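/- Let $G$ be a (real, smooth) semisimple Lie group with finite centre and Lie algebra $\mathfrak g$, let $\theta$ be a Cartan involution of $\mathfrak g$ with fixed point algebra $\mathfrak k$, and let $K\subset G$ be a maximal compact subgroup with Lie algebra $\mathfrak k$; if $G$ is not connected, assume that $K$ meets every connected component of $G$. Let $P\subset G$ be a parabolic subgroup, i.e. a closed subgroup whose Lie algebra is $\mathfrak p=\bigoplus_{i\ge 0}\mathfrak g_i$ for some grading $\mathfrak g=\mathfrak g_{-m}\oplus\dots\oplus\mathfrak g_m$ ($m \ge 0$, $[\mathfrak g_i,\mathfrak g_j]\subset\mathfrak g_{i+j}$) such that $\bigoplus_{i<0}\mathfrak g_i$ is generated by $\mathfrak g_{-1}$. Put $n=\dim(G/P)$ and assume that $G/P$ carries a $G$-invariant orientation, which we fix. Let $M=K\cap P$, with Lie algebra $\mathfrak m$. Let $\mathbb V$ be a finite dimensional real continuous representation of $P$ and $\mathbb W$ a finite dimensional real continuous representation of $K$, with homogeneous vector bundles $V=G\times_P\mathbb V\to G/P$ and $W=G\times_K\mathbb W\to G/K$. On $\mathcal P=G/K\times G/P$ with its projections $\pi_K,\pi_P$ let $E=\pi_K^*W\otimes\pi_P^*V^*$,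 and let $\Omega^{p,q}(\mathcal P,E)$ be the space of smooth $E$-valued forms of degree $p$ in the directions of $G/K$ and degree $q$ in the directions of $G/P$. Let $0\le k\le n$ and $\ell\ge 0$. A linear map $\Phi:\Omega^k(G/P,V)\to\Omega^\ell(G/K,W)$ is called a Poisson transform if it is $G$-equivariant and there is a $\phi\in\Omega^{\ell,n-k}(\mathcal P,E)$ (a kernel of $\Phi$) such that $$\Phi(\alpha)=\int_{G/P}\phi\wedge\pi_P^*\alpha\qquad\text{for all }\alpha\in\Omega^k(G/P,V),$$ where the wedge product is formed via the pairing $E\otimes\pi_P^*V\to\pi_K^*W$ and $\int_{G/P}$ is the fibre integral of the bundle $\pi_K:\mathcal P\to G/K$. Let $\mathbb E=\mathbb W\otimes\mathbb V^*$, an $M$-representation, and let $\Lambda^{\ell,n-k}(\mathfrak g/\mathfrak m)^*$ be the part of bidegree $(\ell,n-k)$ of $\Lambda^{\ell+n-k}(\mathfrak g/\mathfrak m)^*$ with respect to $\mathfrak g/\mathfrak m=\mathfrak p/\mathfrak m\oplus\mathfrak k/\mathfrak m\cong\mathfrak g/\mathfrak k\oplus\mathfrak g/\mathfrak p$. Then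 there is a bijection between the set of Poisson transforms $\Phi:\Omega^k(G/P,V)\to\Omega^\ell(G/K,W)$ and the set of $M$-invariant elements of $\Lambda^{\ell,n-k}(\mathfrak g/\mathfrak m)^*\otimes\mathbb E$. It is given as follows: every kernel $\phi$ of a Poisson transform $\Phi$ is $G$-invariant, and the element that corresponds to $\Phi$ is the value at $eM$ of the pullback of $\phi$ under $G/M\to\mathcal P$, $gM\mapsto(gK,gP)$; conversely, every $M$-invariant element is the value at $eM$ of the pullback of some $G$-invariant form $\phi\in\Omega^{\ell,n-k}(\mathcal P,E)$, which is a kernel of the corresponding Poisson transform. -/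

import Mathlib

open scoped Manifold ContDiff

noncomputable section

namespace PoissonTransform

/-! ### Lie groups, Lie algebras of closed subgroups, adjoint action -/

section LieTheory

variable {d : ℕ} {G : Type*} [TopologicalSpace G] [ChartedSpace (EuclideanSpace ℝ (Fin d)) G]
  [Group G]

variable (d G) in
/-- The Lie algebra `𝔤 = T₁G` of a `d`-dimensional Lie group `G`. -/
abbrev LieAlg : Type := GroupLieAlgebra (𝓡 d) G

/-- A smooth Lie group is regular enough for Mathlib's Lie bracket on `T₁G`. -/
instance lieGroupMinSmoothness [LieGroup (𝓡 d) ∞ G] :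
    LieGroup (𝓡 d) (minSmoothness ℝ 3) G := by
  rw [minSmoothness_of_isRCLikeNormedField]
  infer_instance

/-- The adjoint action `Ad(a) : 𝔤 → 𝔤`, the derivative at `1` of the conjugation by `a`. -/
def Ad (a : G) (X : LieAlg d G) : LieAlg d G :=
  mfderiv (𝓡 d) (𝓡 d) (fun x : G => a * x * a⁻¹) (1 : G) X

/-- The left logarithmic derivative `s(u)⁻¹ · ds(u)v ∈ 𝔤` of a `G`-valued function `s`. -/
def leftLogDeriv {F : Type*} [NormedAddCommGroup F] [NormedSpace ℝ F] (s : F → G) (u v : F) :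
    LieAlg d G :=
  mfderiv 𝓘(ℝ, F) (𝓡 d) (fun u' : F => (s u)⁻¹ * s u') u v

variable (d) in
/-- The Lie algebra `𝔥 ⊆ 𝔤` of a closed subgroup `H` of `G`: the space of velocities at time `0`
of the smooth curves in `G` that start at `1` and stay in `H`. (These velocities already form a
linear subspace.) -/
def lieSub (H : Subgroup G) : Submodule ℝ (LieAlg d G) :=
  Submodule.span ℝ {X | ∃ γ : ℝ → G, ContMDiff 𝓘(ℝ, ℝ) (𝓡 d) ∞ γ ∧ γ 0 = 1 ∧
    (∀ t, γ t ∈ H) ∧ leftLogDeriv γ (0 : ℝ) (1 : ℝ) = X}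

variable (d) in
/-- The class in `𝔤/𝔥` of an element of `𝔤`. -/
abbrev mk (H : Subgroup G) (X : LieAlg d G) : LieAlg d G ⧸ lieSub d H :=
  Submodule.Quotient.mk X

end LieTheory

section Semisimple

variable {d : ℕ} {G : Type*} [TopologicalSpace G] [ChartedSpace (EuclideanSpace ℝ (Fin d)) G]
  [Group G] [LieGroup (𝓡 d) ∞ G]

/-- `θ` is a Cartan involution of `𝔤`: an involutive automorphism for which the bilinear form
`(X, Y) ↦ -B(X, θ Y)` is positive definite, where `B` is the Killing form. -/
def IsCartanInvolution (θ : LieAlg d G ≃ₗ⁅ℝ⁆ LieAlg d G) : Prop :=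
  (∀ X, θ (θ X) = X) ∧ ∀ X, X ≠ 0 → 0 < -killingForm ℝ (LieAlg d G) X (θ X)

variable (d) in
/-- `K` is a maximal compact subgroup of `G` whose Lie algebra `𝔨` is the fixed point algebra of a
Cartan involution. -/
def IsMaximalCompact (K : Subgroup G) : Prop :=
  Maximal (fun H : Subgroup G => IsCompact (H : Set G)) K ∧
    ∃ θ : LieAlg d G ≃ₗ⁅ℝ⁆ LieAlg d G, IsCartanInvolution θ ∧
      ∀ X, X ∈ lieSub d K ↔ θ X = X

/-- `𝔭` is a parabolic subalgebra of `𝔤`: there is a `|m|`-grading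
`𝔤 = 𝔤_{-m} ⊕ ⋯ ⊕ 𝔤_m` such that `⨁_{i<0} 𝔤_i` is generated by `𝔤_{-1}` and
`𝔭 = ⨁_{i≥0} 𝔤_i`. -/
def IsParabolicSubalgebra (𝔭 : Submodule ℝ (LieAlg d G)) : Prop :=
  ∃ (m : ℕ) (𝒢 : ℤ → Submodule ℝ (LieAlg d G)),
    DirectSum.IsInternal 𝒢 ∧
    (∀ i : ℤ, (m : ℤ) < |i| → 𝒢 i = ⊥) ∧
    (∀ i j : ℤ, ∀ X ∈ 𝒢 i, ∀ Y ∈ 𝒢 j, ⁅X, Y⁆ ∈ 𝒢 (i + j)) ∧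
    (LieSubalgebra.lieSpan ℝ (LieAlg d G) (𝒢 (-1) : Set (LieAlg d G))).toSubmodule
      = (⨆ (i : ℤ) (_ : i < 0), 𝒢 i) ∧
    𝔭 = ⨆ (i : ℤ) (_ : 0 ≤ i), 𝒢 i

variable (d) in
/-- `P` is a parabolic subgroup of `G`: a closed subgroup whose Lie algebra is parabolic. -/
def IsParabolic (P : Subgroup G) : Prop :=
  IsClosed (P : Set G) ∧ IsParabolicSubalgebra (lieSub d P)

end Semisimple

/-! ### Differential forms on homogeneous spaces with values in homogeneous bundles

The tangent bundle of `G/H` is `G ×_H (𝔤/𝔥)`, so the bundle of `k`-forms with values in the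
homogeneous bundle `G ×_H V` is `G ×_H (Λᵏ(𝔤/𝔥)* ⊗ V)`. A section of `G ×_H 𝔼` is a smooth function
`f : G → 𝔼` with `f(gh) = h⁻¹ · f(g)` for `h ∈ H`. -/

section Forms

variable {d : ℕ} {G : Type*} [TopologicalSpace G] [ChartedSpace (EuclideanSpace ℝ (Fin d)) G]
  [Group G]
variable {V : Type*} [NormedAddCommGroup V] [NormedSpace ℝ V]
variable {W : Type*} [NormedAddCommGroup W] [NormedSpace ℝ W]

variable (d) in
/-- `η` is a smooth function `G → Λᵏ(𝔤/𝔥)* ⊗ V` such that `η(gh) = h⁻¹ · η(g)` for all `h ∈ H`. -/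
structure IsForm (H : Subgroup G) (ρ : Representation ℝ H V) (k : ℕ)
    (η : G → (LieAlg d G ⧸ lieSub d H) [⋀^Fin k]→ₗ[ℝ] V) : Prop where
  smooth : ∀ Z, ContMDiff (𝓡 d) 𝓘(ℝ, V) ∞ (fun g => η g Z)
  equivariant : ∀ (g : G) (h : H) (X : Fin k → LieAlg d G),
    η (g * h) (fun i => mk d H (X i)) = ρ h⁻¹ (η g (fun i => mk d H (Ad (h : G) (X i))))

variable (d) in
/-- The space `Ωᵏ(G/H, G ×_H V)` of `k`-forms on `G/H` with values in `G ×_H V`. -/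
def Omega (H : Subgroup G) (ρ : Representation ℝ H V) (k : ℕ) :
    Submodule ℝ (G → (LieAlg d G ⧸ lieSub d H) [⋀^Fin k]→ₗ[ℝ] V) where
  carrier := {η | IsForm d H ρ k η}
  zero_mem' := ⟨fun _ => contMDiff_const, fun _ _ _ => by simp⟩
  add_mem' := fun {a b} ha hb => ⟨fun Z => (ha.smooth Z).add (hb.smooth Z), fun g h X => by
    simp only [Pi.add_apply, AlternatingMap.add_apply, ha.equivariant g h X,
      hb.equivariant g h X, map_add]⟩
  smul_mem' := fun c a ha => ⟨fun Z =>
    (contDiff_const_smul c).contMDiff.comp (ha.smooth Z), fun g h X => by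
    simp only [Pi.smul_apply, AlternatingMap.smul_apply, ha.equivariant g h X, map_smul]⟩

/-- The left action of `x ∈ G` on `Ωᵏ(G/H, G ×_H V)`: `(x · η)(g) = η(x⁻¹g)`. -/
def Omega.translate [LieGroup (𝓡 d) ∞ G] {H : Subgroup G} {ρ : Representation ℝ H V} {k : ℕ}
    (x : G) (η : Omega d H ρ k) : Omega d H ρ k :=
  ⟨fun g => η.1 (x⁻¹ * g),
    show IsForm d H ρ k _ from
    { smooth := fun Z => (IsForm.smooth η.2 Z).comp contMDiff_mul_left
      equivariant := fun g h X => by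
        rw [← mul_assoc]; exact IsForm.equivariant η.2 (x⁻¹ * g) h X }⟩

/-- An alternating `r`-form `η` on a space that is the direct sum of subspaces `A` and `B` has
bidegree `(p, r - p)`: it vanishes on every family of vectors of `A ∪ B` of which the number of
those taken from `A` differs from `p`. -/
def HasBidegree {L N : Type*} [AddCommGroup L] [Module ℝ L] [AddCommGroup N] [Module ℝ N]
    {r : ℕ} (A B : Submodule ℝ L) (p : ℕ) (η : L [⋀^Fin r]→ₗ[ℝ] N) : Prop :=
  ∀ (s : Finset (Fin r)) (Z : Fin r → L),
    (∀ i ∈ s, Z i ∈ A) → (∀ i ∉ s, Z i ∈ B) → s.card ≠ p → η Z = 0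

variable (d) in
/-- The tangent representation `𝔤/𝔨 × 𝔤/𝔭` of the product `𝒫 = G/K × G/P = (G × G)/(K × P)`. -/
abbrev TProd (K P : Subgroup G) : Type :=
  (LieAlg d G ⧸ lieSub d K) × (LieAlg d G ⧸ lieSub d P)

/-- `φ ∈ Ω^{ℓ,q}(𝒫, E)`, where `𝒫 = G/K × G/P` and `E = π_K^*(G ×_K W) ⊗ π_P^*(G ×_P V)^*`; here
`W ⊗ V* = Hom(V, W)`, on which `(a, b) ∈ K × P` acts by `T ↦ a ∘ T ∘ b⁻¹`. -/
structure IsKernelForm (K P : Subgroup G) (ρV : Representation ℝ P V) (ρW : Representation ℝ K W)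
    (ℓ q : ℕ) (φ : G × G → TProd d K P [⋀^Fin (ℓ + q)]→ₗ[ℝ] (V →ₗ[ℝ] W)) : Prop where
  smooth : ∀ Z v, ContMDiff ((𝓡 d).prod (𝓡 d)) 𝓘(ℝ, W) ∞ (fun x : G × G => φ x Z v)
  equivariant : ∀ (g₁ g₂ : G) (a : K) (b : P) (X Y : Fin (ℓ + q) → LieAlg d G),
    φ (g₁ * a, g₂ * b) (fun i => (mk d K (X i), mk d P (Y i))) =
      ρW a⁻¹ ∘ₗ
        φ (g₁, g₂) (fun i => (mk d K (Ad (a : G) (X i)), mk d P (Ad (b : G) (Y i)))) ∘ₗ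
          ρV b
  bidegree : ∀ x, HasBidegree (Submodule.prod ⊤ ⊥) (Submodule.prod ⊥ ⊤) ℓ (φ x)

/-- `φ` is invariant under the diagonal left action of `G` on `𝒫 = G/K × G/P`. -/
def IsInvariantForm {S : Type*} (φ : G × G → S) : Prop :=
  ∀ x g₁ g₂ : G, φ (x * g₁, x * g₂) = φ (g₁, g₂)

/-- The wedge product `φ ∧ π_P^*α` at a point of `𝒫`, formed via the pairing
`(W ⊗ V*) ⊗ V → W`. -/
def wedgePullback {K P : Subgroup G} {ℓ q k : ℕ}
    (φ : TProd d K P [⋀^Fin (ℓ + q)]→ₗ[ℝ] (V →ₗ[ℝ] W))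
    (α : (LieAlg d G ⧸ lieSub d P) [⋀^Fin k]→ₗ[ℝ] V) :
    TProd d K P [⋀^Fin (ℓ + (q + k))]→ₗ[ℝ] W :=
  ((TensorProduct.lift (LinearMap.id : (V →ₗ[ℝ] W) →ₗ[ℝ] (V →ₗ[ℝ] W))).compAlternatingMap
    (φ.domCoprod (α.compLinearMap (LinearMap.snd ℝ _ _)))).domDomCongr
      (finSumFinEquiv.trans (finCongr (Nat.add_assoc ℓ q k)))

/-- The restriction of an `(ℓ + n)`-form `ψ` on `A × B` to the fibre direction `B`, after insertion
of vectors `X₁, …, X_ℓ` of `A` into the first `ℓ` entries. -/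
def fibrePart {A B : Type*} [AddCommGroup A] [Module ℝ A] [AddCommGroup B] [Module ℝ B] {ℓ n : ℕ}
    (ψ : (A × B) [⋀^Fin (ℓ + n)]→ₗ[ℝ] W) (X : Fin ℓ → A) (Y : Fin n → B) : W :=
  ψ (Fin.append (fun i => (X i, 0)) (fun j => (0, Y j)))

end Forms

/-! ### Integration of top degree forms over the compact oriented manifold `G/P` -/

section Integration

variable {d : ℕ} {G : Type*} [TopologicalSpace G] [ChartedSpace (EuclideanSpace ℝ (Fin d)) G]
  [Group G]

/-- The derivative of `u ↦ s(u)P ∈ G/P` in the coordinate directions, expressed in `𝔤/𝔭` by means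
of `T(G/P) = G ×_P 𝔤/𝔭`. -/
def coordFrame (P : Subgroup G) {n : ℕ} (s : EuclideanSpace ℝ (Fin n) → G)
    (u : EuclideanSpace ℝ (Fin n)) (i : Fin n) : LieAlg d G ⧸ lieSub d P :=
  mk d P (leftLogDeriv s u (EuclideanSpace.single i 1))

variable (d) in
/-- `s` is smooth on the open set `U ⊆ ℝⁿ`, and `u ↦ s(u)P` is an injective immersion of `U` into
`G/P` (hence, for `n = dim G/P`, the inverse of a chart of `G/P`). -/
structure IsLocalParam (P : Subgroup G) {n : ℕ} (U : Set (EuclideanSpace ℝ (Fin n)))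
    (s : EuclideanSpace ℝ (Fin n) → G) : Prop where
  isOpen : IsOpen U
  smooth : ContMDiffOn 𝓘(ℝ, EuclideanSpace ℝ (Fin n)) (𝓡 d) ∞ s U
  injective : ∀ u ∈ U, ∀ u' ∈ U, (s u)⁻¹ * s u' ∈ P → u = u'
  immersion : ∀ u ∈ U, LinearIndependent ℝ (coordFrame (d := d) P s u)

/-- The orientation `o` of `𝔤/𝔭` is preserved by `Ad(P)`, so that it defines a `G`-invariant
orientation of `G/P`. -/
def IsInvariantOrientation {P : Subgroup G} {n : ℕ}
    (o : Orientation ℝ (LieAlg d G ⧸ lieSub d P) (Fin n)) : Prop :=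
  ∀ a ∈ P, ∀ X : Fin n → LieAlg d G,
    SignType.sign (o.someVector (fun i => mk d P (Ad a (X i)))) =
      SignType.sign (o.someVector (fun i => mk d P (X i)))

/-- `w = ∫_{G/P} η` for an `n`-form `η` on the oriented compact `n`-manifold `G/P` with values in a
fixed vector space, by means of charts `u ↦ s_j(u)P` and a subordinate partition of unity `χ`; the
sign compares a chart with the orientation. -/
def HasIntegral {W : Type*} [NormedAddCommGroup W] [NormedSpace ℝ W] {P : Subgroup G} {n : ℕ}
    (o : Orientation ℝ (LieAlg d G ⧸ lieSub d P) (Fin n))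
    (η : G → (Fin n → LieAlg d G ⧸ lieSub d P) → W) (w : W) : Prop :=
  ∃ (N : ℕ) (U : Fin N → Set (EuclideanSpace ℝ (Fin n)))
    (s : Fin N → EuclideanSpace ℝ (Fin n) → G) (χ : Fin N → G → ℝ),
    (∀ j, IsLocalParam d P (U j) (s j)) ∧
    (∀ j, ContMDiff (𝓡 d) 𝓘(ℝ, ℝ) ∞ (χ j)) ∧
    (∀ j g, ∀ a ∈ P, χ j (g * a) = χ j g) ∧
    (∀ j, ∃ C ⊆ U j, IsCompact C ∧ ∀ g, χ j g ≠ 0 → ∃ u ∈ C, (s j u)⁻¹ * g ∈ P) ∧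
    (∀ g, ∑ j, χ j g = 1) ∧
    w = ∑ j, ∫ u in U j,
      (χ j (s j u) * ((SignType.sign (o.someVector (coordFrame P (s j) u)) : SignType) : ℝ)) •
        η (s j u) (coordFrame P (s j) u)

end Integration

/-! ### Poisson transforms -/

section Transforms

variable {d : ℕ} {G : Type*} [TopologicalSpace G] [ChartedSpace (EuclideanSpace ℝ (Fin d)) G]
  [Group G]
variable {V : Type*} [NormedAddCommGroup V] [NormedSpace ℝ V]
variable {W : Type*} [NormedAddCommGroup W] [NormedSpace ℝ W]
variable {K P : Subgroup G} {ρV : Representation ℝ P V} {ρW : Representation ℝ K W} {k ℓ q : ℕ}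

/-- `Φ(α)` is the fibre integral of `φ ∧ π_P^*α` over `G/P`, for all `α ∈ Ωᵏ(G/P, V)`. -/
def IsIntegralOperator (o : Orientation ℝ (LieAlg d G ⧸ lieSub d P) (Fin (q + k)))
    (φ : G × G → TProd d K P [⋀^Fin (ℓ + q)]→ₗ[ℝ] (V →ₗ[ℝ] W))
    (Φ : Omega d P ρV k →ₗ[ℝ] Omega d K ρW ℓ) : Prop :=
  ∀ (α : Omega d P ρV k) (g₁ : G) (X : Fin ℓ → LieAlg d G ⧸ lieSub d K),
    HasIntegral o (fun g₂ Y => fibrePart (wedgePullback (φ (g₁, g₂)) (α.1 g₂)) X Y)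
      ((Φ α).1 g₁ X)

/-- `Φ : Ωᵏ(G/P, V) → Ω^ℓ(G/K, W)` is a Poisson transform: a `G`-equivariant operator of the form
`α ↦ ∫_{G/P} φ ∧ π_P^*α` for some `φ ∈ Ω^{ℓ,q}(𝒫, E)`, where `q + k = dim G/P`. -/
def IsPoissonTransform [LieGroup (𝓡 d) ∞ G]
    (o : Orientation ℝ (LieAlg d G ⧸ lieSub d P) (Fin (q + k)))
    (Φ : Omega d P ρV k →ₗ[ℝ] Omega d K ρW ℓ) : Prop :=
  (∃ φ : G × G → TProd d K P [⋀^Fin (ℓ + q)]→ₗ[ℝ] (V →ₗ[ℝ] W),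
    IsKernelForm K P ρV ρW ℓ q φ ∧ IsIntegralOperator o φ Φ) ∧
  ∀ (x : G) (α : Omega d P ρV k), Φ (Omega.translate x α) = Omega.translate x (Φ α)

variable (d) in
/-- The `M`-invariant elements of bidegree `(ℓ, q)` of `Λ^{ℓ+q}(𝔤/𝔪)* ⊗ (W ⊗ V*)`, where
`M = K ∩ P` and `W ⊗ V* = Hom(V, W)`. The bidegree refers to `𝔤/𝔪 = 𝔭/𝔪 ⊕ 𝔨/𝔪`, whose summands are
the kernels of the differentials of `π_P : G/M → G/P` and `π_K : G/M → G/K`. -/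
def invariantElements (ρV : Representation ℝ P V) (ρW : Representation ℝ K W) (ℓ q : ℕ) :
    Set ((LieAlg d G ⧸ lieSub d (K ⊓ P)) [⋀^Fin (ℓ + q)]→ₗ[ℝ] (V →ₗ[ℝ] W)) :=
  {φ₀ | HasBidegree ((lieSub d P).map (lieSub d (K ⊓ P)).mkQ)
        ((lieSub d K).map (lieSub d (K ⊓ P)).mkQ) ℓ φ₀ ∧
    ∀ (a : G) (haK : a ∈ K) (haP : a ∈ P) (X : Fin (ℓ + q) → LieAlg d G),
      φ₀ (fun i => mk d (K ⊓ P) (Ad a (X i))) =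
        ρW ⟨a, haK⟩ ∘ₗ φ₀ (fun i => mk d (K ⊓ P) (X i)) ∘ₗ ρV (⟨a, haP⟩ : P)⁻¹}

/-- `φ₀` is the value at the base point `eM` of the pullback of `φ` along the map
`G/M → G/K × G/P`, `gM ↦ (gK, gP)`. -/
def IsBaseValue (φ : G × G → TProd d K P [⋀^Fin (ℓ + q)]→ₗ[ℝ] (V →ₗ[ℝ] W))
    (φ₀ : (LieAlg d G ⧸ lieSub d (K ⊓ P)) [⋀^Fin (ℓ + q)]→ₗ[ℝ] (V →ₗ[ℝ] W)) : Prop :=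
  ∀ X : Fin (ℓ + q) → LieAlg d G,
    φ₀ (fun i => mk d (K ⊓ P) (X i)) = φ (1, 1) (fun i => (mk d K (X i), mk d P (X i)))

end Transforms

end PoissonTransform

end

/-! The group `G` acts transitively on `G/K × G/P` with stabiliser `M = K ∩ P` at the base point,
because `G = KP`. An invariant section of a homogeneous bundle on a homogeneous space is the same
thing as an `M`-invariant vector in the fibre. This classifies the invariant kernels. To classify
operators instead, one also needs that an integral operator determines its kernel, so that
equivariance of `Φ` and invariance of `φ` become equivalent.

Transitivity. If `𝔨 + 𝔭 ≠ 𝔤`, some `Z ≠ 0` is Killing-orthogonal to both. Orthogonality to `𝔭`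
forces `B(Z, Z) = 0` by the grading, and `Z + θZ ∈ 𝔨` gives `B(Z, Z + θZ) = 0`. Hence `B(Z, θZ) =
0`, against the positivity of `-B(·, θ·)` (`sup_eq_top_of_grading`). So `KP` is open; it is closed
because `K` is compact, and `K` meets every component (`exists_factor`). The same splitting yields
smooth local factorisations (`exists_smooth_factor`) and `𝔤/𝔪 ≅ 𝔤/𝔨 × 𝔤/𝔭` (`exists_prodEquiv`).

Existence of kernels. The value at `(g₁, g₂)` is dictated by any factorisation `g₁⁻¹g₂ = ab`. By
`M`-invariance the choice is irrelevant (`kernelAt_mul`), so a locally smooth choice shows that the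
kernel is smooth (`exists_invariant_kernel`).

Integration. After evaluation on a basis of `𝔤/𝔭`, a top form on `G/P` is a density on `G`. Its
chart integrals do not depend on the chart by the change of variables formula (`chartIntegral_eq`),
hence atlas integrals do not depend on the atlas and are invariant under left translations
(`Atlas.integral_eq`, `Atlas.integral_const_mul`).

Uniqueness of kernels. Forms with arbitrary values along a chart, cut off by bump functions, exist
(`exists_testForm`). The fundamental lemma of the calculus of variations and nondegeneracy of the
wedge pairing in complementary degrees (`eq_zero_of_fibrePart_eq_zero`) then show that a kernel with
zero operator vanishes (`eq_zero_of_integral_eq_zero`). A translate of a kernel of an equivariant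
operator is again a kernel of it, so the kernel is invariant.

Underneath lies the theory of closed subgroups, developed from one limit: if `hₙ → 1` and `mₙ(hₙ -
1) → X` in a chart, then `hₙ ^ mₙ` tends to the time-one point of the one-parameter subgroup of `X`
(`tendsto_pow_oneParam`). It identifies `𝔥` with the velocities of one-parameter subgroups inside
`H`, gives local injectivity modulo `H` for transversal maps, hence charts of `G/P` and the
smoothness of continuous representations. -/

open scoped Manifold ContDiff Topology
open Filter MeasureTheory

set_option linter.unusedSectionVars false

noncomputable section

namespace PoissonTransform

/-! ### Logarithmic derivatives and the adjoint action in the chart at the unit -/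

section Calculus

variable {d : ℕ} {G : Type*} [TopologicalSpace G] [ChartedSpace (EuclideanSpace ℝ (Fin d)) G]
  [Group G]
variable {F : Type*} [NormedAddCommGroup F] [NormedSpace ℝ F]
variable {F' : Type*} [NormedAddCommGroup F'] [NormedSpace ℝ F']

/-- The model space of a `d`-dimensional manifold. -/
abbrev Euc (d : ℕ) : Type := EuclideanSpace ℝ (Fin d)

/-- The preferred chart of `G` at the unit. -/
def chart1 (g : G) : Euc d := extChartAt (𝓡 d) (1 : G) g

variable (G) in
/-- The inverse of the preferred chart of `G` at the unit. -/
def par1 (x : Euc d) : G := (extChartAt (𝓡 d) (1 : G)).symm x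

/-- The left logarithmic derivative, computed in the chart at the unit. -/
def logD (f : F → G) (u : F) : F →L[ℝ] Euc d :=
  fderiv ℝ (fun u' => chart1 (d := d) ((f u)⁻¹ * f u')) u

/-- The adjoint action, computed in the chart at the unit. -/
def AdL (a : G) : Euc d →L[ℝ] Euc d :=
  fderiv ℝ (fun x => chart1 (d := d) (a * par1 G x * a⁻¹)) (chart1 (d := d) (1 : G))

variable (d) in
/-- Smoothness at a point of a function from a normed space to `G`. -/
abbrev SmoothAt (f : F → G) (u : F) : Prop := ContMDiffAt 𝓘(ℝ, F) (𝓡 d) ∞ f u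

variable [LieGroup (𝓡 d) ∞ G]

omit [Group G] [LieGroup (𝓡 d) ∞ G] in
theorem mem_chart1_source [Group G] :
    (extChartAt (𝓡 d) (1 : G)).source ∈ 𝓝 (1 : G) := extChartAt_source_mem_nhds _

theorem contMDiffAt_chart1 {g : G} (hg : g ∈ (extChartAt (𝓡 d) (1 : G)).source) :
    ContMDiffAt (𝓡 d) 𝓘(ℝ, Euc d) ∞ (chart1 (d := d) (G := G)) g :=
  contMDiffAt_extChartAt' (by rwa [extChartAt_source] at hg)

theorem contMDiffAt_par1 {x : Euc d} (hx : x ∈ (extChartAt (𝓡 d) (1 : G)).target) :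
    SmoothAt d (par1 G) x :=
  (contMDiffOn_extChartAt_symm (1 : G)).contMDiffAt (extChartAt_target_mem_nhds' hx)

theorem chart1_one_mem : chart1 (d := d) (1 : G) ∈ (extChartAt (𝓡 d) (1 : G)).target :=
  mem_extChartAt_target _

theorem par1_chart1 {g : G} (hg : g ∈ (extChartAt (𝓡 d) (1 : G)).source) :
    par1 G (chart1 (d := d) g) = g := (extChartAt (𝓡 d) (1 : G)).left_inv hg

theorem chart1_par1 {x : Euc d} (hx : x ∈ (extChartAt (𝓡 d) (1 : G)).target) :
    chart1 (par1 G x) = x := (extChartAt (𝓡 d) (1 : G)).right_inv hx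

theorem par1_chart1_one : par1 G (chart1 (d := d) (1 : G)) = 1 :=
  par1_chart1 (mem_extChartAt_source _)

theorem smoothAt_par1_one : SmoothAt d (par1 G) (chart1 (d := d) (1 : G)) :=
  contMDiffAt_par1 chart1_one_mem

theorem contMDiffAt_chart1_one :
    ContMDiffAt (𝓡 d) 𝓘(ℝ, Euc d) ∞ (chart1 (d := d) (G := G)) 1 :=
  contMDiffAt_chart1 (mem_extChartAt_source _)

theorem SmoothAt.chart1 {f : F → G} {u : F} (hf : SmoothAt d f u) (h1 : f u = 1) :
    ContDiffAt ℝ ∞ (fun x => chart1 (d := d) (f x)) u := by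
  rw [← contMDiffAt_iff_contDiffAt]
  have := contMDiffAt_chart1_one (d := d) (G := G)
  rw [← h1] at this
  exact this.comp u hf

theorem SmoothAt.mul {f g : F → G} {u : F} (hf : SmoothAt d f u) (hg : SmoothAt d g u) :
    SmoothAt d (fun x => f x * g x) u := ContMDiffAt.mul hf hg

theorem SmoothAt.inv {f : F → G} {u : F} (hf : SmoothAt d f u) :
    SmoothAt d (fun x => (f x)⁻¹) u := ContMDiffAt.inv hf

omit [LieGroup (𝓡 d) ∞ G] [Group G] in
theorem smoothAt_const {a : G} {u : F} : SmoothAt d (fun _ : F => a) u := contMDiffAt_const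

omit [LieGroup (𝓡 d) ∞ G] [Group G] in
theorem SmoothAt.comp {f : F → G} {τ : F' → F} {u : F'} (hf : SmoothAt d f (τ u))
    (hτ : ContDiffAt ℝ ∞ τ u) : SmoothAt d (fun x => f (τ x)) u :=
  ContMDiffAt.comp (g := f) u hf hτ.contMDiffAt

theorem SmoothAt.logAux {f : F → G} {u : F} (hf : SmoothAt d f u) :
    ContDiffAt ℝ ∞ (fun u' => PoissonTransform.chart1 (d := d) ((f u)⁻¹ * f u')) u :=
  (smoothAt_const.mul hf).chart1 (by simp)

/-- The derivative at a point over the unit, as computed in the chart at the unit. -/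
theorem mfderiv_eq_of_eq_one {f : F → G} {u : F} (hf : SmoothAt d f u) (h1 : f u = 1) (v : F) :
    (mfderiv 𝓘(ℝ, F) (𝓡 d) f u v : Euc d) = fderiv ℝ (fun x => chart1 (d := d) (f x)) u v := by
  have hd : MDifferentiableAt 𝓘(ℝ, F) (𝓡 d) f u := hf.mdifferentiableAt (by simp)
  have h2 : (mfderiv 𝓘(ℝ, F) (𝓡 d) f u : F →L[ℝ] Euc d) =
      fderivWithin ℝ (writtenInExtChartAt 𝓘(ℝ, F) (𝓡 d) u f) (Set.range 𝓘(ℝ, F))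
        (extChartAt 𝓘(ℝ, F) u u) := hd.mfderiv
  have h3 : fderivWithin ℝ (writtenInExtChartAt 𝓘(ℝ, F) (𝓡 d) u f) (Set.range 𝓘(ℝ, F))
        (extChartAt 𝓘(ℝ, F) u u) = fderiv ℝ (fun x => chart1 (d := d) (f x)) u := by
    simp only [writtenInExtChartAt, extChartAt_model_space_eq_id, PartialEquiv.refl_coe,
      PartialEquiv.refl_symm, modelWithCornersSelf_coe, Set.range_id, fderivWithin_univ, h1]
    rfl
  exact congrArg (fun L : F →L[ℝ] Euc d => L v) (h2.trans h3)

theorem leftLogDeriv_eq {f : F → G} {u : F} (hf : SmoothAt d f u) (v : F) :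
    (leftLogDeriv f u v : LieAlg d G) = logD (d := d) f u v :=
  mfderiv_eq_of_eq_one (smoothAt_const.mul hf) (by simp) v

theorem logD_of_eq_one {f : F → G} {u : F} (h1 : f u = 1) :
    logD (d := d) f u = fderiv ℝ (fun x => chart1 (d := d) (f x)) u := by
  simp [logD, h1]

theorem fderiv_par1 :
    fderiv ℝ (fun x => chart1 (d := d) (par1 G x)) (chart1 (d := d) (1 : G)) =
      ContinuousLinearMap.id ℝ _ := by
  have : (fun x => chart1 (d := d) (par1 G x)) =ᶠ[𝓝 (chart1 (d := d) (1 : G))] id := by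
    filter_upwards [extChartAt_target_mem_nhds (I := 𝓡 d) (1 : G)] with x hx
    exact chart1_par1 hx
  rw [this.fderiv_eq, fderiv_id]

theorem Ad_eq (a : G) (X : LieAlg d G) : Ad a X = AdL (d := d) a X := by
  have hc : ContMDiffAt (𝓡 d) (𝓡 d) ∞ (fun x : G => a * x * a⁻¹) 1 :=
    (contMDiffAt_const.mul contMDiffAt_id).mul contMDiffAt_const
  have hd : MDifferentiableAt (𝓡 d) (𝓡 d) (fun x : G => a * x * a⁻¹) 1 :=
    hc.mdifferentiableAt (by simp)
  have h2 : (mfderiv (𝓡 d) (𝓡 d) (fun x : G => a * x * a⁻¹) 1 : Euc d →L[ℝ] Euc d) =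
      fderivWithin ℝ (writtenInExtChartAt (𝓡 d) (𝓡 d) 1 (fun x : G => a * x * a⁻¹))
        (Set.range (𝓡 d)) (extChartAt (𝓡 d) (1 : G) 1) := hd.mfderiv
  have h3 : fderivWithin ℝ (writtenInExtChartAt (𝓡 d) (𝓡 d) 1 (fun x : G => a * x * a⁻¹))
        (Set.range (𝓡 d)) (extChartAt (𝓡 d) (1 : G) 1) = AdL (d := d) a := by
    have h1 : a * 1 * a⁻¹ = 1 := by simp
    simp only [writtenInExtChartAt, modelWithCornersSelf_coe, Set.range_id, fderivWithin_univ,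
      h1]
    rfl
  exact congrArg (fun L : Euc d →L[ℝ] Euc d => L X) (h2.trans h3)

theorem logD_comp {f : F → G} {τ : F' → F} {u : F'} (hf : SmoothAt d f (τ u))
    (hτ : DifferentiableAt ℝ τ u) :
    logD (d := d) (fun x => f (τ x)) u = (logD f (τ u)).comp (fderiv ℝ τ u) :=
  fderiv_comp (g := fun u' => chart1 (d := d) ((f (τ u))⁻¹ * f u')) u
    (hf.logAux.differentiableAt (by simp)) hτ

omit [LieGroup (𝓡 d) ∞ G] in
theorem logD_const_mul (a : G) (f : F → G) (u : F) :
    logD (d := d) (fun x => a * f x) u = logD f u := by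
  simp [logD, mul_assoc]

omit [LieGroup (𝓡 d) ∞ G] in
theorem logD_const (a : G) (u : F) : logD (d := d) (fun _ : F => a) u = 0 := by
  simp [logD]

omit [LieGroup (𝓡 d) ∞ G] in
theorem logD_congr {f g : F → G} {u : F} (h : f =ᶠ[𝓝 u] g) :
    logD (d := d) f u = logD (d := d) g u := by
  unfold logD
  rw [h.eq_of_nhds]
  exact Filter.EventuallyEq.fderiv_eq (h.mono fun x hx => by simp only [hx])

/-- The chart expression of the multiplication of `G` near the unit. -/
theorem fderiv_mul_one {f g : F → G} {u : F} (hf : SmoothAt d f u) (hg : SmoothAt d g u)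
    (hf1 : f u = 1) (hg1 : g u = 1) :
    fderiv ℝ (fun x => chart1 (d := d) (f x * g x)) u =
      fderiv ℝ (fun x => chart1 (d := d) (f x)) u +
        fderiv ℝ (fun x => chart1 (d := d) (g x)) u := by
  set x0 : Euc d := chart1 (d := d) (1 : G)
  let m : Euc d × Euc d → Euc d := fun p => chart1 (d := d) (par1 G p.1 * par1 G p.2)
  have hp1 : SmoothAt d (fun p : Euc d × Euc d => par1 G p.1) (x0, x0) :=
    SmoothAt.comp (τ := Prod.fst) smoothAt_par1_one contDiffAt_fst
  have hp2 : SmoothAt d (fun p : Euc d × Euc d => par1 G p.2) (x0, x0) :=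
    SmoothAt.comp (τ := Prod.snd) smoothAt_par1_one contDiffAt_snd
  have hm : DifferentiableAt ℝ m (x0, x0) :=
    ((hp1.mul hp2).chart1 (by simp [x0, par1_chart1_one])).differentiableAt (by simp)
  have hcf := (hf.chart1 hf1).differentiableAt (n := ∞) (by simp)
  have hcg := (hg.chart1 hg1).differentiableAt (n := ∞) (by simp)
  -- Multiplication restricted to either axis through the unit is the identity, so both partial
  -- derivatives of `m` are identities and its total derivative is addition.
  have hl : ∀ v, fderiv ℝ m (x0, x0) (v, 0) = v := by
    intro v
    have h1 : HasFDerivAt (fun x : Euc d => (x, x0)) (ContinuousLinearMap.inl ℝ _ _) x0 :=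
      hasFDerivAt_prodMk_left x0 x0
    have h2 : fderiv ℝ (fun x => m (x, x0)) x0 = _ :=
      (HasFDerivAt.comp (g := m) (f := fun x => (x, x0)) x0 hm.hasFDerivAt h1).fderiv
    have h3 : (fun x => m (x, x0)) = fun x => chart1 (d := d) (par1 G x) := by
      ext1 x; simp [m, x0, par1_chart1_one]
    rw [h3, fderiv_par1] at h2
    simpa using (congrArg (fun L => L v) h2).symm
  have hr : ∀ v, fderiv ℝ m (x0, x0) (0, v) = v := by
    intro v
    have h1 : HasFDerivAt (fun x : Euc d => (x0, x)) (ContinuousLinearMap.inr ℝ _ _) x0 :=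
      hasFDerivAt_prodMk_right x0 x0
    have h2 : fderiv ℝ (fun x => m (x0, x)) x0 = _ :=
      (HasFDerivAt.comp (g := m) (f := fun x => (x0, x)) x0 hm.hasFDerivAt h1).fderiv
    have h3 : (fun x => m (x0, x)) = fun x => chart1 (d := d) (par1 G x) := by
      ext1 x; simp [m, x0, par1_chart1_one]
    rw [h3, fderiv_par1] at h2
    simpa using (congrArg (fun L => L v) h2).symm
  have hev : (fun x => chart1 (d := d) (f x * g x)) =ᶠ[𝓝 u]
      fun x => m (chart1 (d := d) (f x), chart1 (d := d) (g x)) := by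
    have e1 := hf.continuousAt.preimage_mem_nhds (t := (extChartAt (𝓡 d) (1 : G)).source)
      (by rw [hf1]; exact mem_chart1_source)
    have e2 := hg.continuousAt.preimage_mem_nhds (t := (extChartAt (𝓡 d) (1 : G)).source)
      (by rw [hg1]; exact mem_chart1_source)
    filter_upwards [e1, e2] with x h1 h2
    simp only [m]
    rw [par1_chart1 h1, par1_chart1 h2]
  rw [hev.fderiv_eq]
  have hm' : HasFDerivAt m (fderiv ℝ m (x0, x0))
      (chart1 (d := d) (f u), chart1 (d := d) (g u)) := by
    rw [hf1, hg1]; exact hm.hasFDerivAt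
  have h4 := (HasFDerivAt.comp (g := m) (f := fun x => (chart1 (d := d) (f x), chart1 (d := d) (g x)))
    u hm' (hcf.hasFDerivAt.prodMk hcg.hasFDerivAt)).fderiv
  rw [show (fun x => m (chart1 (d := d) (f x), chart1 (d := d) (g x))) =
    m ∘ fun x => (chart1 (d := d) (f x), chart1 (d := d) (g x)) from rfl, h4]
  ext1 v
  simp only [ContinuousLinearMap.comp_apply, ContinuousLinearMap.prod_apply,
    add_apply]
  rw [← hl (fderiv ℝ (fun x => chart1 (d := d) (f x)) u v),
    ← hr (fderiv ℝ (fun x => chart1 (d := d) (g x)) u v), ← map_add]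
  simp [hl, hr]

theorem fderiv_conj {f : F → G} {u : F} (hf : SmoothAt d f u) (hf1 : f u = 1) (a : G) :
    fderiv ℝ (fun x => chart1 (d := d) (a * f x * a⁻¹)) u =
      (AdL a).comp (fderiv ℝ (fun x => chart1 (d := d) (f x)) u) := by
  have hev : (fun x => chart1 (d := d) (a * f x * a⁻¹)) =ᶠ[𝓝 u]
      fun x => chart1 (d := d) (a * par1 G (chart1 (d := d) (f x)) * a⁻¹) := by
    have e1 := hf.continuousAt.preimage_mem_nhds (t := (extChartAt (𝓡 d) (1 : G)).source)
      (by rw [hf1]; exact mem_chart1_source)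
    filter_upwards [e1] with x h1
    rw [par1_chart1 h1]
  rw [hev.fderiv_eq]
  have hm : DifferentiableAt ℝ (fun x => chart1 (d := d) (a * par1 G x * a⁻¹))
      (chart1 (d := d) (f u)) := by
    rw [hf1]
    exact (((smoothAt_const.mul smoothAt_par1_one).mul smoothAt_const).chart1
      (by simp [par1_chart1_one])).differentiableAt (by simp)
  have := fderiv_comp u hm ((hf.chart1 hf1).differentiableAt (by simp))
  rw [hf1] at this
  exact this

/-- Normalised at `u`, the product `fg` splits as the conjugate of the normalised `f` by `g(u)⁻¹`
times the normalised `g`. Both factors pass through the unit, where multiplication linearises to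
addition. -/
theorem logD_mul {f g : F → G} {u : F} (hf : SmoothAt d f u) (hg : SmoothAt d g u) :
    logD (d := d) (fun x => f x * g x) u = (AdL (g u)⁻¹).comp (logD f u) + logD g u := by
  have h1 : (fun u' => chart1 (d := d) ((f u * g u)⁻¹ * (f u' * g u'))) = fun u' =>
      chart1 (d := d) (((g u)⁻¹ * ((f u)⁻¹ * f u') * (g u)⁻¹⁻¹) * ((g u)⁻¹ * g u')) := by
    ext1 u'; congr 1; group
  unfold logD
  rw [h1, fderiv_mul_one ((smoothAt_const.mul (smoothAt_const.mul hf)).mul smoothAt_const)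
    (smoothAt_const.mul hg) (by simp) (by simp),
    fderiv_conj (smoothAt_const.mul hf) (by simp)]

theorem logD_conj {f : F → G} {u : F} (hf : SmoothAt d f u) (a : G) :
    logD (d := d) (fun x => a * f x * a⁻¹) u = (AdL a).comp (logD f u) := by
  have h1 : (fun u' => chart1 (d := d) ((a * f u * a⁻¹)⁻¹ * (a * f u' * a⁻¹))) = fun u' =>
      chart1 (d := d) (a * ((f u)⁻¹ * f u') * a⁻¹) := by
    ext1 u'; congr 1; group
  unfold logD
  rw [h1, fderiv_conj (smoothAt_const.mul hf) (by simp)]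

theorem AdL_one : AdL (d := d) (1 : G) = ContinuousLinearMap.id ℝ _ := by
  simp [AdL, fderiv_par1]

theorem AdL_mul (a b : G) : AdL (d := d) (a * b) = (AdL (d := d) a).comp (AdL (d := d) b) := by
  have h1 : (fun x : Euc d => chart1 (d := d) (a * b * par1 G x * (a * b)⁻¹)) = fun x =>
      chart1 (d := d) (a * (b * par1 G x * b⁻¹) * a⁻¹) := by
    ext1 u'; congr 1; group
  unfold AdL
  rw [h1, fderiv_conj ((smoothAt_const.mul smoothAt_par1_one).mul smoothAt_const)
    (by simp [par1_chart1_one])]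
  rfl

/-- Near the unit this is smooth dependence of a derivative on a parameter; elsewhere `Ad(g) =
Ad(g₀) Ad(g₀⁻¹g)` reduces to that case. -/
theorem contMDiff_AdL : ContMDiff (𝓡 d) 𝓘(ℝ, Euc d →L[ℝ] Euc d) ∞ (AdL (d := d) (G := G)) := by
  set x0 : Euc d := chart1 (d := d) (1 : G)
  have hloc : ContDiffAt ℝ ∞ (fun y : Euc d => AdL (d := d) (par1 G y)) x0 := by
    have hp1 : SmoothAt d (fun p : Euc d × Euc d => par1 G p.1) (x0, x0) :=
      SmoothAt.comp (τ := Prod.fst) smoothAt_par1_one contDiffAt_fst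
    have hp2 : SmoothAt d (fun p : Euc d × Euc d => par1 G p.2) (x0, x0) :=
      SmoothAt.comp (τ := Prod.snd) smoothAt_par1_one contDiffAt_snd
    have h := ((hp1.mul hp2).mul hp1.inv).chart1 (by simp [x0, par1_chart1_one])
    exact ContDiffAt.fderiv (f := fun y x => chart1 (d := d) (par1 G y * par1 G x * (par1 G y)⁻¹))
      (g := fun _ => x0) (n := ∞) (m := ∞) h contDiffAt_const (by simp)
  intro g0
  have h1 : ContMDiffAt (𝓡 d) 𝓘(ℝ, Euc d →L[ℝ] Euc d) ∞
      (fun g => AdL (d := d) (par1 G (chart1 (d := d) (g0⁻¹ * g)))) g0 := by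
    have hc : ContMDiffAt (𝓡 d) 𝓘(ℝ, Euc d) ∞ (fun g => chart1 (d := d) (g0⁻¹ * g)) g0 := by
      have := contMDiffAt_chart1_one (d := d) (G := G)
      rw [← inv_mul_cancel g0] at this
      exact ContMDiffAt.comp (g := chart1 (d := d)) (f := fun g => g0⁻¹ * g) g0 this
        (contMDiff_mul_left.contMDiffAt)
    have hl' : ContMDiffAt 𝓘(ℝ, Euc d) 𝓘(ℝ, Euc d →L[ℝ] Euc d) ∞
        (fun y : Euc d => AdL (d := d) (par1 G y)) (chart1 (d := d) (g0⁻¹ * g0)) := by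
      rw [inv_mul_cancel]; exact hloc.contMDiffAt
    exact ContMDiffAt.comp (g := fun y : Euc d => AdL (d := d) (par1 G y)) g0 hl' hc
  have h2 : ContMDiffAt (𝓡 d) 𝓘(ℝ, Euc d →L[ℝ] Euc d) ∞
      (fun g => (AdL (d := d) g0).comp (AdL (d := d) (par1 G (chart1 (d := d) (g0⁻¹ * g))))) g0 :=
    ContMDiffAt.clm_comp contMDiffAt_const h1
  refine h2.congr_of_eventuallyEq ?_
  have hc : ContinuousAt (fun g => g0⁻¹ * g) g0 :=
    (contMDiff_mul_left (I := 𝓡 d) (n := ∞) (a := g0⁻¹)).continuous.continuousAt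
  have := hc.preimage_mem_nhds (t := (extChartAt (𝓡 d) (1 : G)).source)
    (by rw [inv_mul_cancel]; exact mem_chart1_source)
  filter_upwards [this] with g hg
  rw [par1_chart1 hg, ← AdL_mul]
  simp

theorem SmoothAt.logD {f : F → G} {u : F} (hf : SmoothAt d f u) :
    ContDiffAt ℝ ∞ (fun x => logD (d := d) f x) u := by
  have hp1 : SmoothAt d (fun p : F × F => f p.1) (u, u) :=
    SmoothAt.comp (f := f) (τ := Prod.fst) hf contDiffAt_fst
  have hp2 : SmoothAt d (fun p : F × F => f p.2) (u, u) :=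
    SmoothAt.comp (f := f) (τ := Prod.snd) hf contDiffAt_snd
  have h := (hp1.inv.mul hp2).chart1 (by simp)
  exact ContDiffAt.fderiv (f := fun y x => PoissonTransform.chart1 (d := d) ((f y)⁻¹ * f x))
      (g := fun x => x) (n := ∞) (m := ∞) h contDiffAt_id (by simp)

end Calculus

/-! ### One-parameter subgroups as integral curves of left-invariant fields -/

section OneParameterSubgroups

variable {d : ℕ} {G : Type*} [TopologicalSpace G] [ChartedSpace (EuclideanSpace ℝ (Fin d)) G]
  [Group G] [LieGroup (𝓡 d) ∞ G]

theorem mfderiv_mul_left_mulInvariantVectorField (g h : G) (X : LieAlg d G) :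
    mfderiv (𝓡 d) (𝓡 d) (g * ·) h (mulInvariantVectorField X h) =
      mulInvariantVectorField X (g * h) := by
  have h1 : ∀ a b : G, MDifferentiableAt (𝓡 d) (𝓡 d) (a * ·) b := fun a b =>
    (contMDiff_mul_left (n := ∞)).contMDiffAt.mdifferentiableAt (by simp)
  have h2 := mfderiv_comp_apply (I := 𝓡 d) (I' := 𝓡 d) (I'' := 𝓡 d) (f := fun x : G => h * x)
    (g := fun x : G => g * x) (1 : G) (h1 _ _) (h1 _ _) X
  have h3 : (fun x : G => g * x) ∘ (fun x : G => h * x) = fun x => g * h * x := by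
    ext x; simp [mul_assoc]
  have h4 : ∀ h' : G, h' = h → ∀ Y : Euc d,
      (mfderiv (𝓡 d) (𝓡 d) (g * ·) h : Euc d →L[ℝ] Euc d) Y =
      (mfderiv (𝓡 d) (𝓡 d) (g * ·) h' : Euc d →L[ℝ] Euc d) Y := by
    rintro _ rfl _; rfl
  rw [h3] at h2
  exact (h4 (h * 1) (mul_one h) _).trans h2.symm

theorem IsMIntegralCurveOn.mul_left {γ : ℝ → G} {X : LieAlg d G} {s : Set ℝ}
    (hγ : IsMIntegralCurveOn (I := 𝓡 d) γ (mulInvariantVectorField X) s) (g : G) :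
    IsMIntegralCurveOn (I := 𝓡 d) (fun t => g * γ t) (mulInvariantVectorField X) s := by
  intro t ht
  have h1 : HasMFDerivAt (𝓡 d) (𝓡 d) (g * ·) (γ t) (mfderiv (𝓡 d) (𝓡 d) (g * ·) (γ t)) :=
    ((contMDiff_mul_left (n := ∞)).contMDiffAt.mdifferentiableAt (by simp)).hasMFDerivAt
  have h2 := h1.comp_hasMFDerivWithinAt t (hγ t ht)
  have h3 := mfderiv_mul_left_mulInvariantVectorField g (γ t) X
  have h4 : ContinuousLinearMap.smulRight (1 : ℝ →L[ℝ] ℝ)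
        (mulInvariantVectorField X (g * γ t) : Euc d) =
      (mfderiv (𝓡 d) (𝓡 d) (g * ·) (γ t) : Euc d →L[ℝ] Euc d).comp
        (ContinuousLinearMap.smulRight (1 : ℝ →L[ℝ] ℝ)
          (mulInvariantVectorField X (γ t) : Euc d)) := by
    refine ContinuousLinearMap.ext fun c => ?_
    rw [ContinuousLinearMap.comp_apply, ContinuousLinearMap.smulRight_apply,
      ContinuousLinearMap.smulRight_apply, map_smul]
    exact congrArg (fun Y : Euc d => ((1 : ℝ →L[ℝ] ℝ) c : ℝ) • Y) h3.symm
  exact (congrArg (fun L : ℝ →L[ℝ] Euc d =>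
    HasMFDerivWithinAt 𝓘(ℝ, ℝ) (𝓡 d) (fun t => g * γ t) s t L) h4).mpr h2

theorem IsMIntegralCurve.mul_left {γ : ℝ → G} {X : LieAlg d G}
    (hγ : IsMIntegralCurve (I := 𝓡 d) γ (mulInvariantVectorField X)) (g : G) :
    IsMIntegralCurve (I := 𝓡 d) (fun t => g * γ t) (mulInvariantVectorField X) := by
  rw [isMIntegralCurve_iff_isMIntegralCurveOn] at hγ ⊢
  exact IsMIntegralCurveOn.mul_left hγ g

theorem contMDiff_one_mulInvariantVectorField (X : LieAlg d G) :
    ContMDiff (𝓡 d) (𝓡 d).tangent 1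
      (fun g : G => (⟨g, mulInvariantVectorField X g⟩ : TangentBundle (𝓡 d) G)) := by
  refine (contMDiff_mulInvariantVectorField (I := 𝓡 d) X).of_le ?_
  rw [minSmoothness_of_isRCLikeNormedField]; norm_num

/-- Left translates of one short integral curve through `1` give integral curves through every point
on the same interval `(-ε, ε)`. This uniform lifetime yields a global curve. -/
theorem exists_oneParam [T2Space G] (X : Euc d) : ∃ γ : ℝ → G, Continuous γ ∧ γ 0 = 1 ∧
    (∀ s t, γ (s + t) = γ s * γ t) ∧ HasDerivAt (fun t => chart1 (d := d) (γ t)) X 0 := by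
  let v : (g : G) → TangentSpace (𝓡 d) g := mulInvariantVectorField (I := 𝓡 d) (X : LieAlg d G)
  have hv := contMDiff_one_mulInvariantVectorField (G := G) (X : LieAlg d G)
  obtain ⟨β, hβ0, hβ⟩ := exists_isMIntegralCurveAt_of_contMDiffAt_boundaryless (I := 𝓡 d) 0
    (hv.contMDiffAt (x := (1 : G)))
  obtain ⟨ε, hε, hβ⟩ := isMIntegralCurveAt_iff'.1 hβ
  rw [Real.ball_eq_Ioo, zero_sub, zero_add] at hβ
  obtain ⟨γ, hγ0, hγ⟩ := exists_isMIntegralCurve_of_isMIntegralCurveOn (I := 𝓡 d) hv hε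
    (fun g => ⟨fun t => g * β t, by simp [hβ0], IsMIntegralCurveOn.mul_left hβ g⟩) (1 : G)
  refine ⟨γ, hγ.continuous, hγ0, fun s t => ?_, ?_⟩
  -- Time shift and left translation both preserve integral curves of the left-invariant field, and
  -- the two curves agree at time `0`; uniqueness is the homomorphism law.
  · have h1 : (γ ∘ fun x => x + s) = fun t => γ s * γ t :=
      isMIntegralCurve_Ioo_eq_of_contMDiff_boundaryless (t₀ := 0) hv (hγ.comp_add s)
        (IsMIntegralCurve.mul_left hγ (γ s)) (by simp [hγ0])
    have := congrFun h1 t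
    simpa [add_comm] using this
  · have h1 : HasMFDerivAt 𝓘(ℝ, ℝ) (𝓡 d) γ 0
      (ContinuousLinearMap.smulRight (1 : ℝ →L[ℝ] ℝ) (mulInvariantVectorField X (γ 0))) := hγ 0
    have h2 : HasFDerivWithinAt (writtenInExtChartAt 𝓘(ℝ, ℝ) (𝓡 d) (0 : ℝ) γ)
      (ContinuousLinearMap.smulRight (1 : ℝ →L[ℝ] ℝ)
        (mulInvariantVectorField (X : LieAlg d G) (γ 0) : Euc d))
      (Set.range 𝓘(ℝ, ℝ)) (extChartAt 𝓘(ℝ, ℝ) (0 : ℝ) 0) := h1.2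
    have h3 : ∀ g : G, g = 1 → (mulInvariantVectorField (I := 𝓡 d) (X : LieAlg d G) g : Euc d) = X := by
      rintro _ rfl
      have : (fun x : G => 1 * x) = id := by ext x; simp
      have h5 : (mfderiv (𝓡 d) (𝓡 d) (fun x : G => 1 * x) 1 : Euc d →L[ℝ] Euc d) =
          ContinuousLinearMap.id ℝ (Euc d) := by rw [this]; exact mfderiv_id
      exact congrArg (fun L : Euc d →L[ℝ] Euc d => L X) h5
    rw [h3 _ hγ0] at h2
    simp only [writtenInExtChartAt, extChartAt_model_space_eq_id, PartialEquiv.refl_coe,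
      PartialEquiv.refl_symm, modelWithCornersSelf_coe, Set.range_id, hγ0,
      hasFDerivWithinAt_univ] at h2
    have := h2.hasDerivAt
    simpa [chart1, Function.comp_def] using this

variable [T2Space G]

/-- The one-parameter subgroup of `G` with initial velocity `X`. -/
def oneParam (X : Euc d) : ℝ → G := (exists_oneParam (G := G) X).choose

theorem continuous_oneParam (X : Euc d) : Continuous (oneParam (G := G) X) :=
  (exists_oneParam (G := G) X).choose_spec.1

@[simp]
theorem oneParam_zero (X : Euc d) : oneParam (G := G) X 0 = 1 :=
  (exists_oneParam (G := G) X).choose_spec.2.1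

theorem oneParam_add (X : Euc d) (s t : ℝ) :
    oneParam (G := G) X (s + t) = oneParam X s * oneParam X t :=
  (exists_oneParam (G := G) X).choose_spec.2.2.1 s t

theorem hasDerivAt_oneParam (X : Euc d) :
    HasDerivAt (fun t => chart1 (d := d) (oneParam (G := G) X t)) X 0 :=
  (exists_oneParam (G := G) X).choose_spec.2.2.2

theorem oneParam_neg (X : Euc d) (t : ℝ) : oneParam (G := G) X (-t) = (oneParam X t)⁻¹ := by
  rw [eq_inv_iff_mul_eq_one, ← oneParam_add]; simp

theorem oneParam_natMul (X : Euc d) (n : ℕ) (t : ℝ) :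
    oneParam (G := G) X (n * t) = oneParam X t ^ n := by
  induction n with
  | zero => simp
  | succ n ih => rw [Nat.cast_succ, add_mul, one_mul, oneParam_add, ih, pow_succ]

/-- Bootstrapping: in the chart the curve solves `f' = Y(f)` with `Y` the smooth coordinate
expression of the left-invariant field, so each order of smoothness of `f` gives the next one. -/
theorem smoothAt_oneParam_zero (X : Euc d) : SmoothAt d (oneParam (G := G) X) 0 := by
  set x0 : Euc d := chart1 (d := d) (1 : G)
  set f : ℝ → Euc d := fun t => chart1 (d := d) (oneParam (G := G) X t) with hf
  let Y : Euc d → Euc d := fun x => fderiv ℝ (fun y => chart1 (d := d) (par1 G x * par1 G y)) x0 X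
  have hY : ∀ x ∈ (extChartAt (𝓡 d) (1 : G)).target, ContDiffAt ℝ ∞ Y x := by
    intro x hx
    have hp1 : SmoothAt d (fun p : Euc d × Euc d => par1 G p.1) (x, x0) :=
      SmoothAt.comp (f := par1 G) (τ := Prod.fst) (contMDiffAt_par1 hx) contDiffAt_fst
    have hp2 : SmoothAt d (fun p : Euc d × Euc d => par1 G p.2) (x, x0) :=
      SmoothAt.comp (f := par1 G) (τ := Prod.snd) smoothAt_par1_one contDiffAt_snd
    have h : ContDiffAt ℝ ∞ (fun p : Euc d × Euc d => chart1 (d := d) (par1 G p.1 * par1 G p.2))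
        (x, x0) := by
      rw [← contMDiffAt_iff_contDiffAt]
      refine ContMDiffAt.comp (g := chart1 (d := d)) (x, x0) (contMDiffAt_chart1 ?_)
        (SmoothAt.mul hp1 hp2)
      simp only [x0, par1_chart1_one, mul_one]
      exact (extChartAt (𝓡 d) (1 : G)).map_target hx
    exact (ContDiffAt.fderiv (f := fun x y => chart1 (d := d) (par1 G x * par1 G y))
      (g := fun _ => x0) (n := ∞) (m := ∞) h contDiffAt_const (by simp)).clm_apply contDiffAt_const
  set S : Set ℝ := (oneParam (G := G) X) ⁻¹' (extChartAt (𝓡 d) (1 : G)).source with hS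
  have hSo : IsOpen S := (isOpen_extChartAt_source (1 : G)).preimage (continuous_oneParam X)
  have h0S : (0 : ℝ) ∈ S := by simp [hS]
  have hder : ∀ t ∈ S, HasDerivAt f (Y (f t)) t := by
    intro t ht
    -- The homomorphism law transports the known derivative at time `0` to time `t`.
    have h1 : HasDerivAt (fun s => f (t + s)) (Y (f t)) 0 := by
      have hev : (fun s => f (t + s)) =ᶠ[𝓝 0]
          fun s => chart1 (d := d) (par1 G (f t) * par1 G (f s)) := by
        filter_upwards [hSo.mem_nhds h0S] with s hs
        simp only [hf, oneParam_add]
        rw [par1_chart1 ht, par1_chart1 hs]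
      have hd : DifferentiableAt ℝ (fun y => chart1 (d := d) (par1 G (f t) * par1 G y)) (f 0) := by
        have h2 : SmoothAt d (fun y => par1 G (f t) * par1 G y) (f 0) := by
          refine smoothAt_const.mul ?_
          simp only [hf, oneParam_zero]
          exact smoothAt_par1_one
        have h3 : ContMDiffAt 𝓘(ℝ, Euc d) 𝓘(ℝ, Euc d) ∞
            (fun y => chart1 (d := d) (par1 G (f t) * par1 G y)) (f 0) := by
          refine ContMDiffAt.comp (g := chart1 (d := d)) (f 0) (contMDiffAt_chart1 ?_) h2
          simp only [hf, oneParam_zero, par1_chart1_one, mul_one]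
          rw [par1_chart1 ht]; exact ht
        exact (contMDiffAt_iff_contDiffAt.1 h3).differentiableAt (by simp)
      have h4 := hd.hasFDerivAt.comp_hasDerivAt 0 (hasDerivAt_oneParam (G := G) X)
      have h5 : f 0 = x0 := by simp [hf, x0]
      rw [h5] at h4
      exact h4.congr_of_eventuallyEq hev
    rw [← sub_self t] at h1
    simpa using h1.comp_sub_const t t
  have hdiff : DifferentiableOn ℝ f S := fun t ht => (hder t ht).differentiableAt.differentiableWithinAt
  have hsm : ∀ n : ℕ, ContDiffOn ℝ n f S := by
    intro n
    induction n with
    | zero => exact contDiffOn_zero.2 hdiff.continuousOn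
    | succ n ih =>
      rw [Nat.cast_succ, contDiffOn_succ_iff_deriv_of_isOpen hSo]
      refine ⟨hdiff, by simp, ?_⟩
      have : ContDiffOn ℝ n (fun t => Y (f t)) S := by
        intro t ht
        refine ContDiffAt.comp_contDiffWithinAt t ((hY (f t) ?_).of_le (by exact_mod_cast le_top)) (ih t ht)
        exact (extChartAt (𝓡 d) (1 : G)).map_source ht
      exact this.congr fun t ht => (hder t ht).deriv
  have hf0 : ContDiffAt ℝ ∞ f 0 :=
    (contDiffOn_infty.2 hsm).contDiffAt (hSo.mem_nhds h0S)
  have h6 : SmoothAt d (fun t => par1 G (f t)) 0 := by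
    refine SmoothAt.comp ?_ hf0
    simp only [hf, oneParam_zero]; exact smoothAt_par1_one
  refine h6.congr_of_eventuallyEq ?_
  filter_upwards [hSo.mem_nhds h0S] with s hs
  exact (par1_chart1 hs).symm

theorem smoothAt_oneParam (X : Euc d) (t : ℝ) : SmoothAt d (oneParam (G := G) X) t := by
  have h1 : SmoothAt d (fun s => oneParam (G := G) X t * oneParam X (s - t)) t := by
    refine smoothAt_const.mul (SmoothAt.comp (τ := fun s => s - t) ?_ (by fun_prop))
    rw [sub_self]; exact smoothAt_oneParam_zero X
  refine h1.congr_of_eventuallyEq (Filter.Eventually.of_forall fun s => ?_)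
  simp only [← oneParam_add]; congr 1; ring

theorem logD_oneParam (X : Euc d) (t : ℝ) : logD (d := d) (oneParam (G := G) X) t 1 = X := by
  have h1 : (fun u => chart1 (d := d) ((oneParam (G := G) X t)⁻¹ * oneParam X u)) =
      fun u => chart1 (d := d) (oneParam (G := G) X (u - t)) := by
    ext1 u
    rw [← oneParam_neg, ← oneParam_add]; congr 2; ring
  have h2 := hasDerivAt_oneParam (G := G) X
  rw [← sub_self t] at h2
  have h3 := (h2.comp_sub_const t t).deriv
  rw [logD, h1, fderiv_apply_one_eq_deriv, h3]

end OneParameterSubgroups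

/-! ### Powers of group elements converging to a one-parameter subgroup -/

section LimitLemma

variable {d : ℕ} {G : Type*} [TopologicalSpace G] [ChartedSpace (EuclideanSpace ℝ (Fin d)) G]
  [Group G] [LieGroup (𝓡 d) ∞ G]

/-- The distance to the unit in the chart at the unit. -/
def size (g : G) : ℝ := ‖chart1 (d := d) g - chart1 (d := d) (1 : G)‖

variable (d G) in
/-- The neighbourhood of size `r` of the unit. -/
def SmallNhd (r : ℝ) : Set G := {g | g ∈ (extChartAt (𝓡 d) (1 : G)).source ∧ size (d := d) g < r}

theorem size_nonneg (g : G) : 0 ≤ size (d := d) g := norm_nonneg _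

theorem size_one : size (d := d) (1 : G) = 0 := by simp [size]

theorem one_mem_smallNhd {r : ℝ} (hr : 0 < r) : (1 : G) ∈ SmallNhd d G r :=
  ⟨mem_extChartAt_source _, by rwa [size_one]⟩

theorem smallNhd_mem_nhds {r : ℝ} (hr : 0 < r) : SmallNhd d G r ∈ 𝓝 (1 : G) := by
  refine inter_mem mem_chart1_source ?_
  have h : ContinuousAt (size (d := d) (G := G)) 1 :=
    ((contMDiffAt_chart1_one (d := d) (G := G)).continuousAt.sub continuousAt_const).norm
  exact h.eventually_lt continuousAt_const (by rwa [size_one])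

theorem tendsto_one_of_size {ι : Type*} {l : Filter ι} {g : ι → G}
    (hs : ∀ᶠ i in l, g i ∈ (extChartAt (𝓡 d) (1 : G)).source)
    (h0 : Tendsto (fun i => size (d := d) (g i)) l (𝓝 0)) : Tendsto g l (𝓝 1) := by
  have h1 : Tendsto (fun i => chart1 (d := d) (g i)) l (𝓝 (chart1 (d := d) (1 : G))) :=
    tendsto_iff_norm_sub_tendsto_zero.2 h0
  have h2 := (smoothAt_par1_one (d := d) (G := G)).continuousAt.tendsto.comp h1
  rw [par1_chart1_one] at h2
  refine h2.congr' ?_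
  filter_upwards [hs] with i hi
  exact par1_chart1 hi

theorem exists_lipschitz_of_smooth {F : Type*} [NormedAddCommGroup F] [NormedSpace ℝ F]
    {f : F → G} {u : F} (hf : SmoothAt d f u) (h1 : f u = 1) :
    ∃ C : ℝ, 0 ≤ C ∧ ∃ r > 0, ∀ x ∈ Metric.ball u r, f x ∈ (extChartAt (𝓡 d) (1 : G)).source ∧
      ∀ y ∈ Metric.ball u r, ‖chart1 (d := d) (f x) - chart1 (d := d) (f y)‖ ≤ C * ‖x - y‖ := by
  obtain ⟨C, t, ht, hL⟩ := ((hf.chart1 h1).of_le (by simp)).exists_lipschitzOnWith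
  have h2 := hf.continuousAt.preimage_mem_nhds (t := (extChartAt (𝓡 d) (1 : G)).source)
    (by rw [h1]; exact mem_chart1_source)
  obtain ⟨r, hr, h⟩ := Metric.mem_nhds_iff.1 (inter_mem ht h2)
  refine ⟨C, C.2, r, hr, fun x hx => ⟨(h hx).2, fun y hy => ?_⟩⟩
  have := hL.dist_le_mul x (h hx).1 y (h hy).1
  rwa [dist_eq_norm, dist_eq_norm] at this

/-- The coefficient of `size a` is exactly `1`, because `a * b` is compared with `a * 1`. In a
product of many small factors the errors therefore add up instead of growing geometrically. -/
theorem exists_size_mul_le : ∃ C : ℝ, 0 ≤ C ∧ ∃ r > 0, ∀ a ∈ SmallNhd d G r,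
    ∀ b ∈ SmallNhd d G r, a * b ∈ (extChartAt (𝓡 d) (1 : G)).source ∧
      size (d := d) (a * b) ≤ size (d := d) a + C * size (d := d) b := by
  set x0 : Euc d := chart1 (d := d) (1 : G) with hx0
  have hp1 : SmoothAt d (fun p : Euc d × Euc d => par1 G p.1) (x0, x0) :=
    SmoothAt.comp (τ := Prod.fst) smoothAt_par1_one contDiffAt_fst
  have hp2 : SmoothAt d (fun p : Euc d × Euc d => par1 G p.2) (x0, x0) :=
    SmoothAt.comp (τ := Prod.snd) smoothAt_par1_one contDiffAt_snd
  obtain ⟨C, hC, r, hr, h⟩ := exists_lipschitz_of_smooth (hp1.mul hp2)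
    (by simp [hx0, par1_chart1_one])
  refine ⟨C, hC, r, hr, fun a ha b hb => ?_⟩
  have hball : ∀ b ∈ SmallNhd d G r, (chart1 (d := d) a, chart1 (d := d) b) ∈
      Metric.ball (x0, x0) r := by
    intro b hb
    rw [Metric.mem_ball, Prod.dist_eq, dist_eq_norm, dist_eq_norm]
    exact max_lt ha.2 hb.2
  have h1 := h _ (hball b hb)
  have h2 := h1.2 _ (hball 1 (one_mem_smallNhd hr))
  simp only [par1_chart1 ha.1, par1_chart1 hb.1, par1_chart1_one, mul_one] at h1 h2
  refine ⟨h1.1, ?_⟩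
  have h3 : ‖(chart1 (d := d) a, chart1 (d := d) b) - (chart1 (d := d) a, chart1 (d := d) (1 : G))‖
      = size (d := d) b := by
    simp [Prod.norm_def, size]
  rw [h3] at h2
  calc size (d := d) (a * b) = ‖(chart1 (d := d) a - x0) +
      (chart1 (d := d) (a * b) - chart1 (d := d) a)‖ := by rw [size]; congr 1; abel
    _ ≤ _ := (norm_add_le _ _).trans (by gcongr; exact le_rfl)

theorem exists_size_mul_inv_le : ∃ C : ℝ, 0 ≤ C ∧ ∃ r > 0, ∀ a ∈ SmallNhd d G r,
    ∀ b ∈ SmallNhd d G r, a * b⁻¹ ∈ (extChartAt (𝓡 d) (1 : G)).source ∧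
      size (d := d) (a * b⁻¹) ≤ C * ‖chart1 (d := d) a - chart1 (d := d) b‖ := by
  set x0 : Euc d := chart1 (d := d) (1 : G) with hx0
  have hp1 : SmoothAt d (fun p : Euc d × Euc d => par1 G p.1) (x0, x0) :=
    SmoothAt.comp (τ := Prod.fst) smoothAt_par1_one contDiffAt_fst
  have hp2 : SmoothAt d (fun p : Euc d × Euc d => par1 G p.2) (x0, x0) :=
    SmoothAt.comp (τ := Prod.snd) smoothAt_par1_one contDiffAt_snd
  obtain ⟨C, hC, r, hr, h⟩ := exists_lipschitz_of_smooth (hp1.mul hp2.inv)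
    (by simp [hx0, par1_chart1_one])
  refine ⟨C, hC, r, hr, fun a ha b hb => ?_⟩
  have hball : ∀ a ∈ SmallNhd d G r, (chart1 (d := d) a, chart1 (d := d) b) ∈
      Metric.ball (x0, x0) r := by
    intro a ha
    rw [Metric.mem_ball, Prod.dist_eq, dist_eq_norm, dist_eq_norm]
    exact max_lt ha.2 hb.2
  have h1 := h _ (hball a ha)
  have h2 := h1.2 _ (hball b hb)
  simp only [par1_chart1 ha.1, par1_chart1 hb.1, mul_inv_cancel] at h1 h2
  refine ⟨h1.1, h2.trans_eq ?_⟩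
  simp [Prod.norm_def]

/-- For each `t` a Lipschitz bound holds near `(t, 1)`; compactness of `[0, 1]` makes the constant
and the radius uniform. -/
theorem exists_size_conj_le [T2Space G] (X : Euc d) : ∃ C : ℝ, 0 ≤ C ∧ ∃ r > 0,
    ∀ t ∈ Set.Icc (0 : ℝ) 1, ∀ b ∈ SmallNhd d G r,
      oneParam X t * b * (oneParam X t)⁻¹ ∈ (extChartAt (𝓡 d) (1 : G)).source ∧
      size (d := d) (oneParam X t * b * (oneParam X t)⁻¹) ≤ C * size (d := d) b := by
  set x0 : Euc d := chart1 (d := d) (1 : G) with hx0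
  refine IsCompact.induction_on (p := fun S : Set ℝ => ∃ C : ℝ, 0 ≤ C ∧ ∃ r > 0,
    ∀ t ∈ S, ∀ b ∈ SmallNhd d G r,
      oneParam X t * b * (oneParam X t)⁻¹ ∈ (extChartAt (𝓡 d) (1 : G)).source ∧
      size (d := d) (oneParam X t * b * (oneParam X t)⁻¹) ≤ C * size (d := d) b)
    isCompact_Icc ⟨0, le_rfl, 1, one_pos, by simp⟩ ?_ ?_ ?_
  · rintro s t hst ⟨C, hC, r, hr, h⟩
    exact ⟨C, hC, r, hr, fun u hu => h u (hst hu)⟩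
  · rintro s t ⟨C, hC, r, hr, h⟩ ⟨C', hC', r', hr', h'⟩
    refine ⟨max C C', le_max_of_le_left hC, min r r', lt_min hr hr', ?_⟩
    rintro u (hu | hu) b hb
    · obtain ⟨h1, h2⟩ := h u hu b ⟨hb.1, hb.2.trans_le (min_le_left _ _)⟩
      exact ⟨h1, h2.trans (mul_le_mul_of_nonneg_right (le_max_left _ _) (size_nonneg b))⟩
    · obtain ⟨h1, h2⟩ := h' u hu b ⟨hb.1, hb.2.trans_le (min_le_right _ _)⟩
      exact ⟨h1, h2.trans (mul_le_mul_of_nonneg_right (le_max_right _ _) (size_nonneg b))⟩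
  · intro t _
    have hp1 : SmoothAt d (fun p : ℝ × Euc d => oneParam (G := G) X p.1) (t, x0) :=
      SmoothAt.comp (τ := Prod.fst) (smoothAt_oneParam X t) contDiffAt_fst
    have hp2 : SmoothAt d (fun p : ℝ × Euc d => par1 G p.2) (t, x0) :=
      SmoothAt.comp (τ := Prod.snd) smoothAt_par1_one contDiffAt_snd
    obtain ⟨C, hC, r, hr, h⟩ := exists_lipschitz_of_smooth ((hp1.mul hp2).mul hp1.inv)
      (by simp [hx0, par1_chart1_one])
    refine ⟨Metric.ball t r, mem_nhdsWithin_of_mem_nhds (Metric.ball_mem_nhds t hr), C, hC, r, hr,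
      fun s hs b hb => ?_⟩
    have hball : ∀ b ∈ SmallNhd d G r, (s, chart1 (d := d) b) ∈ Metric.ball (t, x0) r := by
      intro b hb
      rw [Metric.mem_ball, Prod.dist_eq, dist_eq_norm (chart1 (d := d) b)]
      exact max_lt hs hb.2
    have h1 := h _ (hball b hb)
    have h2 := h1.2 _ (hball 1 (one_mem_smallNhd hr))
    simp only [par1_chart1 hb.1, par1_chart1_one, mul_one, mul_inv_cancel] at h1 h2
    refine ⟨h1.1, h2.trans_eq ?_⟩
    simp [Prod.norm_def, size]

/-- Compare `h n` with `g n`, the one-parameter subgroup at time `1 / m n`, whose `m n`-th power is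
the desired limit. Since `h n` and `g n` have the same first-order behaviour, `q = h g⁻¹` has size
`o(1 / m)`; telescoping `hᵐ g⁻ᵐ` into `m` conjugates of `q` gives a total error `o(1)`. -/
theorem tendsto_pow_oneParam [T2Space G] {X : Euc d} {h : ℕ → G} {m : ℕ → ℕ}
    (hh : Tendsto h atTop (𝓝 1)) (hm : Tendsto m atTop atTop)
    (hX : Tendsto (fun n => (m n : ℝ) • (chart1 (d := d) (h n) - chart1 (d := d) (1 : G)))
      atTop (𝓝 X)) :
    Tendsto (fun n => h n ^ m n) atTop (𝓝 (oneParam X 1)) := by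
  have : IsTopologicalGroup G := topologicalGroup_of_lieGroup (𝓡 d) ∞
  obtain ⟨C₁, hC₁, r₁, hr₁, H₁⟩ := exists_size_mul_le (d := d) (G := G)
  obtain ⟨C₂, hC₂, r₂, hr₂, H₂⟩ := exists_size_mul_inv_le (d := d) (G := G)
  obtain ⟨C₃, hC₃, r₃, hr₃, H₃⟩ := exists_size_conj_le (G := G) X
  let g : ℕ → G := fun n => oneParam X (1 / m n)
  have hinv : Tendsto (fun n => 1 / (m n : ℝ)) atTop (𝓝 0) :=
    tendsto_const_nhds.div_atTop (tendsto_natCast_atTop_atTop.comp hm)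
  have hpos : ∀ᶠ n in atTop, (0 : ℝ) < m n := by
    filter_upwards [hm.eventually_gt_atTop 0] with n hn
    exact_mod_cast hn
  have hg : Tendsto g atTop (𝓝 1) := by
    have := (continuous_oneParam (G := G) X).tendsto 0 |>.comp hinv
    rwa [oneParam_zero] at this
  have hgX : Tendsto (fun n => (m n : ℝ) • (chart1 (d := d) (g n) - chart1 (d := d) (1 : G)))
      atTop (𝓝 X) := by
    have h1 := hasDerivAt_iff_tendsto_slope_zero.1 (hasDerivAt_oneParam (G := G) X)
    have h2 : Tendsto (fun n => 1 / (m n : ℝ)) atTop (𝓝[≠] 0) := by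
      refine tendsto_nhdsWithin_iff.2 ⟨hinv, ?_⟩
      filter_upwards [hpos] with n hn
      simpa using hn.ne'
    refine (h1.comp h2).congr fun n => ?_
    simp [g]
  have hdiff : Tendsto (fun n => (m n : ℝ) * ‖chart1 (d := d) (h n) - chart1 (d := d) (g n)‖)
      atTop (𝓝 0) := by
    have h1 := (hX.sub hgX).norm
    rw [sub_self, norm_zero] at h1
    refine h1.congr fun n => ?_
    rw [← smul_sub, norm_smul, sub_sub_sub_cancel_right, Real.norm_of_nonneg (Nat.cast_nonneg _)]
  let q : ℕ → G := fun n => h n * (g n)⁻¹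
  have hq1 : Tendsto q atTop (𝓝 1) := by
    simpa using hh.mul hg.inv
  have hqs : ∀ᶠ n in atTop, size (d := d) (q n) ≤
      C₂ * ‖chart1 (d := d) (h n) - chart1 (d := d) (g n)‖ := by
    filter_upwards [hh (smallNhd_mem_nhds (d := d) hr₂), hg (smallNhd_mem_nhds (d := d) hr₂)] with n h1 h2
    exact (H₂ _ h1 _ h2).2
  let D : ℕ → ℝ := fun n => C₁ * (C₃ * (C₂ * ((m n : ℝ) *
    ‖chart1 (d := d) (h n) - chart1 (d := d) (g n)‖)))
  have hD : Tendsto D atTop (𝓝 0) := by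
    simpa using ((hdiff.const_mul C₂).const_mul C₃).const_mul C₁
  have hqsz : Tendsto (fun n => C₃ * size (d := d) (q n)) atTop (𝓝 0) := by
    have h1 : ContinuousAt (size (d := d) (G := G)) 1 :=
      ((contMDiffAt_chart1_one (d := d) (G := G)).continuousAt.sub continuousAt_const).norm
    have := (h1.tendsto.comp hq1).const_mul C₃
    simpa [size_one] using this
  -- The induction on `j` must also keep the partial products inside the ball where the product
  -- estimate is valid. The bound `D n`, which is uniform in `j ≤ m n` and tends to `0`, guarantees
  -- this.
  have hmain : ∀ᶠ n in atTop, ∀ j : ℕ, j ≤ m n →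
      h n ^ j * (g n ^ j)⁻¹ ∈ (extChartAt (𝓡 d) (1 : G)).source ∧
      size (d := d) (h n ^ j * (g n ^ j)⁻¹) ≤ j * (C₁ * (C₃ * size (d := d) (q n))) := by
    filter_upwards [hqs, hq1 (smallNhd_mem_nhds (d := d) hr₃), hD.eventually_lt_const hr₁,
      hqsz.eventually_lt_const hr₁, hpos] with n h1 h2 h3 h4 h5 j
    induction j with
    | zero => intro _; simp [size_one]
    | succ j ih =>
      intro hj
      obtain ⟨i1, i2⟩ := ih (by omega)
      have hgj : g n ^ j = oneParam X (j * (1 / m n)) := (oneParam_natMul X j _).symm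
      have ht : (j : ℝ) * (1 / m n) ∈ Set.Icc (0 : ℝ) 1 := by
        refine ⟨by positivity, ?_⟩
        rw [mul_one_div, div_le_one h5]
        exact_mod_cast (by omega : j ≤ m n)
      obtain ⟨c1, c2⟩ := H₃ _ ht (q n) h2
      rw [← hgj] at c1 c2
      -- Telescoping step: the new factor is `q n` conjugated by `g n ^ j`, a point of the
      -- one-parameter subgroup at a time in `[0, 1]`.
      have e1 : h n ^ (j + 1) * (g n ^ (j + 1))⁻¹ =
          h n ^ j * (g n ^ j)⁻¹ * (g n ^ j * q n * (g n ^ j)⁻¹) := by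
        simp only [q, pow_succ]; group
      have hjs : h n ^ j * (g n ^ j)⁻¹ ∈ SmallNhd d G r₁ := by
        refine ⟨i1, lt_of_le_of_lt (i2.trans ?_) h3⟩
        calc (j : ℝ) * (C₁ * (C₃ * size (d := d) (q n)))
            ≤ m n * (C₁ * (C₃ * (C₂ * ‖chart1 (d := d) (h n) - chart1 (d := d) (g n)‖))) := by
              gcongr
              · exact mul_nonneg hC₁ (mul_nonneg hC₃ (size_nonneg _))
              · omega
          _ = D n := by simp only [D]; ring
      obtain ⟨f1, f2⟩ := H₁ _ hjs _ ⟨c1, c2.trans_lt h4⟩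
      rw [e1]
      refine ⟨f1, f2.trans ?_⟩
      push_cast
      have := mul_le_mul_of_nonneg_left c2 hC₁
      linarith
  have hlim : Tendsto (fun n => h n ^ m n * (g n ^ m n)⁻¹) atTop (𝓝 1) := by
    refine tendsto_one_of_size (d := d) (hmain.mono fun n hn => (hn _ le_rfl).1) ?_
    refine squeeze_zero' (Eventually.of_forall fun n => size_nonneg (d := d) _) ?_ hD
    filter_upwards [hmain, hqs] with n h1 h2
    refine (h1 _ le_rfl).2.trans ?_
    calc (m n : ℝ) * (C₁ * (C₃ * size (d := d) (q n)))
        ≤ m n * (C₁ * (C₃ * (C₂ * ‖chart1 (d := d) (h n) - chart1 (d := d) (g n)‖))) := by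
          gcongr
      _ = D n := by simp only [D]; ring
  have hlim2 := hlim.mul_const (oneParam (G := G) X 1)
  rw [one_mul] at hlim2
  refine hlim2.congr' ?_
  filter_upwards [hpos] with n hn
  have : g n ^ m n = oneParam X 1 := by
    simp only [g]
    rw [← oneParam_natMul, mul_one_div_cancel hn.ne']
  rw [this, inv_mul_cancel_right]

end LimitLemma

/-! ### Lie algebras of closed subgroups -/

section ClosedSubgroups

variable {d : ℕ} {G : Type*} [TopologicalSpace G] [ChartedSpace (EuclideanSpace ℝ (Fin d)) G]
  [Group G]

variable (d G) in
/-- The identification of the model space with the Lie algebra of `G`. -/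
def toLie : Euc d ≃ₗ[ℝ] LieAlg d G where
  toFun X := X
  map_add' _ _ := rfl
  map_smul' _ _ := rfl
  invFun X := X
  left_inv _ := rfl
  right_inv _ := rfl

variable (d) in
/-- The Lie algebra of a subgroup as a subspace of the model space. -/
def lieS (H : Subgroup G) : Submodule ℝ (Euc d) := (lieSub d H).comap (toLie d G).toLinearMap

variable (d) in
/-- The projection of the model space to `𝔤/𝔥`. -/
def quo (H : Subgroup G) : Euc d →ₗ[ℝ] LieAlg d G ⧸ lieSub d H :=
  (lieSub d H).mkQ ∘ₗ (toLie d G).toLinearMap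

theorem ker_quo (H : Subgroup G) : LinearMap.ker (quo d H) = lieS d H := by
  rw [quo, LinearMap.ker_comp, Submodule.ker_mkQ]; rfl

theorem quo_eq_zero {H : Subgroup G} {X : Euc d} : quo d H X = 0 ↔ X ∈ lieS d H := by
  rw [← ker_quo, LinearMap.mem_ker]

theorem quo_surjective (H : Subgroup G) : Function.Surjective (quo d H) :=
  (Submodule.mkQ_surjective _).comp (toLie d G).surjective

instance finite_quotient (H : Subgroup G) : FiniteDimensional ℝ (LieAlg d G ⧸ lieSub d H) :=
  Module.Finite.of_surjective (quo d H) (quo_surjective H)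

variable [LieGroup (𝓡 d) ∞ G] [T2Space G]

theorem tendsto_slope_seq {f : ℝ → G} {X : Euc d} (h0 : f 0 = 1)
    (hX : HasDerivAt (fun t => chart1 (d := d) (f t)) X 0) (s : ℝ) :
    Tendsto (fun n : ℕ => ((n : ℝ) + 1) •
      (chart1 (d := d) (f (s / (n + 1))) - chart1 (d := d) (1 : G))) atTop (𝓝 (s • X)) := by
  have h1 : HasDerivAt (fun t => chart1 (d := d) (f (s * t))) (s • X) 0 := by
    have h2 : HasDerivAt (fun t : ℝ => s * t) s 0 := by simpa using (hasDerivAt_id (0 : ℝ)).const_mul s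
    rw [← mul_zero s] at hX
    exact hX.scomp 0 h2
  have h3 := hasDerivAt_iff_tendsto_slope_zero.1 h1
  have h4 : Tendsto (fun n : ℕ => 1 / ((n : ℝ) + 1)) atTop (𝓝[≠] 0) := by
    refine tendsto_nhdsWithin_iff.2 ⟨tendsto_one_div_add_atTop_nhds_zero_nat, ?_⟩
    exact Eventually.of_forall fun n => by
      have : (0 : ℝ) < n + 1 := by positivity
      simpa using this.ne'
  refine (h3.comp h4).congr fun n => ?_
  simp [h0, div_eq_mul_inv]

theorem tendsto_slope_point {f : ℝ → G} (hc : ContinuousAt f 0) (s : ℝ) :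
    Tendsto (fun n : ℕ => f (s / (n + 1))) atTop (𝓝 (f 0)) := by
  refine hc.tendsto.comp ?_
  have := tendsto_one_div_add_atTop_nhds_zero_nat (𝕜 := ℝ) |>.const_mul s
  simpa [div_eq_mul_inv] using this

/-- The powers `oneParam X (t / (n + 1)) ^ (n + 1)` are constantly `oneParam X t`, while the limit
lemma computes their limit from the velocity `t • X`. -/
theorem oneParam_smul_one (X : Euc d) (t : ℝ) : oneParam (G := G) (t • X) 1 = oneParam X t := by
  have h1 := tendsto_slope_seq (oneParam_zero (G := G) X) (hasDerivAt_oneParam X) t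
  have h2 := tendsto_slope_point (continuous_oneParam (G := G) X).continuousAt t
  rw [oneParam_zero] at h2
  have h3 := tendsto_pow_oneParam (X := t • X) (m := fun n => n + 1) h2 (tendsto_add_atTop_nat 1)
    (by simpa using h1)
  refine tendsto_nhds_unique (h3.congr fun n => ?_) tendsto_const_nhds
  rw [← oneParam_natMul]
  congr 1
  push_cast
  field_simp

theorem oneParam_smul (X : Euc d) (c t : ℝ) :
    oneParam (G := G) (c • X) t = oneParam X (t * c) := by
  rw [← oneParam_smul_one, smul_smul, oneParam_smul_one]

/-- The heart of the closed subgroup theorem: any limiting direction of elements of `H` tending to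
the unit generates a one-parameter subgroup of `H`. -/
theorem oneParam_mem_of_seq {H : Subgroup G} (hH : IsClosed (H : Set G)) {X : Euc d} {h : ℕ → G}
    {c : ℕ → ℝ} (hh : Tendsto h atTop (𝓝 1)) (hhH : ∀ᶠ n in atTop, h n ∈ H)
    (hc : Tendsto c atTop atTop)
    (hX : Tendsto (fun n => c n • (chart1 (d := d) (h n) - chart1 (d := d) (1 : G)))
      atTop (𝓝 X)) (t : ℝ) : oneParam X t ∈ H := by
  -- For the exponents `⌊t * c n⌋₊` the rescaled displacements converge to `t • X`, so powers of
  -- elements of `H` converge to `oneParam X t`; `H` is closed.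
  have key : ∀ t : ℝ, 0 < t → oneParam X t ∈ H := by
    intro t ht
    have h1 : Tendsto (fun n => (⌊t * c n⌋₊ : ℝ) / c n) atTop (𝓝 t) :=
      (tendsto_nat_floor_mul_div_atTop ht.le).comp hc
    have h2 : Tendsto (fun n => ((⌊t * c n⌋₊ : ℕ) : ℝ) •
        (chart1 (d := d) (h n) - chart1 (d := d) (1 : G))) atTop (𝓝 (t • X)) := by
      refine (h1.smul hX).congr' ?_
      filter_upwards [hc.eventually_gt_atTop 0] with n hn
      rw [smul_smul, div_mul_cancel₀ _ hn.ne']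
    have h3 := tendsto_pow_oneParam hh (tendsto_nat_floor_atTop.comp (hc.const_mul_atTop ht)) h2
    rw [oneParam_smul_one] at h3
    refine hH.mem_of_tendsto h3 ?_
    filter_upwards [hhH] with n hn
    exact H.pow_mem hn _
  rcases lt_trichotomy t 0 with ht | rfl | ht
  · have := H.inv_mem (key (-t) (by linarith))
    rwa [oneParam_neg, inv_inv] at this
  · rw [oneParam_zero]; exact H.one_mem
  · exact key t ht

theorem oneParam_mem_of_curve {H : Subgroup G} (hH : IsClosed (H : Set G)) {X : Euc d} {f : ℝ → G}
    (hc : ContinuousAt f 0) (h0 : f 0 = 1)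
    (hX : HasDerivAt (fun t => chart1 (d := d) (f t)) X 0) (hf : ∀ᶠ t in 𝓝 0, f t ∈ H) (t : ℝ) :
    oneParam X t ∈ H := by
  have h1 := tendsto_slope_seq h0 hX 1
  have h2 := tendsto_slope_point hc 1
  rw [h0] at h2
  rw [one_smul] at h1
  refine oneParam_mem_of_seq hH h2 ?_
    (tendsto_atTop_add_const_right _ (1 : ℝ) tendsto_natCast_atTop_atTop) h1 t
  exact (tendsto_one_div_add_atTop_nhds_zero_nat (𝕜 := ℝ)).eventually hf

theorem mem_lieS_of_oneParam {H : Subgroup G} {X : Euc d}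
    (h : ∀ t, oneParam (G := G) X t ∈ H) : X ∈ lieS d H := by
  refine Submodule.subset_span ⟨oneParam X, fun t => smoothAt_oneParam X t, oneParam_zero X, h, ?_⟩
  exact (leftLogDeriv_eq (smoothAt_oneParam X 0) 1).trans (logD_oneParam X 0)

theorem SmoothAt.hasDerivAt_chart1 {f : ℝ → G} {t : ℝ} (hf : SmoothAt d f t) (h1 : f t = 1) :
    HasDerivAt (fun s => PoissonTransform.chart1 (d := d) (f s))
      (PoissonTransform.logD (d := d) f t 1) t := by
  have := ((hf.chart1 h1).differentiableAt (by simp)).hasFDerivAt.hasDerivAt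
  rwa [← logD_of_eq_one h1] at this

/-- The product curve `oneParam X t * oneParam Y t` stays in `H` and has initial velocity `X + Y`.
-/
theorem oneParam_add_mem {H : Subgroup G} (hH : IsClosed (H : Set G)) {X Y : Euc d}
    (hX : ∀ t, oneParam (G := G) X t ∈ H) (hY : ∀ t, oneParam (G := G) Y t ∈ H) (t : ℝ) :
    oneParam (G := G) (X + Y) t ∈ H := by
  have s1 := smoothAt_oneParam (G := G) X 0
  have s2 := smoothAt_oneParam (G := G) Y 0
  refine oneParam_mem_of_curve hH (s1.mul s2).continuousAt (by simp) ?_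
    (Eventually.of_forall fun t => H.mul_mem (hX t) (hY t)) t
  have h2 := (s1.mul s2).hasDerivAt_chart1 (by simp)
  rw [logD_mul s1 s2] at h2
  simpa only [oneParam_zero, inv_one, AdL_one, ContinuousLinearMap.id_comp, add_apply,
    logD_oneParam] using h2

/-- The vectors whose one-parameter subgroup lies in `H` form a subspace containing the velocities
of curves in `H`, so taking the span in `lieSub` adds nothing. -/
theorem oneParam_mem {H : Subgroup G} (hH : IsClosed (H : Set G)) {X : Euc d}
    (hX : X ∈ lieS d H) (t : ℝ) : oneParam X t ∈ H := by
  have key : ∀ Y ∈ lieSub d H, ∀ t, oneParam (G := G) (d := d) Y t ∈ H := by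
    intro Y hY
    induction hY using Submodule.span_induction with
    | mem Y hY =>
      obtain ⟨γ, hγ, h0, hm, rfl⟩ := hY
      have h1 : SmoothAt d γ 0 := hγ 0
      intro t
      refine oneParam_mem_of_curve hH h1.continuousAt h0 ?_ (Eventually.of_forall hm) t
      have h2 : (leftLogDeriv γ (0 : ℝ) (1 : ℝ) : LieAlg d G) = logD (d := d) γ 0 1 :=
        leftLogDeriv_eq h1 1
      exact h2 ▸ h1.hasDerivAt_chart1 h0
    | zero =>
      intro t
      have := oneParam_smul (G := G) (0 : Euc d) 0 t
      rw [mul_zero, oneParam_zero, smul_zero] at this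
      exact this ▸ H.one_mem
    | add Y Z _ _ ihY ihZ =>
      intro t
      exact oneParam_add_mem hH ihY ihZ t
    | smul c Y _ ih =>
      intro t
      have := oneParam_smul (G := G) (d := d) Y c t
      exact this ▸ ih (t * c)
  exact key X hX t

theorem mem_lieS_iff {H : Subgroup G} (hH : IsClosed (H : Set G)) {X : Euc d} :
    X ∈ lieS d H ↔ ∀ t, oneParam (G := G) X t ∈ H :=
  ⟨fun h => oneParam_mem hH h, mem_lieS_of_oneParam⟩

theorem lieS_inf {H K : Subgroup G} (hH : IsClosed (H : Set G)) (hK : IsClosed (K : Set G)) :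
    lieS d (H ⊓ K) = lieS d H ⊓ lieS d K := by
  ext X
  have : IsClosed ((H ⊓ K : Subgroup G) : Set G) := hH.inter hK
  rw [Submodule.mem_inf, mem_lieS_iff this, mem_lieS_iff hH, mem_lieS_iff hK]
  exact forall_and

/-- The curve `t ↦ f(u)⁻¹ f(u + tv)` passes through `1`, lies in `H` for small `t`, and has the
vector in question as its velocity. Membership in `H` for small times suffices. -/
theorem logD_mem_lieS {F : Type*} [NormedAddCommGroup F] [NormedSpace ℝ F] {H : Subgroup G}
    (hH : IsClosed (H : Set G)) {f : F → G} {u : F} (hf : SmoothAt d f u)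
    (hm : ∀ᶠ x in 𝓝 u, f x ∈ H) (v : F) : logD (d := d) f u v ∈ lieS d H := by
  have hτ : ContDiffAt ℝ ∞ (fun t : ℝ => u + t • v) 0 := by fun_prop
  have h0 : u + (0 : ℝ) • v = u := by simp
  have hf' : SmoothAt d (fun t : ℝ => (f u)⁻¹ * f (u + t • v)) 0 :=
    smoothAt_const.mul (SmoothAt.comp (by rwa [h0]) hτ)
  have hτd : HasFDerivAt (fun t : ℝ => u + t • v) (ContinuousLinearMap.toSpanSingleton ℝ v) 0 := by
    have := ((hasDerivAt_id (0 : ℝ)).smul_const v).const_add u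
    simpa using this.hasFDerivAt
  have h2 : logD (d := d) (fun t : ℝ => (f u)⁻¹ * f (u + t • v)) 0 1 = logD (d := d) f u v := by
    rw [logD_const_mul, logD_comp (by rwa [h0]) hτd.differentiableAt, hτd.fderiv, h0]
    simp
  have hu : f u ∈ H := hm.self_of_nhds
  refine mem_lieS_of_oneParam fun t => oneParam_mem_of_curve hH hf'.continuousAt (by simp)
    (h2 ▸ hf'.hasDerivAt_chart1 (by simp)) ?_ t
  have hc : Tendsto (fun t : ℝ => u + t • v) (𝓝 0) (𝓝 u) := by
    have := hτ.continuousAt.tendsto; rwa [h0] at this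
  filter_upwards [hc.eventually hm] with t ht
  exact H.mul_mem (H.inv_mem hu) ht

theorem AdL_mem_lieS {H : Subgroup G} (hH : IsClosed (H : Set G)) {a : G} (ha : a ∈ H) {X : Euc d}
    (hX : X ∈ lieS d H) : AdL (d := d) a X ∈ lieS d H := by
  have s1 := smoothAt_oneParam (G := G) X 0
  have h2 := logD_mem_lieS hH (f := fun t => a * oneParam X t * a⁻¹)
    ((smoothAt_const.mul s1).mul smoothAt_const)
    (Eventually.of_forall fun t => H.mul_mem (H.mul_mem ha (oneParam_mem hH hX t)) (H.inv_mem ha)) 1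
  rwa [logD_conj s1, ContinuousLinearMap.comp_apply, logD_oneParam] at h2

/-- A smooth map whose logarithmic derivative is transversal to the Lie algebra of a closed
subgroup `H` is locally injective modulo `H`. -/
theorem eventually_injective_mod {F : Type*} [NormedAddCommGroup F] [NormedSpace ℝ F]
    [FiniteDimensional ℝ F] {H : Subgroup G} (hH : IsClosed (H : Set G)) {s : F → G} {u₀ : F}
    (hs : SmoothAt d s u₀) (htr : ∀ v, logD (d := d) s u₀ v ∈ lieS d H → v = 0) :
    ∀ᶠ p : F × F in 𝓝 (u₀, u₀), (s p.1)⁻¹ * s p.2 ∈ H → p.1 = p.2 := by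
  by_contra hcon
  obtain ⟨p, hp, hpn⟩ := exists_seq_forall_of_frequently (not_eventually.1 hcon)
  have hpH : ∀ n, (s (p n).1)⁻¹ * s (p n).2 ∈ H := fun n => by
    by_contra h; exact hpn n fun h' => absurd h' h
  have hne : ∀ n, (p n).1 ≠ (p n).2 := fun n h => hpn n fun _ => h
  have hp1 : SmoothAt d (fun p : F × F => s p.1) (u₀, u₀) :=
    SmoothAt.comp (f := s) (τ := Prod.fst) hs contDiffAt_fst
  have hp2 : SmoothAt d (fun p : F × F => s p.2) (u₀, u₀) :=
    SmoothAt.comp (f := s) (τ := Prod.snd) hs contDiffAt_snd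
  have hq := hp1.inv.mul hp2
  set Q : F × F → Euc d := fun p => chart1 (d := d) ((s p.1)⁻¹ * s p.2) with hQ
  -- Strict differentiability is needed because both entries of `p n` move: it compares `Q (p n)`
  -- with the value `Q (u, u)` on the diagonal, which is the chart point of `1`, up to `o(‖w n‖)`.
  have hQs : HasStrictFDerivAt Q (fderiv ℝ Q (u₀, u₀)) (u₀, u₀) :=
    (hq.chart1 (by simp)).hasStrictFDerivAt (by simp)
  have hQr : ∀ v, fderiv ℝ Q (u₀, u₀) (0, v) = logD (d := d) s u₀ v := by
    intro v
    have h1 : HasFDerivAt (fun x : F => (u₀, x)) (ContinuousLinearMap.inr ℝ _ _) u₀ :=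
      hasFDerivAt_prodMk_right u₀ u₀
    have h2 : fderiv ℝ (fun x => Q (u₀, x)) u₀ = _ :=
      (HasFDerivAt.comp (g := Q) (f := fun x => (u₀, x)) u₀ hQs.hasFDerivAt h1).fderiv
    rw [logD]
    simpa using (congrArg (fun L => L v) h2).symm
  let w : ℕ → F := fun n => (p n).2 - (p n).1
  have hw : ∀ n, 0 < ‖w n‖ := fun n => norm_pos_iff.2 (sub_ne_zero.2 (hne n).symm)
  have hw0 : Tendsto w atTop (𝓝 0) := by
    have h1 := (continuous_snd.tendsto (u₀, u₀)).comp hp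
    have h2 := (continuous_fst.tendsto (u₀, u₀)).comp hp
    simpa using h1.sub h2
  have hsphere : ∀ n, (‖w n‖⁻¹ • w n) ∈ Metric.sphere (0 : F) 1 := fun n => by
    rw [mem_sphere_zero_iff_norm, norm_smul, norm_inv, norm_norm, inv_mul_cancel₀ (hw n).ne']
  obtain ⟨z, hz, φ, hφ, hlim⟩ := (isCompact_sphere (0 : F) 1).tendsto_subseq hsphere
  have hin : Tendsto (fun n => (p n, ((p n).1, (p n).1))) atTop (𝓝 ((u₀, u₀), (u₀, u₀))) := by
    have h2 := (continuous_fst.tendsto (u₀, u₀)).comp hp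
    exact hp.prodMk_nhds (h2.prodMk_nhds h2)
  have ho := hQs.isLittleO.comp_tendsto hin
  have hQ1 : ∀ u, Q (u, u) = chart1 (d := d) (1 : G) := fun u => by simp [hQ]
  have hsmall : Tendsto (fun n => ‖w n‖⁻¹ • (Q (p n) - chart1 (d := d) (1 : G) -
      logD (d := d) s u₀ (w n))) atTop (𝓝 0) := by
    have h1 : (fun n => Q (p n) - chart1 (d := d) (1 : G) - logD (d := d) s u₀ (w n))
        =o[atTop] w := by
      refine (ho.congr (fun n => ?_) fun n => ?_).trans_isBigO
        (Asymptotics.IsBigO.of_bound 1 (Eventually.of_forall fun n => ?_)) (g := fun n => ((0 : F), w n))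
      · simp only [Function.comp, hQ1]
        rw [← hQr]
        congr 2
        ext <;> simp [w]
      · ext <;> simp [w]
      · simp
    have h2 := (Asymptotics.isLittleO_iff_tendsto' (f := fun n => ‖Q (p n) - chart1 (d := d) (1 : G) -
      logD (d := d) s u₀ (w n)‖) (g := fun n => ‖w n‖) (Eventually.of_forall fun n h =>
        absurd h (hw n).ne')).1 h1.norm_norm
    rw [tendsto_zero_iff_norm_tendsto_zero]
    refine h2.congr fun n => ?_
    rw [norm_smul, norm_inv, norm_norm, div_eq_inv_mul]
  -- Along the subsequence the elements of `H` approach `1` in the direction of the derivative at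
  -- the unit vector `z`. This direction then lies in `𝔥`, so transversality gives `z = 0`, which is
  -- absurd on the sphere.
  have hX : Tendsto (fun n => ‖w (φ n)‖⁻¹ • (chart1 (d := d) ((s (p (φ n)).1)⁻¹ * s (p (φ n)).2) -
      chart1 (d := d) (1 : G))) atTop (𝓝 (logD (d := d) s u₀ z)) := by
    have h1 := (hsmall.comp hφ.tendsto_atTop).add
      (((logD (d := d) s u₀).continuous.tendsto z).comp hlim)
    rw [zero_add] at h1
    refine h1.congr fun n => ?_
    simp only [Function.comp, map_smul, hQ, ← smul_add]
    congr 1; abel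
  have hh : Tendsto (fun n => (s (p (φ n)).1)⁻¹ * s (p (φ n)).2) atTop (𝓝 1) := by
    have := hq.continuousAt.tendsto.comp (hp.comp hφ.tendsto_atTop)
    simpa [Function.comp_def] using this
  have hc : Tendsto (fun n => ‖w (φ n)‖⁻¹) atTop atTop := by
    have h1 : Tendsto (fun n => ‖w n‖) atTop (𝓝[>] 0) :=
      tendsto_nhdsWithin_iff.2 ⟨by simpa using hw0.norm, Eventually.of_forall hw⟩
    exact (tendsto_inv_nhdsGT_zero.comp h1).comp hφ.tendsto_atTop
  have hmem : logD (d := d) s u₀ z ∈ lieS d H := mem_lieS_of_oneParam fun t =>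
    oneParam_mem_of_seq hH hh (Eventually.of_forall fun n => hpH _) hc hX t
  rw [htr z hmem] at hz
  simp at hz

end ClosedSubgroups

/-! ### Local product coordinates transversal to a closed subgroup -/

section Slices

variable {d : ℕ} {G : Type*} [TopologicalSpace G] [ChartedSpace (EuclideanSpace ℝ (Fin d)) G]
  [Group G] [LieGroup (𝓡 d) ∞ G] [T2Space G]

variable (G) in
/-- The product of one-parameter subgroups. -/
def prodExp {r : ℕ} (X : Fin r → Euc d) (t : Fin r → ℝ) : G :=
  (List.ofFn fun i => oneParam (G := G) (X i) (t i)).prod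

theorem prodExp_succ {r : ℕ} (X : Fin (r + 1) → Euc d) (t : Fin (r + 1) → ℝ) :
    prodExp G X t = oneParam (X 0) (t 0) * prodExp G (fun i => X i.succ) (fun i => t i.succ) := by
  simp [prodExp, List.ofFn_succ]

theorem prodExp_zero {r : ℕ} (X : Fin r → Euc d) : prodExp G X 0 = 1 := by
  simp [prodExp]

theorem prodExp_mem {r : ℕ} {H : Subgroup G} (hH : IsClosed (H : Set G)) {X : Fin r → Euc d}
    (hX : ∀ i, X i ∈ lieS d H) (t : Fin r → ℝ) : prodExp G X t ∈ H := by
  refine H.list_prod_mem fun g hg => ?_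
  obtain ⟨i, rfl⟩ := (List.mem_ofFn' _ _).1 hg
  exact oneParam_mem hH (hX i) _

theorem smoothAt_prodExp {r : ℕ} (X : Fin r → Euc d) (t : Fin r → ℝ) :
    SmoothAt d (prodExp G X) t := by
  induction r with
  | zero =>
    have : prodExp G X = fun _ => 1 := by ext t; simp [prodExp]
    rw [this]; exact smoothAt_const
  | succ r ih =>
    have : prodExp G X = fun t => oneParam (X 0) (t 0) *
        prodExp G (fun i => X i.succ) (fun i => t i.succ) := funext (prodExp_succ X)
    rw [this]
    exact (SmoothAt.comp (τ := fun t : Fin (r + 1) → ℝ => t 0) (smoothAt_oneParam _ _)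
      (by fun_prop)).mul (SmoothAt.comp (τ := fun t : Fin (r + 1) → ℝ => fun i : Fin r => t i.succ)
      (ih _ _) (by fun_prop))

theorem logD_prodExp_zero {r : ℕ} (X : Fin r → Euc d) (v : Fin r → ℝ) :
    logD (d := d) (prodExp G X) 0 v = ∑ i, v i • X i := by
  induction r with
  | zero =>
    have : prodExp G X = fun _ => 1 := by ext t; simp [prodExp]
    rw [this, logD_const]; simp
  | succ r ih =>
    have : prodExp G X = fun t => oneParam (X 0) (t 0) *
        prodExp G (fun i => X i.succ) (fun i => t i.succ) := funext (prodExp_succ X)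
    let τ₁ : (Fin (r + 1) → ℝ) →L[ℝ] ℝ := ContinuousLinearMap.proj 0
    let τ₂ : (Fin (r + 1) → ℝ) →L[ℝ] (Fin r → ℝ) :=
      ContinuousLinearMap.pi fun i => ContinuousLinearMap.proj i.succ
    have s1 : SmoothAt d (fun t => oneParam (G := G) (X 0) (τ₁ t)) 0 :=
      SmoothAt.comp (smoothAt_oneParam _ _) τ₁.contDiff.contDiffAt
    have s2 : SmoothAt d (fun t => prodExp G (fun i => X i.succ) (τ₂ t)) 0 :=
      SmoothAt.comp (smoothAt_prodExp _ _) τ₂.contDiff.contDiffAt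
    rw [this]
    have h := logD_mul s1 s2
    rw [logD_comp (smoothAt_oneParam _ _) τ₁.differentiableAt,
      logD_comp (smoothAt_prodExp _ _) τ₂.differentiableAt] at h
    simp only [map_zero, prodExp_zero, inv_one, AdL_one, ContinuousLinearMap.id_comp,
      ContinuousLinearMap.fderiv] at h
    refine (congrArg (fun L => L v) h).trans ?_
    rw [Fin.sum_univ_succ]
    simp only [add_apply, ContinuousLinearMap.comp_apply]
    rw [ih]
    congr 1
    have : logD (d := d) (oneParam (G := G) (X 0)) 0 (τ₁ v) = τ₁ v • X 0 := by
      conv_lhs => rw [← mul_one (τ₁ v), ← smul_eq_mul, map_smul, logD_oneParam]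
    exact this

/-- A smooth map transversal to the Lie algebra of `H`, together with a product of one-parameter
subgroups of `H`, gives local coordinates on `G`. -/
theorem exists_slice {F : Type*} [NormedAddCommGroup F] [NormedSpace ℝ F]
    [FiniteDimensional ℝ F] {H : Subgroup G} {r : ℕ} (X : Module.Basis (Fin r) ℝ (lieS d H))
    {s : F → G} {u₀ : F} (hs : SmoothAt d s u₀)
    (htr : ∀ v, logD (d := d) s u₀ v ∈ lieS d H → v = 0) (hdim : Module.finrank ℝ F + r = d) :
    ∃ τ : G → F × (Fin r → ℝ), ContMDiffAt (𝓡 d) 𝓘(ℝ, F × (Fin r → ℝ)) ∞ τ (s u₀) ∧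
      τ (s u₀) = (u₀, 0) ∧
      (∀ᶠ g in 𝓝 (s u₀), s (τ g).1 * prodExp G (fun i => (X i : Euc d)) (τ g).2 = g) ∧
      ∀ᶠ y in 𝓝 (u₀, 0), τ (s y.1 * prodExp G (fun i => (X i : Euc d)) y.2) = y := by
  have : IsTopologicalGroup G := topologicalGroup_of_lieGroup (𝓡 d) ∞
  set Y : Fin r → Euc d := fun i => (X i : Euc d) with hY
  let Θ : F × (Fin r → ℝ) → G := fun y => s y.1 * prodExp G Y y.2
  have s1 : SmoothAt d (fun y : F × (Fin r → ℝ) => s y.1) (u₀, 0) :=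
    SmoothAt.comp (f := s) (τ := Prod.fst) hs contDiffAt_fst
  have s2 : SmoothAt d (fun y : F × (Fin r → ℝ) => prodExp G Y y.2) (u₀, 0) :=
    SmoothAt.comp (f := prodExp G Y) (τ := Prod.snd) (smoothAt_prodExp _ _) contDiffAt_snd
  have hΘ : SmoothAt d Θ (u₀, 0) := s1.mul s2
  have hΘ0 : Θ (u₀, 0) = s u₀ := by simp [Θ, prodExp_zero]
  let q : F × (Fin r → ℝ) → Euc d := fun y => chart1 (d := d) ((s u₀)⁻¹ * Θ y)
  have hq : ContDiffAt ℝ ∞ q (u₀, 0) := (smoothAt_const.mul hΘ).chart1 (by simp [hΘ0])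
  let L : F × (Fin r → ℝ) →L[ℝ] Euc d := logD Θ (u₀, 0)
  have hLq : fderiv ℝ q (u₀, 0) = L := by simp only [L, logD, hΘ0]; rfl
  have hL : ∀ v t, L (v, t) = logD (d := d) s u₀ v + ∑ i, t i • Y i := by
    intro v t
    have h := logD_mul s1 s2
    rw [logD_comp (f := s) (τ := Prod.fst) hs differentiableAt_fst,
      logD_comp (f := prodExp G Y) (τ := Prod.snd) (smoothAt_prodExp _ _) differentiableAt_snd] at h
    simp only [prodExp_zero, inv_one, AdL_one, ContinuousLinearMap.id_comp, fderiv_fst,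
      fderiv_snd] at h
    refine (congrArg (fun L => L (v, t)) h).trans ?_
    simp [logD_prodExp_zero]
  -- The derivative of `Θ` is the sum of a map transversal to `𝔥` and an isomorphism onto `𝔥`; with
  -- the dimension count it is invertible, and the inverse function theorem applies to `q`.
  have hinj : Function.Injective L := by
    refine (injective_iff_map_eq_zero L).2 ?_
    rintro ⟨v, t⟩ h
    rw [hL] at h
    have hsum : ∑ i, t i • Y i = ((∑ i, t i • X i : lieS d H) : Euc d) := by simp [hY]
    have hv : v = 0 := by
      refine htr v ?_
      rw [eq_neg_of_add_eq_zero_left h, hsum]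
      exact Submodule.neg_mem _ (Submodule.coe_mem _)
    rw [hv, map_zero, zero_add, hsum, Submodule.coe_eq_zero] at h
    have ht := Fintype.linearIndependent_iff.1 X.linearIndependent t h
    exact Prod.ext hv (funext ht)
  let e : (F × (Fin r → ℝ)) ≃ₗ[ℝ] Euc d := LinearEquiv.ofInjectiveOfFinrankEq L.toLinearMap hinj
    (by simp [hdim])
  have he : ((e.toContinuousLinearEquiv : (F × (Fin r → ℝ)) ≃L[ℝ] Euc d) :
      (F × (Fin r → ℝ)) →L[ℝ] Euc d) = L := by
    exact ContinuousLinearMap.ext fun y => rfl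
  have hqe : HasFDerivAt q ((e.toContinuousLinearEquiv : (F × (Fin r → ℝ)) ≃L[ℝ] Euc d) :
      (F × (Fin r → ℝ)) →L[ℝ] Euc d) (u₀, 0) := by
    rw [he, ← hLq]; exact (hq.differentiableAt (by simp)).hasFDerivAt
  let ψ := hq.localInverse hqe (by simp)
  have hψ : ContDiffAt ℝ ∞ ψ (q (u₀, 0)) := hq.to_localInverse hqe (by simp)
  have hq0 : q (u₀, 0) = chart1 (d := d) (1 : G) := by simp [q, hΘ0]
  have hst : HasStrictFDerivAt q ((e.toContinuousLinearEquiv : (F × (Fin r → ℝ)) ≃L[ℝ] Euc d) :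
      (F × (Fin r → ℝ)) →L[ℝ] Euc d) (u₀, 0) := hq.hasStrictFDerivAt' hqe (by simp)
  have hl : ∀ᶠ y in 𝓝 (u₀, 0), ψ (q y) = y := hst.eventually_left_inverse
  have hr : ∀ᶠ x in 𝓝 (q (u₀, 0)), q (ψ x) = x := hst.eventually_right_inverse
  have hψ0 : ψ (q (u₀, 0)) = (u₀, 0) := hl.self_of_nhds
  let τ : G → F × (Fin r → ℝ) := fun g => ψ (chart1 (d := d) ((s u₀)⁻¹ * g))
  have hc : ContMDiffAt (𝓡 d) 𝓘(ℝ, Euc d) ∞ (fun g => chart1 (d := d) ((s u₀)⁻¹ * g)) (s u₀) := by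
    have := contMDiffAt_chart1_one (d := d) (G := G)
    rw [← inv_mul_cancel (s u₀)] at this
    exact ContMDiffAt.comp (g := chart1 (d := d)) (f := fun g => (s u₀)⁻¹ * g) _ this
      (contMDiff_mul_left.contMDiffAt)
  have hτ : ContMDiffAt (𝓡 d) 𝓘(ℝ, F × (Fin r → ℝ)) ∞ τ (s u₀) := by
    refine ContMDiffAt.comp (g := ψ) _ ?_ hc
    rw [inv_mul_cancel, ← hq0]; exact hψ.contMDiffAt
  have hτ0 : τ (s u₀) = (u₀, 0) := by
    simp only [τ]; rw [inv_mul_cancel, ← hq0, hψ0]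
  refine ⟨τ, hτ, hτ0, ?_, ?_⟩
  · have h1 : ∀ᶠ g in 𝓝 (s u₀), q (τ g) = chart1 (d := d) ((s u₀)⁻¹ * g) := by
      refine hc.continuousAt.eventually (p := fun x => q (ψ x) = x) ?_
      show ∀ᶠ x in 𝓝 (chart1 (d := d) ((s u₀)⁻¹ * s u₀)), q (ψ x) = x
      rwa [inv_mul_cancel, ← hq0]
    -- The inverse function theorem gives equality only after applying the chart; it descends to `G`
    -- once both points are known to be in the chart domain.
    have hsrc : (extChartAt (𝓡 d) (1 : G)).source ∈ 𝓝 ((s u₀)⁻¹ * s u₀) := by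
      rw [inv_mul_cancel]; exact mem_chart1_source
    have h2 : ∀ᶠ g in 𝓝 (s u₀), (s u₀)⁻¹ * g ∈ (extChartAt (𝓡 d) (1 : G)).source :=
      (continuous_const_mul (s u₀)⁻¹).continuousAt.eventually hsrc
    have h3 : ∀ᶠ g in 𝓝 (s u₀), (s u₀)⁻¹ * Θ (τ g) ∈ (extChartAt (𝓡 d) (1 : G)).source := by
      have hcont : ContinuousAt (fun g => (s u₀)⁻¹ * Θ (τ g)) (s u₀) := by
        refine continuousAt_const.mul (ContinuousAt.comp (g := Θ) ?_ hτ.continuousAt)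
        rw [hτ0]; exact hΘ.continuousAt
      refine hcont.eventually ?_
      show _ ∈ 𝓝 ((s u₀)⁻¹ * Θ (τ (s u₀)))
      rwa [hτ0, hΘ0]
    filter_upwards [h1, h2, h3] with g h1 h2 h3
    have h4 := congrArg (par1 G) h1
    simp only [q] at h4
    rw [par1_chart1 h2, par1_chart1 h3] at h4
    exact mul_left_cancel h4
  · exact hl

end Slices

/-! ### Continuous one-parameter groups in a Banach algebra are smooth -/

section OneParameterSemigroup

/-- With the primitive `I(t) = ∫₀ᵗ T` one has `T(t) I(ε) = I(t + ε) - I(t)`. As `I(ε) / ε` tends to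
`1`, some `I(ε)` is invertible, so `T` is as smooth as its primitive, and one bootstraps. -/
theorem contDiff_of_add_eq_mul {A : Type*} [NormedRing A] [NormedAlgebra ℝ A] [CompleteSpace A]
    {T : ℝ → A} (hc : Continuous T) (h0 : T 0 = 1) (hadd : ∀ s t, T (s + t) = T s * T t) :
    ContDiff ℝ ∞ T := by
  let I : ℝ → A := fun t => ∫ s in (0 : ℝ)..t, T s
  have hI : ∀ t, HasDerivAt I (T t) t := fun t =>
    intervalIntegral.integral_hasDerivAt_right (hc.intervalIntegrable _ _)
      hc.stronglyMeasurable.stronglyMeasurableAtFilter hc.continuousAt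
  have hunit : ∃ ε : ℝ, IsUnit (I ε) := by
    have h1 : Tendsto (fun t : ℝ => t⁻¹ • (I (0 + t) - I 0)) (𝓝[≠] 0) (𝓝 (T 0)) :=
      hasDerivAt_iff_tendsto_slope_zero.1 (hI 0)
    rw [h0] at h1
    have h2 : ∀ᶠ t in 𝓝[≠] (0 : ℝ), IsUnit (t⁻¹ • (I (0 + t) - I 0)) :=
      h1.eventually (Units.isOpen.mem_nhds isUnit_one)
    obtain ⟨ε, h3, hε⟩ := (h2.and self_mem_nhdsWithin).exists
    have hI0 : I 0 = 0 := by simp [I]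
    rw [hI0, sub_zero, zero_add] at h3
    refine ⟨ε, ?_⟩
    exact (isUnit_smul_iff (Units.mk0 ε⁻¹ (inv_ne_zero hε)) (I ε)).1 h3
  obtain ⟨ε, u, hu⟩ := hunit
  have hT : ∀ t, T t = (I (t + ε) - I t) * (↑u⁻¹ : A) := by
    intro t
    have h1 : I (t + ε) - I t = T t * I ε := by
      simp only [I]
      rw [intervalIntegral.integral_interval_sub_left (hc.intervalIntegrable _ _)
        (hc.intervalIntegrable _ _)]
      have h2 : ∫ s in (0 : ℝ)..ε, T (t + s) = ∫ s in t..(t + ε), T s := by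
        simp
      rw [← h2]
      simp only [hadd]
      exact (ContinuousLinearMap.mul ℝ A (T t)).intervalIntegral_comp_comm (hc.intervalIntegrable _ _)
    rw [h1, ← hu, mul_assoc, Units.mul_inv, mul_one]
  have hder : deriv I = T := funext fun t => (hI t).deriv
  have key : ∀ n : ℕ, ContDiff ℝ n T := by
    intro n
    induction n with
    | zero => exact contDiff_zero.2 hc
    | succ n ih =>
      have hI1 : ContDiff ℝ ((n : ℕ∞ω) + 1) I := by
        rw [contDiff_succ_iff_deriv]
        exact ⟨fun t => (hI t).differentiableAt, by simp, by rwa [hder]⟩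
      have : T = fun t => (I (t + ε) - I t) * (↑u⁻¹ : A) := funext hT
      rw [this, Nat.cast_succ]
      exact ((hI1.comp (contDiff_id.add contDiff_const)).sub hI1).mul contDiff_const
  exact contDiff_infty.2 key

end OneParameterSemigroup

/-! ### Smoothness of continuous representations of closed subgroups -/

section Representations

variable {d : ℕ} {G : Type*} [TopologicalSpace G] [ChartedSpace (EuclideanSpace ℝ (Fin d)) G]
  [Group G]
variable {V : Type*} [NormedAddCommGroup V] [NormedSpace ℝ V] [FiniteDimensional ℝ V]

open Classical in
/-- A representation of a subgroup, extended by zero to a function on the whole group. -/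
def repG (H : Subgroup G) (ρ : Representation ℝ H V) (g : G) : V →L[ℝ] V :=
  if h : g ∈ H then LinearMap.toContinuousLinearMap (ρ ⟨g, h⟩) else 0

theorem repG_apply {H : Subgroup G} (ρ : Representation ℝ H V) (h : H) (v : V) :
    repG H ρ h v = ρ h v := by
  simp [repG]

theorem repG_apply' {H : Subgroup G} (ρ : Representation ℝ H V) {g : G} (h : g ∈ H) (v : V) :
    repG H ρ g v = ρ ⟨g, h⟩ v := by
  simp [repG, h]

theorem repG_one {H : Subgroup G} (ρ : Representation ℝ H V) : repG H ρ 1 = 1 := by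
  ext v
  rw [repG_apply' ρ H.one_mem, show (⟨1, H.one_mem⟩ : H) = 1 from rfl, map_one]
  rfl

theorem repG_mul {H : Subgroup G} (ρ : Representation ℝ H V) {a b : G} (ha : a ∈ H) (hb : b ∈ H) :
    repG H ρ (a * b) = repG H ρ a * repG H ρ b := by
  ext v
  rw [repG_apply' ρ (H.mul_mem ha hb), mul_apply_eq_comp, repG_apply' ρ hb,
    repG_apply' ρ ha, show (⟨a * b, H.mul_mem ha hb⟩ : H) = ⟨a, ha⟩ * ⟨b, hb⟩ from rfl, map_mul]
  rfl

variable [LieGroup (𝓡 d) ∞ G] [T2Space G]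

theorem contDiff_repG_oneParam {H : Subgroup G} (hH : IsClosed (H : Set G))
    (ρ : Representation ℝ H V) (hρ : ∀ v, Continuous fun b : H => ρ b v) {X : Euc d}
    (hX : X ∈ lieS d H) : ContDiff ℝ ∞ (fun t => repG H ρ (oneParam X t)) := by
  have : CompleteSpace V := FiniteDimensional.complete ℝ V
  refine contDiff_of_add_eq_mul ?_ (by rw [oneParam_zero, repG_one]) fun s t => ?_
  · refine continuous_clm_apply.2 fun v => ?_
    have h1 : Continuous fun t => (⟨oneParam X t, oneParam_mem hH hX t⟩ : H) :=
      (continuous_oneParam X).subtype_mk _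
    refine ((hρ v).comp h1).congr fun t => ?_
    exact (repG_apply' ρ (oneParam_mem hH hX t) v).symm
  · rw [oneParam_add, repG_mul ρ (oneParam_mem hH hX s) (oneParam_mem hH hX t)]

theorem contDiff_repG_prodExp {H : Subgroup G} (hH : IsClosed (H : Set G))
    (ρ : Representation ℝ H V) (hρ : ∀ v, Continuous fun b : H => ρ b v) {r : ℕ}
    {X : Fin r → Euc d} (hX : ∀ i, X i ∈ lieS d H) :
    ContDiff ℝ ∞ (fun t => repG H ρ (prodExp G X t)) := by
  induction r with
  | zero =>
    have : prodExp G X = fun _ => 1 := by ext t; simp [prodExp]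
    rw [this]; exact contDiff_const
  | succ r ih =>
    have : (fun t => repG H ρ (prodExp G X t)) = fun t => repG H ρ (oneParam (X 0) (t 0)) *
        repG H ρ (prodExp G (fun i => X i.succ) (fun i => t i.succ)) := by
      ext1 t
      rw [prodExp_succ, repG_mul ρ (oneParam_mem hH (hX 0) _)
        (prodExp_mem hH (fun i => hX i.succ) _)]
    rw [this]
    have h1 : ContDiff ℝ ∞ (fun t : Fin (r + 1) → ℝ => repG H ρ (oneParam (X 0) (t 0))) :=
      (contDiff_repG_oneParam hH ρ hρ (hX 0)).comp (contDiff_apply ℝ ℝ 0)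
    have h2 : ContDiff ℝ ∞ (fun t : Fin (r + 1) → ℝ =>
        repG H ρ (prodExp G (fun i => X i.succ) (fun i => t i.succ))) :=
      (ih (fun i => hX i.succ)).comp (contDiff_pi.2 fun i => contDiff_apply ℝ ℝ i.succ)
    exact h1.mul h2

variable (G) in
/-- The exponential-like parametrization of `G` near `1` defined by a linear map to `𝔤`. -/
def linParam {F : Type*} [NormedAddCommGroup F] [NormedSpace ℝ F] (A : F →L[ℝ] Euc d) (u : F) : G :=
  par1 G (chart1 (d := d) (1 : G) + A u)

theorem linParam_zero {F : Type*} [NormedAddCommGroup F] [NormedSpace ℝ F] (A : F →L[ℝ] Euc d) :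
    linParam G A 0 = 1 := by simp [linParam, par1_chart1_one]

theorem smoothAt_linParam_zero {F : Type*} [NormedAddCommGroup F] [NormedSpace ℝ F]
    (A : F →L[ℝ] Euc d) : SmoothAt d (linParam G A) 0 := by
  refine SmoothAt.comp (τ := fun u => chart1 (d := d) (1 : G) + A u) ?_
    (contDiff_const.add A.contDiff).contDiffAt
  simpa using smoothAt_par1_one

theorem logD_linParam_zero {F : Type*} [NormedAddCommGroup F] [NormedSpace ℝ F]
    (A : F →L[ℝ] Euc d) : logD (d := d) (linParam G A) 0 = A := by
  rw [logD_of_eq_one (linParam_zero A)]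
  have h1 : HasFDerivAt (fun u => chart1 (d := d) (1 : G) + A u) A 0 := A.hasFDerivAt.const_add _
  have h2 : HasFDerivAt (fun x => chart1 (d := d) (par1 G x)) (ContinuousLinearMap.id ℝ _)
      (chart1 (d := d) (1 : G) + A 0) := by
    rw [map_zero, add_zero, ← fderiv_par1 (G := G)]
    exact ((smoothAt_par1_one (d := d) (G := G)).chart1
      par1_chart1_one |>.differentiableAt (by simp)).hasFDerivAt
  exact (HasFDerivAt.comp (g := fun x => chart1 (d := d) (par1 G x))
    (f := fun u => chart1 (d := d) (1 : G) + A u) 0 h2 h1).fderiv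

/-- In slice coordinates `g = s(v) · prodExp(t)` put `R(g) = ρ(prodExp(t))`, which is smooth because
it is a product of one-parameter groups of operators. Near `1` the elements of `H` are exactly
accounted for by `v = 0`. -/
theorem exists_smooth_repG {H : Subgroup G} (hH : IsClosed (H : Set G))
    (ρ : Representation ℝ H V) (hρ : ∀ v, Continuous fun b : H => ρ b v) :
    ∃ R : G → V →L[ℝ] V, ContMDiffAt (𝓡 d) 𝓘(ℝ, V →L[ℝ] V) ∞ R 1 ∧
      ∀ᶠ g in 𝓝 1, g ∈ H → R g = repG H ρ g := by
  obtain ⟨N, hN⟩ := Submodule.exists_isCompl (lieS d H)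
  let X := Module.finBasis ℝ (lieS d H)
  let s : N → G := linParam G N.subtypeL
  have hs0 : s 0 = 1 := linParam_zero N.subtypeL
  have hs : SmoothAt d s 0 := smoothAt_linParam_zero N.subtypeL
  have hlog : ∀ v : N, logD (d := d) s 0 v = v := fun v => by
    rw [show s = linParam G N.subtypeL from rfl, logD_linParam_zero]; rfl
  have htr : ∀ v : N, logD (d := d) s 0 v ∈ lieS d H → v = 0 := by
    intro v hv
    rw [hlog] at hv
    have := (Submodule.disjoint_def.1 hN.disjoint) _ hv v.2
    exact Subtype.ext this
  have hdim : Module.finrank ℝ N + Module.finrank ℝ (lieS d H) = d := by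
    rw [add_comm, Submodule.finrank_add_eq_of_isCompl hN]; simp
  obtain ⟨τ, hτ, hτ0, hτ1, -⟩ := exists_slice X hs htr hdim
  have hinj := eventually_injective_mod hH hs htr
  rw [hs0] at hτ hτ0 hτ1
  have hXm : ∀ i, ((X i : lieS d H) : Euc d) ∈ lieS d H := fun i => (X i).2
  refine ⟨fun g => repG H ρ (prodExp G (fun i => (X i : Euc d)) (τ g).2), ?_, ?_⟩
  · have h1 : ContDiff ℝ ∞ (fun y : N × (Fin (Module.finrank ℝ (lieS d H)) → ℝ) =>
        repG H ρ (prodExp G (fun i => (X i : Euc d)) y.2)) :=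
      (contDiff_repG_prodExp hH ρ hρ hXm).comp contDiff_snd
    exact ContMDiffAt.comp (g := fun y : N × (Fin (Module.finrank ℝ (lieS d H)) → ℝ) =>
      repG H ρ (prodExp G (fun i => (X i : Euc d)) y.2)) (1 : G) h1.contMDiff.contMDiffAt hτ
  · have hlim : Tendsto (fun g => ((0 : N), (τ g).1)) (𝓝 1) (𝓝 (0, 0)) := by
      have h1 := (continuous_fst.tendsto _).comp hτ.continuousAt.tendsto
      rw [hτ0] at h1
      exact tendsto_const_nhds.prodMk_nhds h1
    filter_upwards [hτ1, hlim.eventually hinj] with g h1 h2 hg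
    -- Dividing `g ∈ H` by its `prodExp` factor leaves `s(v) ∈ H`; since `s 0 = 1` is also in `H`,
    -- local injectivity modulo `H` forces `v = 0`.
    have h3 : s (τ g).1 ∈ H := by
      have := H.mul_mem hg (H.inv_mem (prodExp_mem hH hXm (τ g).2))
      rwa [← eq_mul_inv_of_mul_eq h1] at this
    have h4 := h2 (by simpa [hs0] using h3)
    conv_rhs => rw [← h1]
    rw [← h4, hs0, one_mul]

/-- Continuous representations of closed subgroups are smooth. -/
theorem ContMDiffAt.repG {EM HM M : Type*} [NormedAddCommGroup EM] [NormedSpace ℝ EM]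
    [TopologicalSpace HM] {I : ModelWithCorners ℝ EM HM} [TopologicalSpace M] [ChartedSpace HM M]
    {H : Subgroup G} (hH : IsClosed (H : Set G))
    (ρ : Representation ℝ H V) (hρ : ∀ v, Continuous fun b : H => ρ b v) {f : M → G} {x : M}
    (hf : ContMDiffAt I (𝓡 d) ∞ f x) (hm : ∀ᶠ y in 𝓝 x, f y ∈ H) :
    ContMDiffAt I 𝓘(ℝ, V →L[ℝ] V) ∞ (fun y => repG H ρ (f y)) x := by
  obtain ⟨R, hR, hRe⟩ := exists_smooth_repG (d := d) hH ρ hρ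
  have hx : f x ∈ H := hm.self_of_nhds
  have hg : ContMDiffAt I (𝓡 d) ∞ (fun y => (f x)⁻¹ * f y) x := contMDiffAt_const.mul hf
  have h1 : ContMDiffAt I 𝓘(ℝ, V →L[ℝ] V) ∞ (fun y => R ((f x)⁻¹ * f y)) x := by
    refine ContMDiffAt.comp (g := R) x ?_ hg
    rwa [inv_mul_cancel]
  have h2 : ContMDiffAt I 𝓘(ℝ, V →L[ℝ] V) ∞
      (fun y => (PoissonTransform.repG H ρ (f x)).comp (R ((f x)⁻¹ * f y))) x :=
    ContMDiffAt.clm_comp contMDiffAt_const h1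
  refine h2.congr_of_eventuallyEq ?_
  have hlim : Tendsto (fun y => (f x)⁻¹ * f y) (𝓝 x) (𝓝 1) := by
    have := hg.continuousAt.tendsto; rwa [inv_mul_cancel] at this
  filter_upwards [hm, hlim.eventually hRe] with y h3 h4
  have h5 : (f x)⁻¹ * f y ∈ H := H.mul_mem (H.inv_mem hx) h3
  rw [h4 h5]
  conv_lhs => rw [← mul_inv_cancel_left (f x) (f y), repG_mul ρ hx h5]
  rfl

end Representations

/-! ### The Killing form of a graded Lie algebra and `𝔨 + 𝔭 = 𝔤` -/

section GradedLie

variable {L : Type*} [LieRing L] [LieAlgebra ℝ L] [FiniteDimensional ℝ L]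

/-- The operator `ad X ∘ ad Y` shifts degrees by `i + j ≠ 0`, so its trace has no diagonal
contribution. -/
theorem killingForm_eq_zero_of_degree {𝒢 : ℤ → Submodule ℝ L} (hint : DirectSum.IsInternal 𝒢)
    (hlie : ∀ i j : ℤ, ∀ X ∈ 𝒢 i, ∀ Y ∈ 𝒢 j, ⁅X, Y⁆ ∈ 𝒢 (i + j)) {i j : ℤ} (hij : i + j ≠ 0)
    {X Y : L} (hX : X ∈ 𝒢 i) (hY : Y ∈ 𝒢 j) : killingForm ℝ L X Y = 0 := by
  rw [LieModule.traceForm_apply_apply]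
  refine LinearMap.trace_eq_zero_of_mapsTo_ne hint (fun k => i + (j + k)) (fun k => by omega) ?_
  intro k Z hZ
  exact hlie _ _ _ hX _ (hlie _ _ _ hY _ hZ)

theorem killingForm_eq_zero_of_iSup {𝒢 : ℤ → Submodule ℝ L} (hint : DirectSum.IsInternal 𝒢)
    (hlie : ∀ i j : ℤ, ∀ X ∈ 𝒢 i, ∀ Y ∈ 𝒢 j, ⁅X, Y⁆ ∈ 𝒢 (i + j)) {A B : ℤ → Prop}
    (hAB : ∀ i j, A i → B j → i + j ≠ 0) {X Y : L} (hX : X ∈ ⨆ (i : ℤ) (_ : A i), 𝒢 i)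
    (hY : Y ∈ ⨆ (i : ℤ) (_ : B i), 𝒢 i) : killingForm ℝ L X Y = 0 := by
  have h1 : (⨆ (j : ℤ) (_ : B j), 𝒢 j) ≤ LinearMap.ker (killingForm ℝ L X) := by
    refine iSup₂_le fun j hj Z hZ => ?_
    have h2 : (⨆ (i : ℤ) (_ : A i), 𝒢 i) ≤ LinearMap.ker ((killingForm ℝ L).flip Z) :=
      iSup₂_le fun i hi T hT => killingForm_eq_zero_of_degree hint hlie (hAB i j hi hj) hT hZ
    exact h2 hX
  exact h1 hY

/-- The fixed points of a Cartan involution and a parabolic subalgebra span the Lie algebra. -/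
theorem sup_eq_top_of_grading {θ : L → L} (hθ : ∀ X, θ (θ X) = X) (hadd : ∀ X Y, θ (X + Y) = θ X + θ Y)
    (hpos : ∀ X, X ≠ 0 → 0 < -killingForm ℝ L X (θ X)) {𝔨 𝔭 : Submodule ℝ L}
    (h𝔨 : ∀ X, X ∈ 𝔨 ↔ θ X = X) {𝒢 : ℤ → Submodule ℝ L} (hint : DirectSum.IsInternal 𝒢)
    (hlie : ∀ i j : ℤ, ∀ X ∈ 𝒢 i, ∀ Y ∈ 𝒢 j, ⁅X, Y⁆ ∈ 𝒢 (i + j))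
    (h𝔭 : 𝔭 = ⨆ (i : ℤ) (_ : 0 ≤ i), 𝒢 i) : 𝔨 ⊔ 𝔭 = ⊤ := by
  by_contra hne
  obtain ⟨f, hf, hle⟩ := Submodule.exists_le_ker_of_lt_top _ (lt_top_iff_ne_top.2 hne)
  -- Positivity of `-B(X, θX)` already makes `B` nondegenerate, so the functional `f` vanishing on
  -- `𝔨 + 𝔭` is represented by some `Z`.
  have hinj : Function.Injective (killingForm ℝ L : L →ₗ[ℝ] L →ₗ[ℝ] ℝ) := by
    refine (injective_iff_map_eq_zero _).2 fun X hX => ?_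
    by_contra h0
    have := hpos X h0
    rw [hX] at this
    simp at this
  have hsurj : Function.Surjective (killingForm ℝ L : L →ₗ[ℝ] L →ₗ[ℝ] ℝ) :=
    (LinearMap.injective_iff_surjective_of_finrank_eq_finrank
      (Subspace.dual_finrank_eq (K := ℝ) (V := L)).symm).1 hinj
  obtain ⟨Z, hZ⟩ := hsurj f
  have hperp : ∀ Y ∈ 𝔨 ⊔ 𝔭, killingForm ℝ L Z Y = 0 := fun Y hY => by rw [hZ]; exact hle hY
  have hZ0 : Z ≠ 0 := by rintro rfl; exact hf (by rw [← hZ, map_zero])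
  have h1 : killingForm ℝ L Z (Z + θ Z) = 0 :=
    hperp _ (Submodule.mem_sup_left ((h𝔨 _).2 (by rw [hadd, hθ, add_comm])))
  have hp : ∀ Y ∈ ⨆ (i : ℤ) (_ : 0 ≤ i), 𝒢 i, killingForm ℝ L Z Y = 0 := fun Y hY =>
    hperp Y (Submodule.mem_sup_right (h𝔭 ▸ hY))
  -- Split `Z = N + O + Q` into negative, zero and positive degree. As `O` and `Q` lie in `𝔭`, only
  -- `B(Z, N) = B(Q, N)` survives in `B(Z, Z)`; but `0 = B(Z, Q) = B(N, Q)` for degree reasons.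
  have h2 : killingForm ℝ L Z Z = 0 := by
    have hdec : (⊤ : Submodule ℝ L) ≤ (⨆ (i : ℤ) (_ : i < 0), 𝒢 i) ⊔
        ((⨆ (i : ℤ) (_ : i = 0), 𝒢 i) ⊔ ⨆ (i : ℤ) (_ : 0 < i), 𝒢 i) := by
      rw [← hint.submodule_iSup_eq_top]
      refine iSup_le fun i => ?_
      rcases lt_trichotomy i 0 with h | h | h
      · exact le_sup_of_le_left (le_iSup₂_of_le i h le_rfl)
      · exact le_sup_of_le_right (le_sup_of_le_left (le_iSup₂_of_le i h le_rfl))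
      · exact le_sup_of_le_right (le_sup_of_le_right (le_iSup₂_of_le i h le_rfl))
    obtain ⟨N, hN, R, hR, hNR⟩ := Submodule.mem_sup.1 (hdec (Submodule.mem_top (x := Z)))
    obtain ⟨O, hO, Q, hQ, hOQ⟩ := Submodule.mem_sup.1 hR
    have hO' : O ∈ ⨆ (i : ℤ) (_ : 0 ≤ i), 𝒢 i :=
      (iSup₂_le fun i hi => le_iSup₂_of_le i (by omega) le_rfl :
        (⨆ (i : ℤ) (_ : i = 0), 𝒢 i) ≤ ⨆ (i : ℤ) (_ : 0 ≤ i), 𝒢 i) hO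
    have hQ' : Q ∈ ⨆ (i : ℤ) (_ : 0 ≤ i), 𝒢 i :=
      (iSup₂_le fun i hi => le_iSup₂_of_le i (by omega) le_rfl :
        (⨆ (i : ℤ) (_ : 0 < i), 𝒢 i) ≤ ⨆ (i : ℤ) (_ : 0 ≤ i), 𝒢 i) hQ
    have e1 := killingForm_eq_zero_of_iSup hint hlie (fun i j hi hj => by omega) hN hN
    have e2 := killingForm_eq_zero_of_iSup hint hlie (fun i j hi hj => by omega) hO hN
    have e3 := killingForm_eq_zero_of_iSup hint hlie (fun i j hi hj => by omega) hO hQ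
    have e4 := killingForm_eq_zero_of_iSup hint hlie (fun i j hi hj => by omega) hQ hQ
    have e5 := hp Q hQ'
    have e6 := hp O hO'
    have e7 : killingForm ℝ L Q N = killingForm ℝ L N Q := LieModule.traceForm_comm ℝ L L Q N
    have hZe : Z = N + (O + Q) := by rw [hOQ, hNR]
    have e8 : killingForm ℝ L Z Z = killingForm ℝ L Z N + (killingForm ℝ L Z O + killingForm ℝ L Z Q) := by
      conv_lhs => rw [show killingForm ℝ L Z Z = killingForm ℝ L Z (N + (O + Q)) by rw [← hZe]]
      rw [map_add, map_add]
    rw [e8, e5, e6]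
    rw [hZe] at e5 ⊢
    simp only [map_add, LinearMap.add_apply] at e5 ⊢
    linarith
  have h3 := hpos Z hZ0
  rw [map_add, h2, zero_add] at h1
  rw [h1] at h3
  simp at h3

end GradedLie

/-! ### The decomposition `G = KP` and its smooth local versions -/

section Decomposition

variable {d : ℕ} {G : Type*} [TopologicalSpace G] [ChartedSpace (EuclideanSpace ℝ (Fin d)) G]
  [Group G] [LieGroup (𝓡 d) ∞ G]

theorem lieS_sup_eq_top {K P : Subgroup G} (hK : IsMaximalCompact d K) (hP : IsParabolic d P) :
    lieS d K ⊔ lieS d P = ⊤ := by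
  obtain ⟨-, θ, ⟨hθ, hpos⟩, hfix⟩ := hK
  obtain ⟨-, m, 𝒢, hint, -, hlie, -, hp⟩ := hP
  have : FiniteDimensional ℝ (LieAlg d G) := Module.Finite.equiv (toLie d G)
  have h := sup_eq_top_of_grading hθ (map_add θ) hpos hfix hint hlie hp
  rw [eq_top_iff]
  intro X _
  have hX : toLie d G X ∈ lieSub d K ⊔ lieSub d P := h ▸ Submodule.mem_top
  obtain ⟨Y, hY, Z, hZ, hYZ⟩ := Submodule.mem_sup.1 hX
  exact Submodule.mem_sup.2 ⟨Y, hY, Z, hZ, hYZ⟩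

theorem finrank_quotient_add (H : Subgroup G) :
    Module.finrank ℝ (LieAlg d G ⧸ lieSub d H) + Module.finrank ℝ (lieS d H) = d := by
  have h := LinearMap.finrank_range_add_finrank_ker (quo d H)
  rw [ker_quo, LinearMap.range_eq_top.2 (quo_surjective H), finrank_top] at h
  simpa using h

variable [T2Space G]

/-- Lift a basis of `𝔤/𝔭` to vectors of `𝔨`. Products of their one-parameter subgroups lie in `K`
and are transversal to `𝔭`, so slice coordinates at `1` are already a factorisation into `K` and
`P`. -/
theorem exists_smooth_factor_one {K P : Subgroup G} (hK : IsClosed (K : Set G))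
    (hP : IsClosed (P : Set G)) (hKP : lieS d K ⊔ lieS d P = ⊤) :
    ∃ a b : G → G, ContMDiffAt (𝓡 d) (𝓡 d) ∞ a 1 ∧ ContMDiffAt (𝓡 d) (𝓡 d) ∞ b 1 ∧
      ∀ᶠ g in 𝓝 1, a g ∈ K ∧ b g ∈ P ∧ a g * b g = g := by
  let e := Module.finBasis ℝ (LieAlg d G ⧸ lieSub d P)
  have hY : ∀ i, ∃ Y ∈ lieS d K, quo d P Y = e i := by
    intro i
    obtain ⟨Z, hZ⟩ := quo_surjective P (e i)
    obtain ⟨Y, hY, T, hT, hYT⟩ := Submodule.mem_sup.1 (hKP ▸ Submodule.mem_top (x := Z))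
    refine ⟨Y, hY, ?_⟩
    rw [← hZ, ← hYT, map_add, quo_eq_zero.2 hT, add_zero]
  choose Y hYK hYe using hY
  have htr : ∀ v, logD (d := d) (prodExp G Y) 0 v ∈ lieS d P → v = 0 := by
    intro v hv
    rw [logD_prodExp_zero, ← quo_eq_zero, map_sum] at hv
    simp only [map_smul, hYe] at hv
    exact funext (Fintype.linearIndependent_iff.1 e.linearIndependent v hv)
  let X := Module.finBasis ℝ (lieS d P)
  obtain ⟨τ, hτ, hτ0, hτ1, -⟩ := exists_slice X (smoothAt_prodExp Y 0) htr
    (by simpa using finrank_quotient_add (d := d) P)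
  rw [prodExp_zero] at hτ hτ1
  let R := (Fin (Module.finrank ℝ (LieAlg d G ⧸ lieSub d P)) → ℝ) ×
    (Fin (Module.finrank ℝ (lieS d P)) → ℝ)
  refine ⟨fun g => prodExp G Y (τ g).1, fun g => prodExp G (fun i => (X i : Euc d)) (τ g).2,
    ?_, ?_, ?_⟩
  · have h1 : ContMDiff 𝓘(ℝ, R) (𝓡 d) ∞ fun y : R => prodExp G Y y.1 :=
      fun y => SmoothAt.comp (f := prodExp G Y) (τ := Prod.fst) (smoothAt_prodExp _ _) contDiffAt_fst
    exact ContMDiffAt.comp (g := fun y : R => prodExp G Y y.1) (1 : G) h1.contMDiffAt hτ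
  · have h1 : ContMDiff 𝓘(ℝ, R) (𝓡 d) ∞ fun y : R => prodExp G (fun i => (X i : Euc d)) y.2 :=
      fun y => SmoothAt.comp (f := prodExp G (fun i => (X i : Euc d))) (τ := Prod.snd)
        (smoothAt_prodExp _ _) contDiffAt_snd
    exact ContMDiffAt.comp (g := fun y : R => prodExp G (fun i => (X i : Euc d)) y.2) (1 : G)
      h1.contMDiffAt hτ
  · filter_upwards [hτ1] with g hg
    exact ⟨prodExp_mem hK hYK _, prodExp_mem hP (fun i => (X i).2) _, hg⟩

-- The set `KP` is closed, as a compact set times a closed one, and open by the factorisation near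
-- `1`. Hence it contains the identity component, and `K` moves any element into that component.
open scoped Pointwise in
theorem exists_factor {K P : Subgroup G} (hK : IsCompact (K : Set G))
    (hP : IsClosed (P : Set G)) (hKP : lieS d K ⊔ lieS d P = ⊤)
    (hKG : ∀ g : G, ∃ a ∈ K, a⁻¹ * g ∈ connectedComponent (1 : G)) (g : G) :
    ∃ a ∈ K, ∃ b ∈ P, a * b = g := by
  have : IsTopologicalGroup G := topologicalGroup_of_lieGroup (𝓡 d) ∞
  have hclosed : IsClosed ((K : Set G) * (P : Set G)) := hP.mul_left_of_isCompact hK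
  have hopen : IsOpen ((K : Set G) * (P : Set G)) := by
    rw [isOpen_iff_mem_nhds]
    rintro _ ⟨a, ha, b, hb, rfl⟩
    obtain ⟨α, β, -, -, h⟩ := exists_smooth_factor_one (d := d) hK.isClosed hP hKP
    have hlim : Tendsto (fun g => a⁻¹ * g * b⁻¹) (𝓝 (a * b)) (𝓝 1) := by
      have : ContinuousAt (fun g => a⁻¹ * g * b⁻¹) (a * b) := by fun_prop
      simpa [ContinuousAt] using this
    filter_upwards [hlim.eventually h] with g hg
    refine ⟨a * α (a⁻¹ * g * b⁻¹), K.mul_mem ha hg.1, β (a⁻¹ * g * b⁻¹) * b, P.mul_mem hg.2.1 hb, ?_⟩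
    show a * α (a⁻¹ * g * b⁻¹) * (β (a⁻¹ * g * b⁻¹) * b) = g
    rw [mul_assoc, ← mul_assoc (α _), hg.2.2]; group
  have hsub : connectedComponent (1 : G) ⊆ (K : Set G) * (P : Set G) :=
    IsClopen.connectedComponent_subset ⟨hclosed, hopen⟩ ⟨1, K.one_mem, 1, P.one_mem, by simp⟩
  obtain ⟨a, ha, hag⟩ := hKG g
  obtain ⟨a', ha', b, hb, hab⟩ := hsub hag
  refine ⟨a * a', K.mul_mem ha ha', b, hb, ?_⟩
  simp only at hab
  rw [mul_assoc, hab]; group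

theorem exists_smooth_factor {K P : Subgroup G} (hK : IsCompact (K : Set G))
    (hP : IsClosed (P : Set G)) (hKP : lieS d K ⊔ lieS d P = ⊤)
    (hKG : ∀ g : G, ∃ a ∈ K, a⁻¹ * g ∈ connectedComponent (1 : G)) (g₀ : G) :
    ∃ a b : G → G, ContMDiffAt (𝓡 d) (𝓡 d) ∞ a g₀ ∧ ContMDiffAt (𝓡 d) (𝓡 d) ∞ b g₀ ∧
      ∀ᶠ g in 𝓝 g₀, a g ∈ K ∧ b g ∈ P ∧ a g * b g = g := by
  obtain ⟨a₀, ha₀, b₀, hb₀, rfl⟩ := exists_factor hK hP hKP hKG g₀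
  obtain ⟨α, β, hα, hβ, h⟩ := exists_smooth_factor_one (d := d) hK.isClosed hP hKP
  have hc : ContMDiffAt (𝓡 d) (𝓡 d) ∞ (fun g => a₀⁻¹ * g * b₀⁻¹) (a₀ * b₀) :=
    (contMDiffAt_const.mul contMDiffAt_id).mul contMDiffAt_const
  have h1 : a₀⁻¹ * (a₀ * b₀) * b₀⁻¹ = 1 := by group
  have hlim : Tendsto (fun g => a₀⁻¹ * g * b₀⁻¹) (𝓝 (a₀ * b₀)) (𝓝 1) := by
    have := hc.continuousAt.tendsto; rwa [h1] at this
  refine ⟨fun g => a₀ * α (a₀⁻¹ * g * b₀⁻¹), fun g => β (a₀⁻¹ * g * b₀⁻¹) * b₀,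
    contMDiffAt_const.mul (ContMDiffAt.comp (g := α) _ (by rwa [h1]) hc),
    (ContMDiffAt.comp (g := β) _ (by rwa [h1]) hc).mul contMDiffAt_const, ?_⟩
  filter_upwards [hlim.eventually h] with g hg
  refine ⟨K.mul_mem ha₀ hg.1, P.mul_mem hg.2.1 hb₀, ?_⟩
  rw [mul_assoc, ← mul_assoc (α _), hg.2.2]; group

end Decomposition

/-! ### Charts of `G/P` lifted to `G` -/

section LocalParams

variable {d : ℕ} {G : Type*} [TopologicalSpace G] [ChartedSpace (EuclideanSpace ℝ (Fin d)) G]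
  [Group G] {P : Subgroup G} {n : ℕ}

/-- The linear map `𝔤 → 𝔤/𝔭 ≅ ℝⁿ` defined by a basis of `𝔤/𝔭`. -/
def quoE (e : Module.Basis (Fin n) ℝ (LieAlg d G ⧸ lieSub d P)) : Euc d →L[ℝ] Euc n :=
  LinearMap.toContinuousLinearMap
    ((WithLp.linearEquiv 2 ℝ (Fin n → ℝ)).symm.toLinearMap ∘ₗ e.equivFun.toLinearMap ∘ₗ quo d P)

variable (e : Module.Basis (Fin n) ℝ (LieAlg d G ⧸ lieSub d P))

theorem quoE_apply (X : Euc d) (i : Fin n) : quoE e X i = e.repr (quo d P X) i := by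
  simp [quoE]

theorem quoE_eq_iff {X Y : Euc d} : quoE e X = quoE e Y ↔ quo d P X = quo d P Y := by
  constructor
  · intro h
    refine e.repr.injective (Finsupp.ext fun i => ?_)
    rw [← quoE_apply, ← quoE_apply, h]
  · intro h
    ext i
    rw [quoE_apply, quoE_apply, h]

theorem quoE_eq_zero {X : Euc d} : quoE e X = 0 ↔ X ∈ lieS d P := by
  rw [← quo_eq_zero, ← map_zero (quoE e), quoE_eq_iff, map_zero]

theorem quoE_surjective : Function.Surjective (quoE e) := by
  intro v
  obtain ⟨X, hX⟩ := quo_surjective P (e.equivFun.symm v)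
  refine ⟨X, ?_⟩
  ext i
  rw [quoE_apply, hX, Module.Basis.equivFun_symm_apply, Module.Basis.repr_sum_self]

theorem exists_quoE_section : ∃ A : Euc n →L[ℝ] Euc d, ∀ v, quoE e (A v) = v := by
  obtain ⟨A, hA⟩ := (quoE e).toLinearMap.exists_rightInverse_of_surjective
    (LinearMap.range_eq_top.2 (quoE_surjective e))
  exact ⟨LinearMap.toContinuousLinearMap A, fun v => LinearMap.congr_fun hA v⟩

/-- The Jacobian of `u ↦ s(u)P`, measured by a basis of `𝔤/𝔭`. -/
def jac (s : Euc n → G) (u : Euc n) : ℝ := ((quoE e).comp (logD (d := d) s u)).det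

theorem det_eq_of_quoE (Y : Fin n → Euc d) (L : Euc n →L[ℝ] Euc n)
    (h : ∀ i, quoE e (Y i) = L (EuclideanSpace.single i 1)) :
    e.det (fun i => quo d P (Y i)) = L.det := by
  rw [Module.Basis.det_apply, ContinuousLinearMap.det, ← LinearMap.det_toMatrix
    (EuclideanSpace.basisFun (Fin n) ℝ).toBasis]
  congr 1
  ext i j
  rw [Module.Basis.toMatrix_apply, LinearMap.toMatrix_apply, ← quoE_apply, h]
  simp

variable [LieGroup (𝓡 d) ∞ G]

theorem coordFrame_eq {s : Euc n → G} {u : Euc n} (hs : SmoothAt d s u) (i : Fin n) :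
    coordFrame (d := d) P s u i = quo d P (logD s u (EuclideanSpace.single i 1)) := by
  unfold coordFrame
  rw [leftLogDeriv_eq hs]; rfl

theorem det_coordFrame {s : Euc n → G} {u : Euc n} (hs : SmoothAt d s u) :
    e.det (coordFrame P s u) = jac e s u := by
  rw [funext (coordFrame_eq (P := P) hs)]
  exact det_eq_of_quoE e _ _ fun i => rfl

theorem jac_ne_zero_iff {s : Euc n → G} {u : Euc n} (hs : SmoothAt d s u) :
    jac e s u ≠ 0 ↔ LinearIndependent ℝ (coordFrame (d := d) P s u) := by
  rw [← det_coordFrame e hs, ← isUnit_iff_ne_zero, ← Module.Basis.is_basis_iff_det]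
  refine ⟨fun h => h.1, fun h => ⟨h, h.span_eq_top_of_card_eq_finrank' ?_⟩⟩
  rw [Module.finrank_eq_card_basis e]

theorem continuousAt_jac {s : Euc n → G} {u : Euc n} (hs : SmoothAt d s u) :
    ContinuousAt (jac e s) u := by
  have h1 : ContinuousAt (fun u => (quoE e).comp (logD (d := d) s u)) u :=
    continuousAt_const.clm_comp hs.logD.continuousAt
  exact (ContinuousLinearMap.continuous_det).continuousAt.comp h1

theorem eq_zero_of_jac_ne_zero {s : Euc n → G} {u : Euc n} (h : jac e s u ≠ 0) (v : Euc n)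
    (hv : logD (d := d) s u v ∈ lieS d P) : v = 0 := by
  have h1 : ((quoE e).comp (logD (d := d) s u)) v = 0 := (quoE_eq_zero e).2 hv
  have h2 : LinearMap.ker ((quoE e).comp (logD (d := d) s u)).toLinearMap = ⊥ := by
    by_contra hk
    exact h (LinearMap.det_eq_zero_iff_ker_ne_bot.2 hk)
  exact (LinearMap.ker_eq_bot'.1 h2) v h1

variable {U : Set (Euc n)} {s : Euc n → G}

theorem IsLocalParam.smoothAt (hp : IsLocalParam d P U s) {u : Euc n} (hu : u ∈ U) :
    SmoothAt d s u := hp.smooth.contMDiffAt (hp.isOpen.mem_nhds hu)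

theorem IsLocalParam.jac_ne_zero (hp : IsLocalParam d P U s) {u : Euc n} (hu : u ∈ U) :
    jac e s u ≠ 0 := (jac_ne_zero_iff e (hp.smoothAt hu)).2 (hp.immersion u hu)

theorem IsLocalParam.const_mul (hp : IsLocalParam d P U s) (x : G) :
    IsLocalParam d P U fun u => x * s u where
  isOpen := hp.isOpen
  smooth := contMDiffOn_const.mul hp.smooth
  injective u hu u' hu' h := hp.injective u hu u' hu' (by simpa [mul_assoc] using h)
  immersion u hu := by
    have : coordFrame (d := d) P (fun u => x * s u) u = coordFrame P s u := by
      funext i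
      rw [coordFrame_eq (smoothAt_const.mul (hp.smoothAt hu)), coordFrame_eq (hp.smoothAt hu),
        logD_const_mul]
    rw [this]; exact hp.immersion u hu

theorem jac_const_mul (x : G) (u : Euc n) : jac e (fun u => x * s u) u = jac e s u := by
  unfold jac; rw [logD_const_mul]

/-- The set of the elements of `G` over the image of a local parametrization of `G/P`. -/
def sat (P : Subgroup G) (U : Set (Euc n)) (s : Euc n → G) : Set G :=
  {g | ∃ u ∈ U, (s u)⁻¹ * g ∈ P}

open Classical in
/-- The coordinates of an element over the image of a local parametrization of `G/P`. -/
def coord (P : Subgroup G) (U : Set (Euc n)) (s : Euc n → G) (g : G) : Euc n :=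
  if h : g ∈ sat P U s then h.choose else 0

theorem coord_mem {g : G} (h : g ∈ sat P U s) :
    coord P U s g ∈ U ∧ (s (coord P U s g))⁻¹ * g ∈ P := by
  rw [coord, dif_pos h]; exact h.choose_spec

theorem IsLocalParam.coord_eq (hp : IsLocalParam d P U s) {u : Euc n} (hu : u ∈ U) {g : G}
    (h : (s u)⁻¹ * g ∈ P) : coord P U s g = u := by
  have hg : g ∈ sat P U s := ⟨u, hu, h⟩
  refine hp.injective _ (coord_mem hg).1 _ hu ?_
  have := P.mul_mem (coord_mem hg).2 (P.inv_mem h)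
  simpa [mul_assoc] using this

theorem mem_sat_mul_iff {g b : G} (hb : b ∈ P) : g * b ∈ sat P U s ↔ g ∈ sat P U s := by
  simp only [sat, Set.mem_ofPred_eq, ← mul_assoc, P.mul_mem_cancel_right hb]

theorem IsLocalParam.coord_mul (hp : IsLocalParam d P U s) {g b : G} (hg : g ∈ sat P U s)
    (hb : b ∈ P) : coord P U s (g * b) = coord P U s g :=
  hp.coord_eq (coord_mem hg).1 (by
    rw [← mul_assoc]; exact P.mul_mem (coord_mem hg).2 hb)

variable [T2Space G]

/-- Slice coordinates at `s u₀`, moved to `g₀ = s(u₀) b₀` by right translation with `b₀ ∈ P`,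
provide a smooth candidate for `coord`; injectivity modulo `P` shows that the chosen coordinate
coincides with it. -/
theorem IsLocalParam.eventually_mem_sat (hP : IsClosed (P : Set G)) (hp : IsLocalParam d P U s)
    (hn : Module.finrank ℝ (LieAlg d G ⧸ lieSub d P) = n) {g₀ : G} (hg₀ : g₀ ∈ sat P U s) :
    (∀ᶠ g in 𝓝 g₀, g ∈ sat P U s) ∧
      ContMDiffAt (𝓡 d) 𝓘(ℝ, Euc n) ∞ (coord P U s) g₀ := by
  have : IsTopologicalGroup G := topologicalGroup_of_lieGroup (𝓡 d) ∞
  let e := Module.finBasisOfFinrankEq ℝ _ hn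
  obtain ⟨u₀, hu₀, hb₀⟩ := id hg₀
  let X := Module.finBasis ℝ (lieS d P)
  obtain ⟨τ, hτ, hτ0, hτ1, -⟩ := exists_slice X (hp.smoothAt hu₀)
    (eq_zero_of_jac_ne_zero e (hp.jac_ne_zero e hu₀)) (by
      rw [finrank_euclideanSpace_fin, ← hn]; exact finrank_quotient_add P)
  set b₀ := (s u₀)⁻¹ * g₀ with hb
  have h1 : g₀ * b₀⁻¹ = s u₀ := by simp [hb]
  have hr : ContMDiffAt (𝓡 d) (𝓡 d) ∞ (fun g => g * b₀⁻¹) g₀ := contMDiffAt_id.mul contMDiffAt_const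
  have hlim : Tendsto (fun g => g * b₀⁻¹) (𝓝 g₀) (𝓝 (s u₀)) := by
    have := hr.continuousAt.tendsto; rwa [h1] at this
  have hc : ContMDiffAt (𝓡 d) 𝓘(ℝ, Euc n) ∞ (fun g => (τ (g * b₀⁻¹)).1) g₀ :=
    (contDiff_fst.contMDiff.contMDiffAt).comp g₀
      (ContMDiffAt.comp (g := τ) g₀ (by rwa [h1]) hr)
  have hU : ∀ᶠ g in 𝓝 g₀, (τ (g * b₀⁻¹)).1 ∈ U := by
    refine hc.continuousAt.preimage_mem_nhds ?_
    rw [h1, hτ0]; exact hp.isOpen.mem_nhds hu₀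
  have key : ∀ᶠ g in 𝓝 g₀, (τ (g * b₀⁻¹)).1 ∈ U ∧ (s (τ (g * b₀⁻¹)).1)⁻¹ * g ∈ P := by
    filter_upwards [hU, hlim.eventually hτ1] with g hg hg'
    refine ⟨hg, ?_⟩
    have h2 : (s (τ (g * b₀⁻¹)).1)⁻¹ * g =
        prodExp G (fun i => (X i : Euc d)) (τ (g * b₀⁻¹)).2 * b₀ := by
      rw [inv_mul_eq_iff_eq_mul, ← mul_assoc, hg']; simp
    rw [h2]
    exact P.mul_mem (prodExp_mem hP (fun i => (X i).2) _) hb₀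
  refine ⟨key.mono fun g hg => ⟨_, hg.1, hg.2⟩, hc.congr_of_eventuallyEq ?_⟩
  exact key.mono fun g hg => hp.coord_eq hg.1 hg.2

theorem IsLocalParam.isOpen_sat (hP : IsClosed (P : Set G)) (hp : IsLocalParam d P U s)
    (hn : Module.finrank ℝ (LieAlg d G ⧸ lieSub d P) = n) : IsOpen (sat P U s) :=
  isOpen_iff_mem_nhds.2 fun _ hg => (hp.eventually_mem_sat hP hn hg).1

theorem IsLocalParam.contMDiffAt_coord (hP : IsClosed (P : Set G)) (hp : IsLocalParam d P U s)
    (hn : Module.finrank ℝ (LieAlg d G ⧸ lieSub d P) = n) {g : G} (hg : g ∈ sat P U s) :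
    ContMDiffAt (𝓡 d) 𝓘(ℝ, Euc n) ∞ (coord P U s) g :=
  (hp.eventually_mem_sat hP hn hg).2

/-- Near `1` follow the chart along a linear section of `𝔤 → 𝔤/𝔭`. Its Jacobian at `0` is `1`, so it
is an immersion that is injective modulo `P` on a small neighbourhood; translate it by `g`. -/
theorem exists_isLocalParam (hP : IsClosed (P : Set G))
    (hn : Module.finrank ℝ (LieAlg d G ⧸ lieSub d P) = n) (g : G) :
    ∃ (U : Set (Euc n)) (s : Euc n → G), IsLocalParam d P U s ∧ 0 ∈ U ∧ s 0 = g := by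
  let e := Module.finBasisOfFinrankEq ℝ _ hn
  obtain ⟨A, hA⟩ := exists_quoE_section e
  let s : Euc n → G := linParam G A
  have hs0 : SmoothAt d s 0 := smoothAt_linParam_zero A
  have hj0 : jac e s 0 ≠ 0 := by
    have : (quoE e).comp (logD (d := d) s 0) = ContinuousLinearMap.id ℝ _ := by
      rw [logD_linParam_zero]; exact ContinuousLinearMap.ext hA
    rw [jac, this]; simp [ContinuousLinearMap.det]
  have hinj := eventually_injective_mod hP hs0 (eq_zero_of_jac_ne_zero e hj0)
  rw [nhds_prod_eq] at hinj
  obtain ⟨t, ht, hinj⟩ := (eventually_prod_self_iff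
    (r := fun u u' => (s u)⁻¹ * s u' ∈ P → u = u')).1 hinj
  have hsm : ∀ᶠ u in 𝓝 (0 : Euc n), SmoothAt d s u := by
    have hc : ContinuousAt (fun u => chart1 (d := d) (1 : G) + A u) 0 := by fun_prop
    have := hc.preimage_mem_nhds (t := (extChartAt (𝓡 d) (1 : G)).target) (by
      rw [map_zero, add_zero]; exact extChartAt_target_mem_nhds (I := 𝓡 d) (1 : G))
    filter_upwards [this] with u hu
    exact SmoothAt.comp (τ := fun u => chart1 (d := d) (1 : G) + A u) (contMDiffAt_par1 hu)
      (contDiff_const.add A.contDiff).contDiffAt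
  have hj : ∀ᶠ u in 𝓝 (0 : Euc n), jac e s u ≠ 0 :=
    (continuousAt_jac e hs0).eventually_ne hj0
  obtain ⟨U, hU, hUo, h0⟩ := eventually_nhds_iff.1 ((hsm.and hj).and ht)
  have hp : IsLocalParam d P U s :=
    { isOpen := hUo
      smooth := fun u hu => (hU u hu).1.1.contMDiffWithinAt
      injective := fun u hu u' hu' h => hinj u (hU u hu).2 u' (hU u' hu').2 h
      immersion := fun u hu => (jac_ne_zero_iff e (hU u hu).1.1).1 (hU u hu).1.2 }
  exact ⟨U, _, hp.const_mul g, h0, by simp [s, linParam_zero]⟩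

end LocalParams

/-! ### Densities on `G/P` and their integrals in charts -/

section Densities

variable {d : ℕ} {G : Type*} [TopologicalSpace G] [ChartedSpace (EuclideanSpace ℝ (Fin d)) G]
  [Group G] {P : Subgroup G} {n : ℕ}
variable (e : Module.Basis (Fin n) ℝ (LieAlg d G ⧸ lieSub d P))
variable {W : Type*} [NormedAddCommGroup W] [NormedSpace ℝ W]
variable {U U' : Set (Euc n)} {s s' : Euc n → G}

/-- The action of `a` on `𝔤/𝔭 ≅ ℝⁿ` induced by `Ad(a)`, for `a ∈ P`. -/
def AdE (a : G) : Euc n →L[ℝ] Euc n :=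
  (quoE e).comp ((AdL (d := d) a).comp (exists_quoE_section e).choose)

/-- `F` is a density on `G/P`: a function on `G` that is equivariant for the determinant of the
adjoint action on `𝔤/𝔭`. -/
def IsDensity (F : G → W) : Prop := ∀ g, ∀ b ∈ P, F (g * b) = (AdE e b).det • F g

/-- The support of `f` lies over a compact part of the image of a local parametrization. -/
def SupportedIn {E : Type*} [Zero E] (P : Subgroup G) (U : Set (Euc n)) (s : Euc n → G)
    (f : G → E) : Prop :=
  ∃ C ⊆ U, IsCompact C ∧ ∀ g, f g ≠ 0 → ∃ u ∈ C, (s u)⁻¹ * g ∈ P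

/-- The integral of a density in a local parametrization. -/
def chartIntegral (U : Set (Euc n)) (s : Euc n → G) (F : G → W) : W :=
  ∫ u in U, |jac e s u| • F (s u)

theorem SupportedIn.smul {F : G → W} (hF : SupportedIn P U s F) (χ : G → ℝ) :
    SupportedIn P U s fun g => χ g • F g := by
  obtain ⟨C, hC, hCc, h⟩ := hF
  exact ⟨C, hC, hCc, fun g hg => h g (right_ne_zero_of_smul hg)⟩

theorem SupportedIn.smul_left {χ : G → ℝ} (hχ : SupportedIn P U s χ) (F : G → W) :
    SupportedIn P U s fun g => χ g • F g := by
  obtain ⟨C, hC, hCc, h⟩ := hχ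
  exact ⟨C, hC, hCc, fun g hg => h g (left_ne_zero_of_smul hg)⟩

theorem SupportedIn.mem_sat {E : Type*} [Zero E] {f : G → E} (hf : SupportedIn P U s f) {g : G}
    (hg : f g ≠ 0) : g ∈ sat P U s := by
  obtain ⟨C, hC, hCc, h⟩ := hf
  obtain ⟨u, hu, hug⟩ := h g hg
  exact ⟨u, hC hu, hug⟩

variable {e} in
theorem IsDensity.smul {F : G → W} (hF : IsDensity e F) {χ : G → ℝ}
    (hχ : ∀ g, ∀ a ∈ P, χ (g * a) = χ g) : IsDensity e fun g => χ g • F g := by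
  intro g b hb
  simp only [hχ g b hb, hF g b hb]
  rw [smul_comm]

variable [LieGroup (𝓡 d) ∞ G]

theorem IsLocalParam.continuousOn_comp (hp : IsLocalParam d P U s) {F : G → W}
    (hF : Continuous F) : ContinuousOn (fun u => |jac e s u| • F (s u)) U := fun _ hu =>
  ContinuousAt.continuousWithinAt <| ContinuousAt.smul
    (continuousAt_jac e (hp.smoothAt hu)).abs
    (hF.continuousAt.comp (hp.smoothAt hu).continuousAt)

/-- Injectivity modulo `P` turns the support condition on `G` into vanishing outside the compact set
`C` of coordinates. -/
theorem IsLocalParam.integrableOn (hp : IsLocalParam d P U s) {F : G → W}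
    (hF : Continuous F) (hs : SupportedIn P U s F) :
    IntegrableOn (fun u => |jac e s u| • F (s u)) U := by
  obtain ⟨C, hC, hCc, h⟩ := hs
  refine IntegrableOn.of_forall_sdiff_eq_zero
    (((hp.continuousOn_comp e hF).mono hC).integrableOn_compact hCc) hp.isOpen.measurableSet ?_
  rintro u ⟨hu, huC⟩
  by_contra hne
  obtain ⟨u', hu', hm⟩ := h _ (right_ne_zero_of_smul hne)
  exact huC (hp.injective u' (hC hu') u hu hm ▸ hu')

theorem chartIntegral_sum (hp : IsLocalParam d P U s) {ι : Type*} (t : Finset ι) {F : ι → G → W}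
    (hF : ∀ i, Continuous (F i)) (hs : ∀ i, SupportedIn P U s (F i)) :
    chartIntegral e U s (fun g => ∑ i ∈ t, F i g) = ∑ i ∈ t, chartIntegral e U s (F i) := by
  unfold chartIntegral
  simp only [Finset.smul_sum]
  exact integral_finsetSum _ fun i _ => hp.integrableOn e (hF i) (hs i)

theorem chartIntegral_comp (hp : IsLocalParam d P U s) {W' : Type*} [NormedAddCommGroup W']
    [NormedSpace ℝ W'] [CompleteSpace W] [CompleteSpace W'] (T : W →L[ℝ] W') {F : G → W}
    (hF : Continuous F) (hs : SupportedIn P U s F) :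
    chartIntegral e U s (fun g => T (F g)) = T (chartIntegral e U s F) := by
  unfold chartIntegral
  rw [← T.integral_comp_comm (hp.integrableOn e hF hs)]
  simp only [map_smul]

theorem chartIntegral_const_mul (x : G) (F : G → W) :
    chartIntegral e U (fun u => x * s u) F = chartIntegral e U s (fun g => F (x * g)) := by
  unfold chartIntegral
  simp only [jac_const_mul]

variable [T2Space G]

/-- Two lifts of a vector differ by an element of `𝔭`, which `Ad(a)` preserves; so the section
chosen in `AdE` does not matter. -/
theorem AdE_quoE (hP : IsClosed (P : Set G)) {a : G} (ha : a ∈ P) (X : Euc d) :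
    AdE e a (quoE e X) = quoE e (AdL a X) := by
  set A := (exists_quoE_section e).choose with hA
  have h1 : quoE e (A (quoE e X) - X) = 0 := by
    rw [map_sub, (exists_quoE_section e).choose_spec, sub_self]
  have h2 := (quoE_eq_zero e).2 (AdL_mem_lieS hP ha ((quoE_eq_zero e).1 h1))
  rw [map_sub, map_sub, sub_eq_zero] at h2
  exact h2

theorem AdE_comp (hP : IsClosed (P : Set G)) {a b : G} (ha : a ∈ P) (hb : b ∈ P) :
    AdE e (a * b) = (AdE e a).comp (AdE e b) := by
  ext1 v
  obtain ⟨X, rfl⟩ := quoE_surjective e v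
  rw [ContinuousLinearMap.comp_apply, AdE_quoE e hP (P.mul_mem ha hb), AdE_quoE e hP hb,
    AdE_quoE e hP ha, AdL_mul]; rfl

theorem AdE_one (hP : IsClosed (P : Set G)) : AdE e (1 : G) = ContinuousLinearMap.id ℝ _ := by
  ext1 v
  obtain ⟨X, rfl⟩ := quoE_surjective e v
  rw [AdE_quoE e hP P.one_mem, AdL_one]; rfl

theorem det_comp (A B : Euc n →L[ℝ] Euc n) : (A.comp B).det = A.det * B.det :=
  LinearMap.det_comp _ _

theorem det_AdE_inv (hP : IsClosed (P : Set G)) {b : G} (hb : b ∈ P) :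
    (AdE e b⁻¹).det * (AdE e b).det = 1 := by
  rw [← det_comp, ← AdE_comp e hP (P.inv_mem hb) hb, inv_mul_cancel, AdE_one e hP]
  simp [ContinuousLinearMap.det]

/-- In the product rule for `s' ∘ τ` times `b` the logarithmic derivative of `b` lies in `𝔭` and
disappears modulo `𝔭`. -/
theorem jac_change (hP : IsClosed (P : Set G)) {τ : Euc n → Euc n} {b : Euc n → G} {u : Euc n}
    (hs' : SmoothAt d s' (τ u)) (hτ : ContDiffAt ℝ ∞ τ u) (hb : SmoothAt d b u)
    (hbP : ∀ᶠ x in 𝓝 u, b x ∈ P) (h : ∀ᶠ x in 𝓝 u, s x = s' (τ x) * b x) :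
    jac e s u = (AdE e (b u)⁻¹).det * (jac e s' (τ u) * (fderiv ℝ τ u).det) := by
  have h1 : logD (d := d) s u =
      (AdL (b u)⁻¹).comp ((logD s' (τ u)).comp (fderiv ℝ τ u)) + logD b u := by
    rw [logD_congr h, logD_mul (SmoothAt.comp hs' hτ) hb,
      logD_comp hs' (hτ.differentiableAt (by simp))]
  have h2 : (quoE e).comp (logD (d := d) s u) =
      (AdE e (b u)⁻¹).comp (((quoE e).comp (logD (d := d) s' (τ u))).comp (fderiv ℝ τ u)) := by
    ext1 v
    simp only [ContinuousLinearMap.comp_apply, h1, add_apply, map_add,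
      (quoE_eq_zero e).2 (logD_mem_lieS hP hb hbP v), add_zero,
      AdE_quoE e hP (P.inv_mem hbP.self_of_nhds)]
  rw [jac, h2, det_comp, det_comp]; rfl

theorem chartIntegral_eq (hP : IsClosed (P : Set G)) (hpos : ∀ b ∈ P, 0 < (AdE e b).det)
    (hp : IsLocalParam d P U s) (hp' : IsLocalParam d P U' s') {F : G → W} (hF : IsDensity e F)
    (h1 : ∀ g, F g ≠ 0 → g ∈ sat P U s) (h2 : ∀ g, F g ≠ 0 → g ∈ sat P U' s') :
    chartIntegral e U s F = chartIntegral e U' s' F := by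
  have hn : Module.finrank ℝ (LieAlg d G ⧸ lieSub d P) = n := by
    simpa using Module.finrank_eq_card_basis e
  set τ : Euc n → Euc n := fun u => coord P U' s' (s u) with hτ
  have hcont : ∀ {V : Set (Euc n)} {r : Euc n → G}, IsLocalParam d P V r → ∀ {O : Set G},
      IsOpen O → IsOpen {u | u ∈ V ∧ r u ∈ O} := by
    intro V r hr O hO
    exact hr.smooth.continuousOn.isOpen_inter_preimage hr.isOpen hO
  set D := {u | u ∈ U ∧ s u ∈ sat P U' s'} with hD
  set D' := {u | u ∈ U' ∧ s' u ∈ sat P U s} with hD'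
  have hDo : IsOpen D := hcont hp (hp'.isOpen_sat hP hn)
  have hDo' : IsOpen D' := hcont hp' (hp.isOpen_sat hP hn)
  have hτm : ∀ u ∈ D, τ u ∈ U' ∧ (s' (τ u))⁻¹ * s u ∈ P := fun u hu => coord_mem hu.2
  have hτs : ∀ u ∈ D, ContDiffAt ℝ ∞ τ u := by
    intro u hu
    rw [← contMDiffAt_iff_contDiffAt]
    exact ContMDiffAt.comp (g := coord P U' s') u (hp'.contMDiffAt_coord hP hn hu.2)
      (hp.smoothAt hu.1)
  have himg : τ '' D = D' := by
    ext u'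
    constructor
    · rintro ⟨u, hu, rfl⟩
      refine ⟨(hτm u hu).1, u, hu.1, ?_⟩
      simpa using P.inv_mem (hτm u hu).2
    · rintro ⟨hu', u, hu, hm⟩
      have hm' : (s' u')⁻¹ * s u ∈ P := by simpa using P.inv_mem hm
      exact ⟨u, ⟨hu, u', hu', hm'⟩, hp'.coord_eq hu' hm'⟩
  have hinj : Set.InjOn τ D := by
    intro u hu v hv huv
    refine hp.injective u hu.1 v hv.1 ?_
    have h3 := P.mul_mem (P.inv_mem (hτm u hu).2) (huv ▸ (hτm v hv).2)
    simpa [mul_assoc] using h3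
  -- The factor `det Ad(b⁻¹)` of the Jacobian cancels the factor `det Ad(b)` of the density;
  -- positivity of the determinants is what allows this under the absolute value.
  have key : ∀ u ∈ D, |jac e s u| • F (s u) =
      |(fderiv ℝ τ u).det| • (|jac e s' (τ u)| • F (s' (τ u))) := by
    intro u hu
    have hb : SmoothAt d (fun x => (s' (τ x))⁻¹ * s x) u :=
      (SmoothAt.comp (hp'.smoothAt (hτm u hu).1) (hτs u hu)).inv.mul (hp.smoothAt hu.1)
    have hj := jac_change e hP (s := s) (hp'.smoothAt (hτm u hu).1) (hτs u hu) hb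
      (by filter_upwards [hDo.mem_nhds hu] with x hx using (hτm x hx).2)
      (Eventually.of_forall fun x => by simp)
    set b := (s' (τ u))⁻¹ * s u with hbdef
    have hbP : b ∈ P := (hτm u hu).2
    have hFs : F (s u) = (AdE e b).det • F (s' (τ u)) := by
      rw [← hF _ b hbP, hbdef, mul_inv_cancel_left]
    rw [hj, hFs, smul_smul, smul_smul, abs_mul, abs_mul,
      abs_of_pos (hpos _ (P.inv_mem hbP))]
    congr 1
    have h4 := det_AdE_inv e hP hbP
    linear_combination (|jac e s' (τ u)| * |(fderiv ℝ τ u).det|) * h4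
  have e1 : chartIntegral e U s F = ∫ u in D, |jac e s u| • F (s u) := by
    refine setIntegral_eq_of_subset_of_forall_sdiff_eq_zero hp.isOpen.measurableSet
      (fun u hu => hu.1) ?_
    rintro u ⟨hu, hun⟩
    by_contra hne
    exact hun ⟨hu, h2 _ (right_ne_zero_of_smul hne)⟩
  have e2 : chartIntegral e U' s' F = ∫ u in D', |jac e s' u| • F (s' u) := by
    refine setIntegral_eq_of_subset_of_forall_sdiff_eq_zero hp'.isOpen.measurableSet
      (fun u hu => hu.1) ?_
    rintro u ⟨hu, hun⟩
    by_contra hne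
    exact hun ⟨hu, h1 _ (right_ne_zero_of_smul hne)⟩
  rw [e1, e2, ← himg, integral_image_eq_integral_abs_det_fderiv_smul volume hDo.measurableSet
    (fun u hu => ((hτs u hu).differentiableAt (by simp)).hasFDerivAt.hasFDerivWithinAt) hinj]
  exact setIntegral_congr_fun hDo.measurableSet key

end Densities

/-! ### Partitions of unity and the integral over `G/P` -/

section Atlases

variable {d : ℕ} {G : Type*} [TopologicalSpace G] [ChartedSpace (EuclideanSpace ℝ (Fin d)) G]
  [Group G] {P : Subgroup G} {n : ℕ}
variable (e : Module.Basis (Fin n) ℝ (LieAlg d G ⧸ lieSub d P))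
variable {W : Type*} [NormedAddCommGroup W] [NormedSpace ℝ W]
variable {U U' : Set (Euc n)} {s s' : Euc n → G}

variable (d P n) in
/-- A finite atlas of `G/P` by local parametrizations, with a subordinate partition of unity. -/
structure Atlas where
  N : ℕ
  U : Fin N → Set (Euc n)
  s : Fin N → Euc n → G
  χ : Fin N → G → ℝ
  param : ∀ j, IsLocalParam d P (U j) (s j)
  smooth : ∀ j, ContMDiff (𝓡 d) 𝓘(ℝ, ℝ) ∞ (χ j)
  invariant : ∀ j g, ∀ a ∈ P, χ j (g * a) = χ j g
  supported : ∀ j, SupportedIn P (U j) (s j) (χ j)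
  sum_eq : ∀ g, ∑ j, χ j g = 1

/-- The integral of a density on `G/P` by means of an atlas. -/
def Atlas.integral (A : Atlas d P n) (F : G → W) : W :=
  ∑ j, chartIntegral e (A.U j) (A.s j) fun g => A.χ j g • F g

theorem alternating_eq_det_smul {M : Type*} [AddCommGroup M] [Module ℝ M]
    (e : Module.Basis (Fin n) ℝ M) (f : M [⋀^Fin n]→ₗ[ℝ] W) (Y : Fin n → M) :
    f Y = e.det Y • f e := by
  have h : f = (LinearMap.toSpanSingleton ℝ W (f e)).compAlternatingMap e.det := by
    refine Module.Basis.ext_alternating e fun v hv => ?_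
    let σ : Equiv.Perm (Fin n) := Equiv.ofBijective v (Finite.injective_iff_bijective.1 hv)
    have h1 : (fun i => e (v i)) = fun i => e (σ i) := rfl
    have h2 := f.map_perm e σ
    have h3 := e.det.map_perm e σ
    rw [Module.Basis.det_self] at h3
    simp only [LinearMap.compAlternatingMap_apply, LinearMap.toSpanSingleton_apply, h1]
    rw [show (fun i => e (σ i)) = (e ∘ σ) from rfl, h2, h3]
    rw [smul_assoc, one_smul]
  conv_lhs => rw [h]
  simp

variable [LieGroup (𝓡 d) ∞ G]

/-- The orientation of a basis. -/
def orientSign (o : Orientation ℝ (LieAlg d G ⧸ lieSub d P) (Fin n)) : ℝ :=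
  ((SignType.sign (o.someVector e) : SignType) : ℝ)

theorem someVector_basis_ne_zero (o : Orientation ℝ (LieAlg d G ⧸ lieSub d P) (Fin n)) :
    o.someVector e ≠ 0 := by
  intro h
  refine o.someVector_ne_zero (AlternatingMap.ext fun Y => ?_)
  rw [alternating_eq_det_smul e, h]; simp

theorem orientSign_mul_self (o : Orientation ℝ (LieAlg d G ⧸ lieSub d P) (Fin n)) :
    orientSign e o * orientSign e o = 1 := by
  have := someVector_basis_ne_zero e o
  unfold orientSign
  rcases lt_or_gt_of_ne this with h | h
  · simp [sign_neg h]
  · simp [sign_pos h]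

/-- The integrals of an `n`-form in the sense of `HasIntegral` are integrals of a density. -/
theorem hasIntegral_iff (o : Orientation ℝ (LieAlg d G ⧸ lieSub d P) (Fin n))
    (η : G → (LieAlg d G ⧸ lieSub d P) [⋀^Fin n]→ₗ[ℝ] W) (w : W) :
    HasIntegral o (fun g Y => η g Y) w ↔
      ∃ A : Atlas d P n, w = A.integral e fun g => orientSign e o • η g e := by
  have key : ∀ {U : Set (Euc n)} {s : Euc n → G} (_ : IsLocalParam d P U s) (χ : G → ℝ),
      (∫ u in U, (χ (s u) * ((SignType.sign (o.someVector (coordFrame P s u)) : SignType) : ℝ)) •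
        η (s u) (coordFrame P s u)) =
      chartIntegral e U s fun g => χ g • orientSign e o • η g e := by
    intro U s hp χ
    refine setIntegral_congr_fun hp.isOpen.measurableSet fun u hu => ?_
    have h1 : o.someVector (coordFrame P s u) = jac e s u * o.someVector e := by
      rw [alternating_eq_det_smul e, det_coordFrame e (hp.smoothAt hu), smul_eq_mul]
    simp only
    -- Both the orientation and the form evaluated on the frame produce the Jacobian; its sign times
    -- itself is `|jac|`, leaving the sign of the fixed basis `e`.
    rw [h1, alternating_eq_det_smul e (η (s u)), det_coordFrame e (hp.smoothAt hu), sign_mul,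
      SignType.coe_mul, smul_smul, smul_smul, smul_smul, orientSign, ← sign_mul_self (jac e s u)]
    congr 1
    ring
  constructor
  · rintro ⟨N, U, s, χ, h1, h2, h3, h4, h5, rfl⟩
    refine ⟨⟨N, U, s, χ, h1, h2, h3, h4, h5⟩, ?_⟩
    exact Finset.sum_congr rfl fun j _ => key (h1 j) _
  · rintro ⟨A, rfl⟩
    refine ⟨A.N, A.U, A.s, A.χ, A.param, A.smooth, fun j g => A.invariant j g, A.supported,
      A.sum_eq, ?_⟩
    exact Finset.sum_congr rfl fun j _ => (key (A.param j) _).symm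

variable {e}

/-- The translate of an atlas by an element of `G`. -/
def Atlas.translate (A : Atlas d P n) (x : G) : Atlas d P n where
  N := A.N
  U := A.U
  s j u := x * A.s j u
  χ j g := A.χ j (x⁻¹ * g)
  param j := (A.param j).const_mul x
  smooth j := (A.smooth j).comp contMDiff_mul_left
  invariant j g a ha := by rw [← mul_assoc]; exact A.invariant j _ a ha
  supported j := by
    obtain ⟨C, hC, hCc, h⟩ := A.supported j
    refine ⟨C, hC, hCc, fun g hg => ?_⟩
    obtain ⟨u, hu, hm⟩ := h _ hg
    exact ⟨u, hu, by simpa [mul_assoc] using hm⟩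
  sum_eq g := A.sum_eq _

theorem Atlas.integral_translate (A : Atlas d P n) (x : G) (F : G → W) :
    (A.translate x).integral e F = A.integral e fun g => F (x * g) := by
  refine Finset.sum_congr rfl fun j _ => ?_
  refine (chartIntegral_const_mul e x _).trans ?_
  simp only [Atlas.translate, inv_mul_cancel_left]

theorem Atlas.integral_sum (A : Atlas d P n) {ι : Type*} (t : Finset ι) {F : ι → G → W}
    (hF : ∀ i, Continuous (F i)) :
    A.integral e (fun g => ∑ i ∈ t, F i g) = ∑ i ∈ t, A.integral e (F i) := by
  unfold Atlas.integral
  rw [Finset.sum_comm]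
  refine Finset.sum_congr rfl fun j _ => ?_
  simp only [Finset.smul_sum]
  exact chartIntegral_sum e (A.param j) t (fun i => (A.smooth j).continuous.smul (hF i))
    fun i => (A.supported j).smul_left _

theorem Atlas.integral_add (A : Atlas d P n) {F F' : G → W} (hF : Continuous F)
    (hF' : Continuous F') :
    A.integral e (fun g => F g + F' g) = A.integral e F + A.integral e F' := by
  have h := A.integral_sum (e := e) Finset.univ (F := ![F, F']) fun i => by
    fin_cases i <;> assumption
  simpa using h

theorem Atlas.integral_comp (A : Atlas d P n) {W' : Type*} [NormedAddCommGroup W']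
    [NormedSpace ℝ W'] [CompleteSpace W] [CompleteSpace W'] (T : W →L[ℝ] W') {F : G → W}
    (hF : Continuous F) : A.integral e (fun g => T (F g)) = T (A.integral e F) := by
  unfold Atlas.integral
  rw [map_sum]
  refine Finset.sum_congr rfl fun j _ => ?_
  rw [← chartIntegral_comp e (A.param j) T (F := fun g => A.χ j g • F g)
    ((A.smooth j).continuous.smul hF) ((A.supported j).smul_left _)]
  simp only [map_smul]

variable [T2Space G]

/-- Insert the partition of unity into the chart integral: each summand is supported over both
charts, where the two chart integrals agree. -/
theorem Atlas.integral_of_supportedIn (hP : IsClosed (P : Set G))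
    (hpos : ∀ b ∈ P, 0 < (AdE e b).det) (A : Atlas d P n) (hp : IsLocalParam d P U s) {F : G → W}
    (hc : Continuous F) (hF : IsDensity e F) (hs : SupportedIn P U s F) :
    A.integral e F = chartIntegral e U s F := by
  have h1 : chartIntegral e U s F = ∑ j, chartIntegral e U s fun g => A.χ j g • F g := by
    rw [← chartIntegral_sum e hp _ (F := fun j g => A.χ j g • F g) (fun j => (A.smooth j).continuous.smul hc)
      fun j => hs.smul _]
    simp only [← Finset.sum_smul, A.sum_eq, one_smul]
  rw [h1]
  refine Finset.sum_congr rfl fun j _ => ?_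
  exact chartIntegral_eq e hP hpos (A.param j) hp (hF.smul fun g a ha => A.invariant j g a ha)
    (fun g hg => (A.supported j).mem_sat (left_ne_zero_of_smul hg))
    fun g hg => hs.mem_sat (right_ne_zero_of_smul hg)

theorem Atlas.integral_eq (hP : IsClosed (P : Set G)) (hpos : ∀ b ∈ P, 0 < (AdE e b).det)
    (A A' : Atlas d P n) {F : G → W} (hc : Continuous F) (hF : IsDensity e F) :
    A.integral e F = A'.integral e F := by
  have h1 : A.integral e F = ∑ j, A.integral e fun g => A'.χ j g • F g := by
    rw [← A.integral_sum Finset.univ (F := fun j g => A'.χ j g • F g) fun j => (A'.smooth j).continuous.smul hc]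
    simp only [← Finset.sum_smul, A'.sum_eq, one_smul]
  rw [h1]
  exact Finset.sum_congr rfl fun j _ => A.integral_of_supportedIn hP hpos (A'.param j)
    ((A'.smooth j).continuous.smul hc) (hF.smul fun g a ha => A'.invariant j g a ha)
    ((A'.supported j).smul_left F)

/-- Translating the function is the same as translating the atlas, and the integral does not depend
on the atlas. -/
theorem Atlas.integral_const_mul (hP : IsClosed (P : Set G)) (hpos : ∀ b ∈ P, 0 < (AdE e b).det)
    (A : Atlas d P n) {F : G → W} (hc : Continuous F) (hF : IsDensity e F) (x : G) :
    A.integral e (fun g => F (x * g)) = A.integral e F := by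
  rw [← A.integral_translate, Atlas.integral_eq hP hpos _ A hc hF]

include d in
theorem isClosed_image_mul (hP : IsClosed (P : Set G)) {C : Set (Euc n)} (hC : IsCompact C)
    (hs : ContinuousOn s C) : IsClosed {g | ∃ u ∈ C, (s u)⁻¹ * g ∈ P} := by
  have : IsTopologicalGroup G := topologicalGroup_of_lieGroup (𝓡 d) ∞
  have h := hP.mul_left_of_isCompact (hC.image_of_continuousOn hs)
  convert h using 1
  ext g
  rw [Set.mem_mul]
  constructor
  · rintro ⟨u, hu, hg⟩
    exact ⟨s u, ⟨u, hu, rfl⟩, _, hg, by simp⟩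
  · rintro ⟨_, ⟨u, hu, rfl⟩, b, hb, rfl⟩
    exact ⟨u, hu, by simpa using hb⟩

theorem IsLocalParam.contMDiff_of_supportedIn (hP : IsClosed (P : Set G))
    (hp : IsLocalParam d P U s) {f : G → W} (hf : SupportedIn P U s f)
    (hsm : ∀ g ∈ sat P U s, ContMDiffAt (𝓡 d) 𝓘(ℝ, W) ∞ f g) :
    ContMDiff (𝓡 d) 𝓘(ℝ, W) ∞ f := by
  obtain ⟨C, hC, hCc, h⟩ := hf
  intro g
  by_cases hg : g ∈ sat P U s
  · exact hsm g hg
  · have hcl := isClosed_image_mul (d := d) hP hCc (hp.smooth.continuousOn.mono hC)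
    have : f =ᶠ[𝓝 g] fun _ => 0 := by
      filter_upwards [hcl.isOpen_compl.mem_nhds
        (show g ∈ {g | ∃ u ∈ C, (s u)⁻¹ * g ∈ P}ᶜ from fun ⟨u, hu, hm⟩ => hg ⟨u, hC hu, hm⟩)]
        with x hx
      by_contra hne
      exact hx (h x hne)
    exact contMDiffAt_const.congr_of_eventuallyEq this

theorem exists_bump (hP : IsClosed (P : Set G))
    (hn : Module.finrank ℝ (LieAlg d G ⧸ lieSub d P) = n) (g : G) :
    ∃ (U : Set (Euc n)) (s : Euc n → G) (ψ : G → ℝ), IsLocalParam d P U s ∧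
      ContMDiff (𝓡 d) 𝓘(ℝ, ℝ) ∞ ψ ∧ (∀ g, ∀ a ∈ P, ψ (g * a) = ψ g) ∧ SupportedIn P U s ψ ∧
      (∀ g, 0 ≤ ψ g) ∧ 0 < ψ g := by
  classical
  obtain ⟨U, s, hp, h0, rfl⟩ := exists_isLocalParam hP hn g
  obtain ⟨r, hr, hrU⟩ := Metric.nhds_basis_closedBall.mem_iff.1 (hp.isOpen.mem_nhds h0)
  let f : ContDiffBump (0 : Euc n) := ⟨r / 2, r, half_pos hr, half_lt_self hr⟩
  let ψ : G → ℝ := fun g => if g ∈ sat P U s then f (coord P U s g) else 0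
  have hsupp : SupportedIn P U s ψ := by
    refine ⟨Metric.closedBall 0 r, hrU, isCompact_closedBall _ _, fun g hg => ?_⟩
    have hgs : g ∈ sat P U s := by
      by_contra h; exact hg (if_neg h)
    refine ⟨coord P U s g, ?_, (coord_mem hgs).2⟩
    have h1 : f (coord P U s g) ≠ 0 := by simpa [ψ, hgs] using hg
    have h2 : coord P U s g ∈ Function.support f := h1
    rw [f.support_eq] at h2
    exact Metric.ball_subset_closedBall h2
  refine ⟨U, s, ψ, hp, hp.contMDiff_of_supportedIn hP hsupp fun g hg => ?_, fun g a ha => ?_, hsupp,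
    fun g => ?_, ?_⟩
  · have h1 : ContMDiffAt (𝓡 d) 𝓘(ℝ, ℝ) ∞ (fun g => f (coord P U s g)) g :=
      f.contDiff.contMDiff.contMDiffAt.comp g (hp.contMDiffAt_coord hP hn hg)
    refine h1.congr_of_eventuallyEq ?_
    filter_upwards [(hp.isOpen_sat hP hn).mem_nhds hg] with x hx
    simp [ψ, hx]
  · simp only [ψ, mem_sat_mul_iff ha]
    split_ifs with h
    · rw [hp.coord_mul h ha]
    · rfl
  · simp only [ψ]
    split_ifs
    · exact f.nonneg
    · exact le_rfl
  · have h1 : (s 0)⁻¹ * s 0 ∈ P := by simp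
    have h2 : s 0 ∈ sat P U s := ⟨0, h0, h1⟩
    simp only [ψ, h2, if_true, hp.coord_eq h0 h1]
    exact f.pos_of_mem_ball (Metric.mem_ball_self hr)

/-- The bump functions are right `P`-invariant and `G = KP`, so finitely many whose positivity sets
cover the compact `K` have a positive sum on all of `G`; divide by that sum. -/
theorem exists_atlas (hP : IsClosed (P : Set G))
    (hn : Module.finrank ℝ (LieAlg d G ⧸ lieSub d P) = n) {K : Subgroup G}
    (hK : IsCompact (K : Set G)) (hKP : ∀ g : G, ∃ a ∈ K, ∃ b ∈ P, a * b = g) :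
    Nonempty (Atlas d P n) := by
  choose U s ψ hp hsm hinv hsupp hnn hpos using exists_bump (d := d) hP hn
  obtain ⟨t, ht⟩ := hK.elim_finite_subcover (fun g : G => {x | 0 < ψ g x})
    (fun g => isOpen_lt continuous_const (hsm g).continuous)
    (fun g _ => Set.mem_iUnion.2 ⟨g, hpos g⟩)
  have hS : ∀ g, 0 < ∑ i ∈ t, ψ i g := by
    intro g
    obtain ⟨a, ha, b, hb, rfl⟩ := hKP g
    simp only [fun i => hinv i a b hb]
    obtain ⟨i, hi⟩ := Set.mem_iUnion.1 (ht ha)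
    obtain ⟨hit, hi⟩ := Set.mem_iUnion.1 hi
    exact Finset.sum_pos' (fun i _ => hnn i a) ⟨i, hit, hi⟩
  have hSs : ContMDiff (𝓡 d) 𝓘(ℝ, ℝ) ∞ fun g => ∑ i ∈ t, ψ i g := by
    exact contMDiff_finsetSum fun i _ => hsm i
  let j : Fin t.card → G := fun i => (t.equivFin.symm i : G)
  refine ⟨⟨t.card, fun i => U (j i), fun i => s (j i),
    fun i g => (∑ i ∈ t, ψ i g)⁻¹ * ψ (j i) g, fun i => hp _, fun i => ?_, fun i g a ha => ?_,
    fun i => ?_, fun g => ?_⟩⟩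
  · have h1 : ContMDiff (𝓡 d) 𝓘(ℝ, ℝ) ∞ fun g => (∑ i ∈ t, ψ i g)⁻¹ := fun g =>
      ((contDiffAt_inv ℝ (hS g).ne').contMDiffAt).comp g (hSs g)
    exact h1.mul (hsm (j i))
  · simp only [hinv _ g a ha]
  · obtain ⟨C, hC, hCc, h⟩ := hsupp (j i)
    exact ⟨C, hC, hCc, fun g hg => h g (right_ne_zero_of_mul hg)⟩
  · rw [← Finset.mul_sum, inv_mul_eq_one₀ (hS g).ne']
    rw [← Finset.sum_coe_sort t fun i => ψ i g]
    exact (t.equivFin.symm.sum_comp fun i : t => ψ i g).symm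

/-- The chart integral is a convolution evaluated at `0`, so smooth dependence on `q` follows from
the smoothness of convolutions with a parameter. -/
theorem IsLocalParam.contMDiff_chartIntegral [CompleteSpace W] (hp : IsLocalParam d P U s)
    {χ : G → ℝ} (hχ : ContMDiff (𝓡 d) 𝓘(ℝ, ℝ) ∞ χ) (hs : SupportedIn P U s χ) {F : G → G → W}
    (hF : ContMDiff ((𝓡 d).prod (𝓡 d)) 𝓘(ℝ, W) ∞ fun x : G × G => F x.1 x.2) :
    ContMDiff (𝓡 d) 𝓘(ℝ, W) ∞ fun q => chartIntegral e U s fun g => χ g • F q g := by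
  classical
  obtain ⟨C, hC, hCc, h⟩ := hs
  intro q₀
  set ψ := extChartAt (𝓡 d) q₀ with hψ
  -- The convolution at `0` evaluates `k p` at `0 - t`, hence the reflection `-x`.
  let k : Euc d → Euc n → W := fun p x => if -x ∈ U then χ (s (-x)) • F (ψ.symm p) (s (-x)) else 0
  have hk0 : ∀ p x, x ∉ Neg.neg '' C → k p x = 0 := by
    intro p x hx
    by_contra hne
    have hxU : -x ∈ U := by by_contra hxU; exact hne (if_neg hxU)
    simp only [k, if_pos hxU] at hne
    obtain ⟨u, hu, hm⟩ := h _ (left_ne_zero_of_smul hne)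
    have := hp.injective u (hC hu) _ hxU hm
    exact hx ⟨u, hu, by rw [this, neg_neg]⟩
  have hCn : IsCompact (Neg.neg '' C : Set (Euc n)) := hCc.image continuous_neg
  have hopen : IsOpen ψ.target := isOpen_extChartAt_target q₀
  have hks : ContDiffOn ℝ ∞ (Function.uncurry k) (ψ.target ×ˢ Set.univ) := by
    rintro ⟨p, x⟩ ⟨hpt, -⟩
    refine ContDiffAt.contDiffWithinAt ?_
    by_cases hx : -x ∈ U
    · rw [← contMDiffAt_iff_contDiffAt]
      have h1 : SmoothAt d (fun y : Euc d × Euc n => s (-y.2)) (p, x) :=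
        SmoothAt.comp (f := s) (τ := fun y : Euc d × Euc n => -y.2) (hp.smoothAt hx) (by fun_prop)
      have h2 : SmoothAt d (fun y : Euc d × Euc n => ψ.symm y.1) (p, x) :=
        SmoothAt.comp (f := ψ.symm) (τ := Prod.fst)
          ((contMDiffOn_extChartAt_symm q₀).contMDiffAt (hopen.mem_nhds hpt)) contDiffAt_fst
      have h3 : ContMDiffAt 𝓘(ℝ, Euc d × Euc n) 𝓘(ℝ, W) ∞
          (fun y : Euc d × Euc n => F (ψ.symm y.1) (s (-y.2))) (p, x) :=
        ContMDiffAt.comp (g := fun x : G × G => F x.1 x.2) (p, x) hF.contMDiffAt (h2.prodMk h1)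
      have h4 : ContMDiffAt 𝓘(ℝ, Euc d × Euc n) 𝓘(ℝ, ℝ) ∞
          (fun y : Euc d × Euc n => χ (s (-y.2))) (p, x) :=
        ContMDiffAt.comp (g := χ) (p, x) hχ.contMDiffAt h1
      refine (h4.smul h3).congr_of_eventuallyEq ?_
      have hc : ContinuousAt (fun y : Euc d × Euc n => -y.2) (p, x) := by fun_prop
      filter_upwards [hc.preimage_mem_nhds (hp.isOpen.mem_nhds hx)] with y hy
      exact if_pos hy
    · have hx' : x ∉ Neg.neg '' C := by
        rintro ⟨u, hu, rfl⟩
        exact hx (by rw [neg_neg]; exact hC hu)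
      have : Function.uncurry k =ᶠ[𝓝 (p, x)] fun _ => 0 := by
        filter_upwards [continuous_snd.continuousAt.preimage_mem_nhds
          (hCn.isClosed.isOpen_compl.mem_nhds hx')] with y hy
        exact hk0 _ _ hy
      exact contDiffAt_const.congr_of_eventuallyEq this
  have hf : LocallyIntegrable (C.indicator fun u => |jac e s u|) := by
    refine IntegrableOn.integrable_indicator ?_ hCc.measurableSet |>.locallyIntegrable
    refine ContinuousOn.integrableOn_compact hCc fun u hu => ?_
    exact (continuousAt_jac e (hp.smoothAt (hC hu))).abs.continuousWithinAt
  have hconv := contDiffOn_convolution_right_with_param_comp (n := ⊤) (v := fun _ => (0 : Euc n))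
    (ContinuousLinearMap.lsmul ℝ ℝ) contDiffOn_const hopen hCn (fun p x _ hx => hk0 p x hx) hf hks
  have hint : ∀ p, convolution (C.indicator fun u => |jac e s u|) (k p) (ContinuousLinearMap.lsmul ℝ ℝ) volume 0 =
      chartIntegral e U s fun g => χ g • F (ψ.symm p) g := by
    intro p
    rw [convolution, chartIntegral, ← integral_indicator hp.isOpen.measurableSet]
    congr 1
    funext t
    simp only [zero_sub, k, neg_neg, ContinuousLinearMap.lsmul_apply]
    by_cases htU : t ∈ U
    · rw [if_pos htU, Set.indicator_of_mem htU]
      by_cases htC : t ∈ C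
      · rw [Set.indicator_of_mem htC]
      · rw [Set.indicator_of_notMem htC, zero_smul]
        by_contra hne
        obtain ⟨u, hu, hm⟩ := h _ (left_ne_zero_of_smul (right_ne_zero_of_smul (Ne.symm hne)))
        exact htC (hp.injective u (hC hu) t htU hm ▸ hu)
    · rw [if_neg htU, Set.indicator_of_notMem htU, smul_zero]
  simp only [hint] at hconv
  have h5 : ContMDiffAt (𝓡 d) 𝓘(ℝ, W) ∞
      (fun q => chartIntegral e U s fun g => χ g • F (ψ.symm (ψ q)) g) q₀ :=
    ContMDiffAt.comp (g := fun p => chartIntegral e U s fun g => χ g • F (ψ.symm p) g) q₀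
      ((hconv.contDiffAt (hopen.mem_nhds (mem_extChartAt_target q₀))).contMDiffAt)
      contMDiffAt_extChartAt
  refine h5.congr_of_eventuallyEq ?_
  filter_upwards [extChartAt_source_mem_nhds (I := 𝓡 d) q₀] with q hq
  rw [hψ, (extChartAt (𝓡 d) q₀).left_inv hq]

theorem Atlas.contMDiff_integral [CompleteSpace W] (A : Atlas d P n) {F : G → G → W}
    (hF : ContMDiff ((𝓡 d).prod (𝓡 d)) 𝓘(ℝ, W) ∞ fun x : G × G => F x.1 x.2) :
    ContMDiff (𝓡 d) 𝓘(ℝ, W) ∞ fun q => A.integral e (F q) :=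
  contMDiff_finsetSum fun j _ =>
    (A.param j).contMDiff_chartIntegral (A.smooth j) (A.supported j) hF

end Atlases

/-! ### Alternating forms on a product of two vector spaces -/

section FibreParts

variable {A B : Type*} [AddCommGroup A] [Module ℝ A] [AddCommGroup B] [Module ℝ B]
variable {W : Type*} [NormedAddCommGroup W] [NormedSpace ℝ W] {ℓ n : ℕ}

theorem append_update_left (X : Fin ℓ → A) (Y : Fin n → B) (i : Fin ℓ) (x : A) :
    Fin.append (fun i' => ((Function.update X i x i', 0) : A × B)) (fun j => (0, Y j)) =
      Function.update (Fin.append (fun i' => ((X i', 0) : A × B)) (fun j => (0, Y j)))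
        (Fin.castAdd n i) (x, 0) := by
  funext m
  refine Fin.addCases (fun i' => ?_) (fun j => ?_) m
  · by_cases h : i' = i
    · subst h; simp
    · have : Fin.castAdd n i' ≠ Fin.castAdd n i := fun h' => h (Fin.castAdd_injective _ _ h')
      simp [Function.update_of_ne h, Function.update_of_ne this]
  · have : Fin.natAdd ℓ j ≠ Fin.castAdd n i := by
      intro h; have := congrArg Fin.val h; simp at this; omega
    simp [Function.update_of_ne this]

theorem append_update_right (X : Fin ℓ → A) (Y : Fin n → B) (j : Fin n) (y : B) :
    Fin.append (fun i => ((X i, 0) : A × B)) (fun j' => (0, Function.update Y j y j')) =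
      Function.update (Fin.append (fun i' => ((X i', 0) : A × B)) (fun j => (0, Y j)))
        (Fin.natAdd ℓ j) (0, y) := by
  funext m
  refine Fin.addCases (fun i' => ?_) (fun j' => ?_) m
  · have : Fin.castAdd n i' ≠ Fin.natAdd ℓ j := by
      intro h; have := congrArg Fin.val h; simp at this; omega
    simp [Function.update_of_ne this]
  · by_cases h : j' = j
    · subst h; simp
    · have : Fin.natAdd ℓ j' ≠ Fin.natAdd ℓ j := fun h' => h (Fin.natAdd_injective _ _ h')
      simp [Function.update_of_ne h, Function.update_of_ne this]

/-- The fibre part of a form, as an alternating form on the fibre. -/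
def fibreForm (ψ : (A × B) [⋀^Fin (ℓ + n)]→ₗ[ℝ] W) (X : Fin ℓ → A) : B [⋀^Fin n]→ₗ[ℝ] W where
  toFun Y := fibrePart ψ X Y
  map_update_add' := by
    intro inst Y j y y'
    rw [Subsingleton.elim inst (instDecidableEqFin n)]
    have h : ((0, y + y') : A × B) = (0, y) + (0, y') := by simp
    simp only [fibrePart, append_update_right]
    rw [h, ψ.map_update_add]
  map_update_smul' := by
    intro inst Y j c y
    rw [Subsingleton.elim inst (instDecidableEqFin n)]
    have h : ((0, c • y) : A × B) = c • (0, y) := by simp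
    simp only [fibrePart, append_update_right]
    rw [h, ψ.map_update_smul]
  map_eq_zero_of_eq' := by
    intro Y i j hij hne
    exact ψ.map_eq_zero_of_eq (i := Fin.natAdd ℓ i) (j := Fin.natAdd ℓ j) _ (by simp [hij])
      fun h => hne (Fin.natAdd_injective _ _ h)

theorem fibreForm_apply (ψ : (A × B) [⋀^Fin (ℓ + n)]→ₗ[ℝ] W) (X : Fin ℓ → A) (Y : Fin n → B) :
    fibreForm ψ X Y = fibrePart ψ X Y := rfl

/-- The fibre part of a form, as an alternating form on the base. -/
def baseForm (ψ : (A × B) [⋀^Fin (ℓ + n)]→ₗ[ℝ] W) (Y : Fin n → B) : A [⋀^Fin ℓ]→ₗ[ℝ] W where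
  toFun X := fibrePart ψ X Y
  map_update_add' := by
    intro inst X j x x'
    rw [Subsingleton.elim inst (instDecidableEqFin ℓ)]
    have h : ((x + x', 0) : A × B) = (x, 0) + (x', 0) := by simp
    simp only [fibrePart, append_update_left]
    rw [h, ψ.map_update_add]
  map_update_smul' := by
    intro inst X j c x
    rw [Subsingleton.elim inst (instDecidableEqFin ℓ)]
    have h : ((c • x, 0) : A × B) = c • (x, 0) := by simp
    simp only [fibrePart, append_update_left]
    rw [h, ψ.map_update_smul]
  map_eq_zero_of_eq' := by
    intro X i j hij hne
    exact ψ.map_eq_zero_of_eq (i := Fin.castAdd n i) (j := Fin.castAdd n j) _ (by simp [hij])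
      fun h => hne (Fin.castAdd_injective _ _ h)

theorem baseForm_apply (ψ : (A × B) [⋀^Fin (ℓ + n)]→ₗ[ℝ] W) (X : Fin ℓ → A) (Y : Fin n → B) :
    baseForm ψ Y X = fibrePart ψ X Y := rfl

/-- A form of bidegree `(ℓ, q)` vanishes if it does so on the families consisting of `ℓ` vectors
of the first factor, followed by `q` distinct basis vectors of the second factor. -/
theorem eq_zero_of_hasBidegree {N : Type*} [AddCommGroup N] [Module ℝ N] {q : ℕ} {ιB : Type*}
    [FiniteDimensional ℝ A] (eB : Module.Basis ιB ℝ B) {φ : (A × B) [⋀^Fin (ℓ + q)]→ₗ[ℝ] N}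
    (hφ : HasBidegree (Submodule.prod ⊤ ⊥) (Submodule.prod ⊥ ⊤) ℓ φ)
    (h : ∀ (X : Fin ℓ → A) (y : Fin q → ιB), Function.Injective y →
      φ (Fin.append (fun i => (X i, 0)) (fun j => (0, eB (y j)))) = 0) : φ = 0 := by
  classical
  let eA := Module.finBasis ℝ A
  refine Module.Basis.ext_alternating (eA.prod eB) fun v hv => ?_
  rw [AlternatingMap.zero_apply]
  set s : Finset (Fin (ℓ + q)) := Finset.univ.filter fun i => (v i).isLeft with hs
  have hleft : ∀ i ∈ s, ∃ x, v i = Sum.inl x := fun i hi =>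
    Sum.isLeft_iff.1 (Finset.mem_filter.1 hi).2
  have hright : ∀ i ∉ s, ∃ y, v i = Sum.inr y := fun i hi =>
    Sum.isRight_iff.1 (by
      have : ¬ (v i).isLeft := fun h' => hi (Finset.mem_filter.2 ⟨Finset.mem_univ _, h'⟩)
      simpa using this)
  -- With exactly `ℓ` vectors from the first factor, a permutation sorts the family into the shape
  -- of the hypothesis at the cost of a sign; any other number is excluded by the bidegree.
  by_cases hcard : s.card = ℓ
  · have hcard' : sᶜ.card = q := by rw [Finset.card_compl, hcard]; simp
    let π : Equiv.Perm (Fin (ℓ + q)) :=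
      finSumFinEquiv.symm.trans (finSumEquivOfFinset hcard hcard')
    have h1 : ∀ i : Fin ℓ, π (Fin.castAdd q i) ∈ s := fun i => by
      simp only [π, Equiv.trans_apply, finSumFinEquiv_symm_apply_castAdd,
        finSumEquivOfFinset_inl]
      exact Finset.orderEmbOfFin_mem _ _ _
    have h2 : ∀ j : Fin q, π (Fin.natAdd ℓ j) ∉ s := fun j => by
      simp only [π, Equiv.trans_apply, finSumFinEquiv_symm_apply_natAdd,
        finSumEquivOfFinset_inr]
      exact Finset.mem_compl.1 (Finset.orderEmbOfFin_mem _ _ _)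
    choose x hx using fun i => hleft _ (h1 i)
    choose y hy using fun j => hright _ (h2 j)
    have hyi : Function.Injective y := by
      intro j j' hjj
      have := hv ((hy j).trans ((congrArg Sum.inr hjj).trans (hy j').symm))
      exact Fin.natAdd_injective _ _ (π.injective this)
    have h3 := h (fun i => eA (x i)) y hyi
    have h4 : (Fin.append (fun i => ((eA (x i), 0) : A × B)) (fun j => (0, eB (y j)))) =
        (fun i => (eA.prod eB) (v i)) ∘ π := by
      funext m
      refine Fin.addCases (fun i => ?_) (fun j => ?_) m
      · simp [hx]
      · simp [hy]
    rw [h4, φ.map_perm] at h3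
    exact (smul_eq_zero_iff_eq _).1 h3
  · refine hφ s _ (fun i hi => ?_) (fun i hi => ?_) hcard
    · obtain ⟨x, hx⟩ := hleft i hi
      simp [hx]
    · obtain ⟨y, hy⟩ := hright i hi
      simp [hy]

theorem exists_perm_extending {q k : ℕ} {y : Fin q → Fin (q + k)} (hy : Function.Injective y) :
    ∃ β : Equiv.Perm (Fin (q + k)), ∀ j, β (Fin.castAdd k j) = y j := by
  classical
  have hcard : Fintype.card ((Set.range y)ᶜ : Set (Fin (q + k))) = k := by
    rw [Fintype.card_compl_set, Set.card_range_of_injective hy]; simp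
  let γ := (Fintype.equivFinOfCardEq hcard).symm
  refine ⟨(finSumFinEquiv.symm.trans ((Equiv.ofInjective y hy).sumCongr γ)).trans
    (Equiv.Set.sumCompl (Set.range y)), fun j => ?_⟩
  simp

end FibreParts

/-! ### The wedge product as a sum over shuffles, and its nondegeneracy -/

section Wedge

variable {d : ℕ} {G : Type*} [TopologicalSpace G] [ChartedSpace (EuclideanSpace ℝ (Fin d)) G]
  [Group G] {K P : Subgroup G} {ℓ q k : ℕ}
variable {V : Type*} [NormedAddCommGroup V] [NormedSpace ℝ V]
variable {W : Type*} [NormedAddCommGroup W] [NormedSpace ℝ W]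

/-- The term of the wedge product that belongs to a permutation. -/
def wedgeTerm (φ : TProd d K P [⋀^Fin (ℓ + q)]→ₗ[ℝ] (V →ₗ[ℝ] W))
    (α : (LieAlg d G ⧸ lieSub d P) [⋀^Fin k]→ₗ[ℝ] V)
    (σ : Equiv.Perm (Fin (ℓ + q) ⊕ Fin k)) (Z : Fin (ℓ + (q + k)) → TProd d K P) : W :=
  Equiv.Perm.sign σ •
    φ (fun i => Z (finSumFinEquiv.trans (finCongr (Nat.add_assoc ℓ q k)) (σ (Sum.inl i))))
      (α fun j => (Z (finSumFinEquiv.trans (finCongr (Nat.add_assoc ℓ q k)) (σ (Sum.inr j)))).2)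

theorem lift_summand (φ : TProd d K P [⋀^Fin (ℓ + q)]→ₗ[ℝ] (V →ₗ[ℝ] W))
    (α : (LieAlg d G ⧸ lieSub d P) [⋀^Fin k]→ₗ[ℝ] V)
    (σ : Equiv.Perm (Fin (ℓ + q) ⊕ Fin k)) (Z : Fin (ℓ + (q + k)) → TProd d K P) :
    TensorProduct.lift (LinearMap.id : (V →ₗ[ℝ] W) →ₗ[ℝ] (V →ₗ[ℝ] W))
      (AlternatingMap.domCoprod.summand φ (α.compLinearMap (LinearMap.snd ℝ _ _))
        (Quotient.mk'' σ) (Z ∘ finSumFinEquiv.trans (finCongr (Nat.add_assoc ℓ q k)))) =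
      wedgeTerm φ α σ Z := by
  rw [AlternatingMap.domCoprod.summand_mk'', wedgeTerm, smul_apply,
    MultilinearMap.domDomCongr_apply, MultilinearMap.domCoprod_apply, map_zsmul_unit]
  rfl

theorem wedgePullback_eq_sum (φ : TProd d K P [⋀^Fin (ℓ + q)]→ₗ[ℝ] (V →ₗ[ℝ] W))
    (α : (LieAlg d G ⧸ lieSub d P) [⋀^Fin k]→ₗ[ℝ] V) (Z : Fin (ℓ + (q + k)) → TProd d K P) :
    wedgePullback φ α Z = ∑ c : Equiv.Perm.ModSumCongr (Fin (ℓ + q)) (Fin k),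
      TensorProduct.lift (LinearMap.id : (V →ₗ[ℝ] W) →ₗ[ℝ] (V →ₗ[ℝ] W))
        (AlternatingMap.domCoprod.summand φ (α.compLinearMap (LinearMap.snd ℝ _ _)) c
          (Z ∘ finSumFinEquiv.trans (finCongr (Nat.add_assoc ℓ q k)))) := by
  rw [wedgePullback, AlternatingMap.domDomCongr_apply, LinearMap.compAlternatingMap_apply,
    AlternatingMap.domCoprod_apply, sum_apply, map_sum]

theorem wedgePullback_apply (φ : TProd d K P [⋀^Fin (ℓ + q)]→ₗ[ℝ] (V →ₗ[ℝ] W))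
    (α : (LieAlg d G ⧸ lieSub d P) [⋀^Fin k]→ₗ[ℝ] V) (Z : Fin (ℓ + (q + k)) → TProd d K P) :
    wedgePullback φ α Z = ∑ c : Equiv.Perm.ModSumCongr (Fin (ℓ + q)) (Fin k),
      wedgeTerm φ α c.out Z := by
  rw [wedgePullback_eq_sum]
  refine Finset.sum_congr rfl fun c _ => ?_
  rw [← lift_summand]
  congr 3
  exact (Quotient.out_eq' c).symm

theorem wedgePullback_sub (φ φ' : TProd d K P [⋀^Fin (ℓ + q)]→ₗ[ℝ] (V →ₗ[ℝ] W))
    (α : (LieAlg d G ⧸ lieSub d P) [⋀^Fin k]→ₗ[ℝ] V) (Z : Fin (ℓ + (q + k)) → TProd d K P) :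
    wedgePullback (φ - φ') α Z = wedgePullback φ α Z - wedgePullback φ' α Z := by
  simp only [wedgePullback_apply, ← Finset.sum_sub_distrib, wedgeTerm, AlternatingMap.sub_apply,
    LinearMap.sub_apply, smul_sub]

theorem wedgePullback_add_right (φ : TProd d K P [⋀^Fin (ℓ + q)]→ₗ[ℝ] (V →ₗ[ℝ] W))
    (α α' : (LieAlg d G ⧸ lieSub d P) [⋀^Fin k]→ₗ[ℝ] V) (Z : Fin (ℓ + (q + k)) → TProd d K P) :
    wedgePullback φ (α + α') Z = wedgePullback φ α Z + wedgePullback φ α' Z := by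
  simp only [wedgePullback_apply, ← Finset.sum_add_distrib, wedgeTerm, AlternatingMap.add_apply,
    map_add, smul_add]

theorem wedgePullback_smul_right (φ : TProd d K P [⋀^Fin (ℓ + q)]→ₗ[ℝ] (V →ₗ[ℝ] W)) (c : ℝ)
    (α : (LieAlg d G ⧸ lieSub d P) [⋀^Fin k]→ₗ[ℝ] V) (Z : Fin (ℓ + (q + k)) → TProd d K P) :
    wedgePullback φ (c • α) Z = c • wedgePullback φ α Z := by
  simp only [wedgePullback_apply, Finset.smul_sum, wedgeTerm, AlternatingMap.smul_apply,
    map_smul]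
  exact Finset.sum_congr rfl fun _ _ => smul_comm _ _ _

/-- The wedge product is compatible with the changes of the arguments and of the values. -/
theorem wedgePullback_equivariant {φ φ' : TProd d K P [⋀^Fin (ℓ + q)]→ₗ[ℝ] (V →ₗ[ℝ] W)}
    {α α' : (LieAlg d G ⧸ lieSub d P) [⋀^Fin k]→ₗ[ℝ] V} (T : W →ₗ[ℝ] W)
    (L₁ : (LieAlg d G ⧸ lieSub d K) → (LieAlg d G ⧸ lieSub d K))
    (L₂ : (LieAlg d G ⧸ lieSub d P) → (LieAlg d G ⧸ lieSub d P))
    (h : ∀ Z Y, φ' Z (α' Y) = T (φ (fun i => (L₁ (Z i).1, L₂ (Z i).2)) (α fun j => L₂ (Y j))))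
    (Z : Fin (ℓ + (q + k)) → TProd d K P) :
    wedgePullback φ' α' Z = T (wedgePullback φ α fun i => (L₁ (Z i).1, L₂ (Z i).2)) := by
  simp only [wedgePullback_apply, map_sum, wedgeTerm, h]
  refine Finset.sum_congr rfl fun c _ => ?_
  rw [map_zsmul_unit]

/-- Nondegeneracy of the wedge pairing in complementary degrees: to detect the coefficient of `φ` at
`q` basis vectors of `𝔤/𝔭`, wedge with the product of the `k` complementary coordinates. -/
theorem eq_zero_of_fibrePart_eq_zero
    (hn : Module.finrank ℝ (LieAlg d G ⧸ lieSub d P) = q + k)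
    {φ : TProd d K P [⋀^Fin (ℓ + q)]→ₗ[ℝ] (V →ₗ[ℝ] W)}
    (hφ : HasBidegree (Submodule.prod ⊤ ⊥) (Submodule.prod ⊥ ⊤) ℓ φ)
    (h : ∀ (α : (LieAlg d G ⧸ lieSub d P) [⋀^Fin k]→ₗ[ℝ] V) (X : Fin ℓ → LieAlg d G ⧸ lieSub d K)
      (Y : Fin (q + k) → LieAlg d G ⧸ lieSub d P), fibrePart (wedgePullback φ α) X Y = 0) :
    φ = 0 := by
  classical
  let eB := Module.finBasisOfFinrankEq ℝ _ hn
  refine eq_zero_of_hasBidegree eB hφ fun X y hy => LinearMap.ext fun v => ?_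
  obtain ⟨β, hβ⟩ := exists_perm_extending hy
  let p : (LieAlg d G ⧸ lieSub d P) →ₗ[ℝ] (Fin k → ℝ) :=
    LinearMap.pi fun j => eB.coord (β (Fin.natAdd q j))
  let α : (LieAlg d G ⧸ lieSub d P) [⋀^Fin k]→ₗ[ℝ] V :=
    (LinearMap.toSpanSingleton ℝ V v).compAlternatingMap
      ((Pi.basisFun ℝ (Fin k)).det.compLinearMap p)
  let Y : Fin (q + k) → LieAlg d G ⧸ lieSub d P := fun i => eB (β i)
  let Z : Fin (ℓ + (q + k)) → TProd d K P :=
    Fin.append (fun i => (X i, 0)) (fun j => (0, Y j))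
  let ε := (finSumFinEquiv (m := ℓ + q) (n := k)).trans (finCongr (Nat.add_assoc ℓ q k))
  have hp1 : ∀ j, p (eB (β (Fin.castAdd k j))) = 0 := by
    intro j
    funext i
    have : Fin.castAdd k j ≠ Fin.natAdd q i := by
      intro h'; have := congrArg Fin.val h'; simp at this; omega
    simp [p, this]
  have hp2 : ∀ j, p (eB (β (Fin.natAdd q j))) = Pi.basisFun ℝ (Fin k) j := by
    intro j
    funext i
    simp [p, Finsupp.single_apply, Pi.single_apply, eq_comm]
  have hZ1 : ∀ i : Fin ℓ, Z (ε (Sum.inl (Fin.castAdd q i))) = (X i, 0) := by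
    intro i
    have : ε (Sum.inl (Fin.castAdd q i)) = Fin.castAdd (q + k) i := by ext; simp [ε]
    simp only [Z, this, Fin.append_left]
  have hZ2 : ∀ j : Fin q, Z (ε (Sum.inl (Fin.natAdd ℓ j))) = (0, eB (β (Fin.castAdd k j))) := by
    intro j
    have : ε (Sum.inl (Fin.natAdd ℓ j)) = Fin.natAdd ℓ (Fin.castAdd k j) := by ext; simp [ε]
    simp only [Z, this, Fin.append_right, Y]
  have hZ3 : ∀ j : Fin k, Z (ε (Sum.inr j)) = (0, eB (β (Fin.natAdd q j))) := by
    intro j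
    have : ε (Sum.inr j) = Fin.natAdd ℓ (Fin.natAdd q j) := by ext; simp [ε, add_assoc]
    simp only [Z, this, Fin.append_right, Y]
  have hp0 : ∀ i : Fin (ℓ + q), p (Z (ε (Sum.inl i))).2 = 0 := by
    intro i
    refine Fin.addCases (fun i => ?_) (fun j => ?_) i
    · rw [hZ1]; simp
    · rw [hZ2]; exact hp1 j
  have hsum : fibrePart (wedgePullback φ α) X Y = wedgeTerm φ α 1 Z := by
    rw [fibrePart, wedgePullback_eq_sum, ← lift_summand]
    refine Finset.sum_eq_single _ (fun c _ hc => ?_) (fun h' => absurd (Finset.mem_univ _) h')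
    induction c using Quotient.inductionOn' with | _ σ
    rw [lift_summand]
    -- Outside the trivial coset some argument of `α` comes from the first block, and all vectors of
    -- that block are killed by `p`; only the trivial shuffle contributes.
    obtain ⟨j, i, hij⟩ : ∃ j i, σ (Sum.inr j) = Sum.inl i := by
      by_contra hcon
      push Not at hcon
      refine hc (Quotient.sound' ?_)
      rw [QuotientGroup.leftRel_apply, mul_one]
      refine Subgroup.inv_mem _ (Equiv.Perm.mem_sumCongrHom_range_of_perm_mapsTo_inl
        ((Equiv.Perm.perm_mapsTo_inl_iff_mapsTo_inr σ).2 ?_))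
      rintro _ ⟨j, rfl⟩
      rcases hσ : σ (Sum.inr j) with i | j'
      · exact absurd hσ (hcon j i)
      · exact ⟨j', rfl⟩
    rw [wedgeTerm]
    have hα0 : (α fun j => (Z (ε (σ (Sum.inr j)))).2) = 0 := by
      have : ((Pi.basisFun ℝ (Fin k)).det fun j => p (Z (ε (σ (Sum.inr j)))).2) = 0 :=
        AlternatingMap.map_coord_zero _ j (by rw [hij]; exact hp0 i)
      simp only [α, LinearMap.compAlternatingMap_apply, AlternatingMap.compLinearMap_apply]
      rw [this, map_zero]
    have : (α fun j => ((Fin.append (fun i => ((X i, 0) : TProd d K P)) (fun j => (0, Y j)))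
        (ε (σ (Sum.inr j)))).2) = 0 := hα0
    rw [this, map_zero, smul_zero]
  have h1 := h α X Y
  rw [hsum, wedgeTerm] at h1
  simp only [Equiv.Perm.sign_one, one_smul, Equiv.Perm.one_apply] at h1
  have h2 : (α fun j => (Z (ε (Sum.inr j))).2) = v := by
    simp only [α, LinearMap.compAlternatingMap_apply, AlternatingMap.compLinearMap_apply]
    have : (fun j => p (Z (ε (Sum.inr j))).2) = Pi.basisFun ℝ (Fin k) := by
      funext j; rw [hZ3]; exact hp2 j
    rw [this, Module.Basis.det_self]; simp
  have h3 : (fun i => Z (ε (Sum.inl i))) =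
      Fin.append (fun i => (X i, 0)) (fun j => (0, eB (y j))) := by
    funext i
    refine Fin.addCases (fun i => ?_) (fun j => ?_) i
    · rw [hZ1, Fin.append_left]
    · rw [hZ2, Fin.append_right, hβ]
  rw [LinearMap.zero_apply, ← h3]
  exact (congrArg _ h2.symm).trans h1

end Wedge

/-! ### Smoothness of multilinear expressions -/

section Smoothness

variable {EM HM M : Type*} [NormedAddCommGroup EM] [NormedSpace ℝ EM]
    [TopologicalSpace HM] {I : ModelWithCorners ℝ EM HM} [TopologicalSpace M] [ChartedSpace HM M]
variable {V : Type*} [NormedAddCommGroup V] [NormedSpace ℝ V]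
variable {W : Type*} [NormedAddCommGroup W] [NormedSpace ℝ W]
variable {L : Type*} [AddCommGroup L] [Module ℝ L]

variable (I) in
/-- Smoothness at a point of a function with values in a finite dimensional vector space, tested
by the linear functionals. -/
def WeakSmoothAt (y : M → L) (x : M) : Prop :=
  ∀ f : L →ₗ[ℝ] ℝ, ContMDiffAt I 𝓘(ℝ, ℝ) ∞ (fun x => f (y x)) x

theorem ContMDiffAt.weakSmoothAt [FiniteDimensional ℝ V] {y : M → V} {x : M}
    (hy : ContMDiffAt I 𝓘(ℝ, V) ∞ y x) (T : V →ₗ[ℝ] L) : WeakSmoothAt I (fun x => T (y x)) x :=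
  fun f => (LinearMap.toContinuousLinearMap (f ∘ₗ T)).contMDiff.contMDiffAt.comp x hy

theorem WeakSmoothAt.prodMk {L' : Type*} [AddCommGroup L'] [Module ℝ L'] {y : M → L} {y' : M → L'}
    {x : M} (hy : WeakSmoothAt I y x) (hy' : WeakSmoothAt I y' x) :
    WeakSmoothAt I (fun x => (y x, y' x)) x := by
  intro f
  have h : ∀ p : L × L', f p = (f ∘ₗ LinearMap.inl ℝ L L') p.1 + (f ∘ₗ LinearMap.inr ℝ L L') p.2 := by
    intro p
    simp only [LinearMap.comp_apply, ← map_add]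
    simp
  simp only [h]
  exact (hy _).add (hy' _)

/-- Expanding the arguments in a basis leaves a finite sum of products of smooth coordinates with
values of `f` on fixed vectors. Weak smoothness of the arguments is enough, so `L` needs no norm. -/
theorem contMDiffAt_alternating_apply [FiniteDimensional ℝ L] {r : ℕ} {f : M → L [⋀^Fin r]→ₗ[ℝ] W}
    {y : Fin r → M → L} {x : M} (hf : ∀ Z, ContMDiffAt I 𝓘(ℝ, W) ∞ (fun x => f x Z) x)
    (hy : ∀ i, WeakSmoothAt I (y i) x) :
    ContMDiffAt I 𝓘(ℝ, W) ∞ (fun x => f x fun i => y i x) x := by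
  let b := Module.finBasis ℝ L
  have h : ∀ x, (f x fun i => y i x) = ∑ r : Fin r → Fin (Module.finrank ℝ L),
      (∏ i, b.coord (r i) (y i x)) • f x (fun i => b (r i)) := by
    intro x
    have h1 : (fun i => y i x) = fun i => ∑ j, b.coord j (y i x) • b j := by
      funext i; exact (b.sum_repr (y i x)).symm
    conv_lhs => rw [h1]
    have h2 := (f x).toMultilinearMap.map_sum (fun i j => b.coord j (y i x) • b j)
    refine h2.trans (Finset.sum_congr rfl fun r _ => ?_)
    exact (f x).toMultilinearMap.map_smul_univ (fun i => b.coord (r i) (y i x)) (fun i => b (r i))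
  simp only [h]
  refine contMDiffAt_finsetSum fun r _ => ?_
  exact (contMDiffAt_finsetProd fun i _ => hy i _).smul (hf _)

theorem contMDiffAt_hom_apply [FiniteDimensional ℝ V] {T : M → V →ₗ[ℝ] W} {f : M → V} {x : M}
    (hT : ∀ v, ContMDiffAt I 𝓘(ℝ, W) ∞ (fun x => T x v) x) (hf : ContMDiffAt I 𝓘(ℝ, V) ∞ f x) :
    ContMDiffAt I 𝓘(ℝ, W) ∞ (fun x => T x (f x)) x := by
  let b := Module.finBasis ℝ V
  have h : ∀ x, T x (f x) = ∑ i, b.coord i (f x) • T x (b i) := by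
    intro x
    conv_lhs => rw [← b.sum_repr (f x), map_sum]
    simp
  simp only [h]
  exact contMDiffAt_finsetSum fun i _ => (ContMDiffAt.weakSmoothAt hf LinearMap.id (b.coord i)).smul (hT _)

end Smoothness

/-! ### The isotropy representation on `𝔤/𝔥` -/

section Adjoint

variable {d : ℕ} {G : Type*} [TopologicalSpace G] [ChartedSpace (EuclideanSpace ℝ (Fin d)) G]
  [Group G]

theorem exists_quo_section (H : Subgroup G) :
    ∃ S : (LieAlg d G ⧸ lieSub d H) →ₗ[ℝ] Euc d, ∀ z, quo d H (S z) = z := by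
  obtain ⟨S, hS⟩ := (quo d H).exists_rightInverse_of_surjective
    (LinearMap.range_eq_top.2 (quo_surjective H))
  exact ⟨S, fun z => LinearMap.congr_fun hS z⟩

/-- The action of `a` on `𝔤/𝔥` induced by `Ad(a)`, for `a ∈ H`. -/
def AdQ (H : Subgroup G) (a : G) :
    (LieAlg d G ⧸ lieSub d H) →ₗ[ℝ] (LieAlg d G ⧸ lieSub d H) :=
  quo d H ∘ₗ (AdL (d := d) a).toLinearMap ∘ₗ (exists_quo_section H).choose

variable [LieGroup (𝓡 d) ∞ G] [T2Space G] {H : Subgroup G}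

theorem AdQ_quo (hH : IsClosed (H : Set G)) {a : G} (ha : a ∈ H) (X : Euc d) :
    AdQ H a (quo d H X) = quo d H (AdL a X) := by
  set S := (exists_quo_section (d := d) H).choose with hS
  have h1 : quo d H (S (quo d H X) - X) = 0 := by
    rw [map_sub, (exists_quo_section (d := d) H).choose_spec, sub_self]
  have h2 := quo_eq_zero.2 (AdL_mem_lieS hH ha (quo_eq_zero.1 h1))
  rw [map_sub, map_sub, sub_eq_zero] at h2
  exact h2

theorem AdQ_mk (hH : IsClosed (H : Set G)) {a : G} (ha : a ∈ H) (X : LieAlg d G) :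
    AdQ H a (mk d H X) = mk d H (Ad a X) := by
  rw [Ad_eq]; exact AdQ_quo hH ha X

theorem AdQ_one (hH : IsClosed (H : Set G)) (z : LieAlg d G ⧸ lieSub d H) : AdQ H 1 z = z := by
  obtain ⟨X, rfl⟩ := quo_surjective H z
  rw [AdQ_quo hH H.one_mem, AdL_one]; rfl

theorem AdQ_mul (hH : IsClosed (H : Set G)) {a b : G} (ha : a ∈ H) (hb : b ∈ H)
    (z : LieAlg d G ⧸ lieSub d H) : AdQ H (a * b) z = AdQ H a (AdQ H b z) := by
  obtain ⟨X, rfl⟩ := quo_surjective H z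
  rw [AdQ_quo hH (H.mul_mem ha hb), AdQ_quo hH hb, AdQ_quo hH ha, AdL_mul]; rfl

theorem weakSmoothAt_AdQ {EM HM M : Type*} [NormedAddCommGroup EM] [NormedSpace ℝ EM]
    [TopologicalSpace HM] {I : ModelWithCorners ℝ EM HM} [TopologicalSpace M] [ChartedSpace HM M]
    {a : M → G} {x : M} (ha : ContMDiffAt I (𝓡 d) ∞ a x) (z : LieAlg d G ⧸ lieSub d H) :
    WeakSmoothAt I (fun x => AdQ H (a x) z) x := by
  have h1 : ContMDiffAt I 𝓘(ℝ, Euc d →L[ℝ] Euc d) ∞ (fun x => AdL (d := d) (a x)) x :=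
    ContMDiffAt.comp (g := AdL (d := d)) x contMDiff_AdL.contMDiffAt ha
  exact ContMDiffAt.weakSmoothAt
    (h1.clm_apply (contMDiffAt_const (c := (exists_quo_section (d := d) H).choose z))) (quo d H)

theorem det_AdQ {n : ℕ} (e : Module.Basis (Fin n) ℝ (LieAlg d G ⧸ lieSub d H))
    (hH : IsClosed (H : Set G)) {b : G} (hb : b ∈ H) :
    e.det (fun i => AdQ H b (e i)) = (AdE e b).det := by
  choose X hX using fun i => quo_surjective (d := d) H (e i)
  have h1 : (fun i => AdQ H b (e i)) = fun i => quo d H (AdL b (X i)) := by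
    funext i; rw [← hX, AdQ_quo hH hb]
  rw [h1]
  refine det_eq_of_quoE e _ _ fun i => ?_
  rw [← AdE_quoE e hH hb]
  congr 1
  ext j
  rw [quoE_apply, hX]
  simp [Finsupp.single_apply, eq_comm]

/-- Testing the invariant orientation on the basis `e` multiplies a nonzero number by this
determinant without changing its sign. -/
theorem det_AdE_pos {n : ℕ} (e : Module.Basis (Fin n) ℝ (LieAlg d G ⧸ lieSub d H))
    (hH : IsClosed (H : Set G)) {o : Orientation ℝ (LieAlg d G ⧸ lieSub d H) (Fin n)}
    (ho : IsInvariantOrientation o) {b : G} (hb : b ∈ H) : 0 < (AdE e b).det := by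
  choose X hX using fun i => quo_surjective (d := d) H (e i)
  have h1 := ho b hb X
  have h2 : (fun i => mk d H (Ad b (X i))) = fun i => AdQ H b (e i) := by
    funext i; rw [← hX]; exact (AdQ_mk hH hb (X i)).symm
  have h3 : (fun i => mk d H (X i)) = e := funext hX
  rw [h2, h3, alternating_eq_det_smul e, det_AdQ e hH hb, smul_eq_mul, sign_mul] at h1
  have h4 := someVector_basis_ne_zero e o
  rcases lt_trichotomy (AdE e b).det 0 with h | h | h
  · rcases lt_or_gt_of_ne h4 with h5 | h5 <;> simp [sign_neg h, sign_neg, sign_pos, h5] at h1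
  · rw [h] at h1
    rcases lt_or_gt_of_ne h4 with h5 | h5 <;> simp [sign_neg, sign_pos, h5] at h1
  · exact h

end Adjoint

/-! ### Equivariance conditions in terms of quotient vectors -/

section Equivariance

variable {d : ℕ} {G : Type*} [TopologicalSpace G] [ChartedSpace (EuclideanSpace ℝ (Fin d)) G]
  [Group G] [LieGroup (𝓡 d) ∞ G] [T2Space G] {K P H : Subgroup G} {ℓ q k : ℕ}
variable {V : Type*} [NormedAddCommGroup V] [NormedSpace ℝ V]
variable {W : Type*} [NormedAddCommGroup W] [NormedSpace ℝ W]
variable {ρV : Representation ℝ P V} {ρW : Representation ℝ K W}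

theorem isForm_equivariant_iff {ρ : Representation ℝ H V} (hH : IsClosed (H : Set G))
    {η : G → (LieAlg d G ⧸ lieSub d H) [⋀^Fin k]→ₗ[ℝ] V} :
    (∀ (g : G) (h : H) (X : Fin k → LieAlg d G),
      η (g * h) (fun i => mk d H (X i)) = ρ h⁻¹ (η g (fun i => mk d H (Ad (h : G) (X i))))) ↔
    ∀ (g : G) (h : H) (Z : Fin k → LieAlg d G ⧸ lieSub d H),
      η (g * h) Z = ρ h⁻¹ (η g (fun i => AdQ H (h : G) (Z i))) := by
  constructor
  · intro hη g h Z
    obtain ⟨X, rfl⟩ : ∃ X : Fin k → LieAlg d G, (fun i => mk d H (X i)) = Z := by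
      choose X hX using fun i => quo_surjective (d := d) H (Z i)
      exact ⟨X, funext hX⟩
    simp only [AdQ_mk hH h.2]
    exact hη g h X
  · intro hη g h X
    rw [hη]
    simp only [AdQ_mk hH h.2]

theorem isKernelForm_equivariant_iff (hK : IsClosed (K : Set G)) (hP : IsClosed (P : Set G))
    {φ : G × G → TProd d K P [⋀^Fin (ℓ + q)]→ₗ[ℝ] (V →ₗ[ℝ] W)} :
    (∀ (g₁ g₂ : G) (a : K) (b : P) (X Y : Fin (ℓ + q) → LieAlg d G),
      φ (g₁ * a, g₂ * b) (fun i => (mk d K (X i), mk d P (Y i))) =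
        ρW a⁻¹ ∘ₗ
          φ (g₁, g₂) (fun i => (mk d K (Ad (a : G) (X i)), mk d P (Ad (b : G) (Y i)))) ∘ₗ
            ρV b) ↔
    ∀ (g₁ g₂ : G) (a : K) (b : P) (Z : Fin (ℓ + q) → TProd d K P),
      φ (g₁ * a, g₂ * b) Z =
        ρW a⁻¹ ∘ₗ φ (g₁, g₂) (fun i => (AdQ K (a : G) (Z i).1, AdQ P (b : G) (Z i).2)) ∘ₗ ρV b := by
  constructor
  · intro hη g₁ g₂ a b Z
    obtain ⟨X, Y, rfl⟩ : ∃ X Y : Fin (ℓ + q) → LieAlg d G,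
        (fun i => (mk d K (X i), mk d P (Y i))) = Z := by
      choose X hX using fun i => quo_surjective (d := d) K (Z i).1
      choose Y hY using fun i => quo_surjective (d := d) P (Z i).2
      exact ⟨X, Y, funext fun i => Prod.ext (hX i) (hY i)⟩
    simp only [AdQ_mk hK a.2, AdQ_mk hP b.2]
    exact hη g₁ g₂ a b X Y
  · intro hη g₁ g₂ a b X Y
    rw [hη]
    simp only [AdQ_mk hK a.2, AdQ_mk hP b.2]

end Equivariance

/-! ### Integral operators defined by kernels -/

section Operators

variable {d : ℕ} {G : Type*} [TopologicalSpace G] [ChartedSpace (EuclideanSpace ℝ (Fin d)) G]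
  [Group G] {K P : Subgroup G} {ℓ q k : ℕ}
variable {V : Type*} [NormedAddCommGroup V] [NormedSpace ℝ V]
variable {W : Type*} [NormedAddCommGroup W] [NormedSpace ℝ W]
variable {ρV : Representation ℝ P V} {ρW : Representation ℝ K W}
variable (e : Module.Basis (Fin (q + k)) ℝ (LieAlg d G ⧸ lieSub d P))
variable (o : Orientation ℝ (LieAlg d G ⧸ lieSub d P) (Fin (q + k)))

/-- The density on `G/P` whose integral is the value at `(g₁, X)` of the fibre integral of the form
`φ ∧ π_P^*α`. -/
def fibreDensity [LieGroup (𝓡 d) ∞ G] (φ : G × G → TProd d K P [⋀^Fin (ℓ + q)]→ₗ[ℝ] (V →ₗ[ℝ] W))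
    (α : G → (LieAlg d G ⧸ lieSub d P) [⋀^Fin k]→ₗ[ℝ] V) (g₁ : G)
    (X : Fin ℓ → LieAlg d G ⧸ lieSub d K) (g₂ : G) : W :=
  orientSign e o • fibrePart (wedgePullback (φ (g₁, g₂)) (α g₂)) X e

theorem fibrePart_equivariant {φ φ' : TProd d K P [⋀^Fin (ℓ + q)]→ₗ[ℝ] (V →ₗ[ℝ] W)}
    {α α' : (LieAlg d G ⧸ lieSub d P) [⋀^Fin k]→ₗ[ℝ] V} (T : W →ₗ[ℝ] W)
    (L₁ : (LieAlg d G ⧸ lieSub d K) →ₗ[ℝ] (LieAlg d G ⧸ lieSub d K))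
    (L₂ : (LieAlg d G ⧸ lieSub d P) →ₗ[ℝ] (LieAlg d G ⧸ lieSub d P))
    (h : ∀ Z Y, φ' Z (α' Y) = T (φ (fun i => (L₁ (Z i).1, L₂ (Z i).2)) (α fun j => L₂ (Y j))))
    (X : Fin ℓ → LieAlg d G ⧸ lieSub d K) (Y : Fin (q + k) → LieAlg d G ⧸ lieSub d P) :
    fibrePart (wedgePullback φ' α') X Y =
      T (fibrePart (wedgePullback φ α) (fun i => L₁ (X i)) fun j => L₂ (Y j)) := by
  rw [fibrePart, wedgePullback_equivariant T L₁ L₂ h, fibrePart]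
  congr 2
  funext m
  refine Fin.addCases (fun i => ?_) (fun j => ?_) m
  · simp
  · simp

variable [LieGroup (𝓡 d) ∞ G]

theorem contMDiff_fibreDensity [FiniteDimensional ℝ V]
    {φ : G × G → TProd d K P [⋀^Fin (ℓ + q)]→ₗ[ℝ] (V →ₗ[ℝ] W)}
    (hφ : ∀ Z v, ContMDiff ((𝓡 d).prod (𝓡 d)) 𝓘(ℝ, W) ∞ (fun x : G × G => φ x Z v))
    {α : G → (LieAlg d G ⧸ lieSub d P) [⋀^Fin k]→ₗ[ℝ] V}
    (hα : ∀ Z, ContMDiff (𝓡 d) 𝓘(ℝ, V) ∞ (fun g => α g Z)) (X : Fin ℓ → LieAlg d G ⧸ lieSub d K) :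
    ContMDiff ((𝓡 d).prod (𝓡 d)) 𝓘(ℝ, W) ∞
      fun x : G × G => fibreDensity e o φ α x.1 X x.2 := by
  have hs : ∀ {f : G × G → W} (c : ℝ), ContMDiff ((𝓡 d).prod (𝓡 d)) 𝓘(ℝ, W) ∞ f →
      ContMDiff ((𝓡 d).prod (𝓡 d)) 𝓘(ℝ, W) ∞ fun x => c • f x := fun c hf =>
    (contDiff_const_smul c).contMDiff.comp hf
  simp only [fibreDensity, fibrePart, wedgePullback_apply, wedgeTerm, Units.smul_def,
    ← Int.cast_smul_eq_zsmul ℝ]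
  refine hs _ (contMDiff_finsetSum fun c _ => hs _ fun x => ?_)
  exact contMDiffAt_hom_apply (T := fun x : G × G => φ (x.1, x.2) _) (fun v => hφ _ v x)
    ((hα _).comp contMDiff_snd x)

theorem continuous_fibreDensity [FiniteDimensional ℝ V]
    {φ : G × G → TProd d K P [⋀^Fin (ℓ + q)]→ₗ[ℝ] (V →ₗ[ℝ] W)}
    (hφ : ∀ Z v, ContMDiff ((𝓡 d).prod (𝓡 d)) 𝓘(ℝ, W) ∞ (fun x : G × G => φ x Z v))
    {α : G → (LieAlg d G ⧸ lieSub d P) [⋀^Fin k]→ₗ[ℝ] V}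
    (hα : ∀ Z, ContMDiff (𝓡 d) 𝓘(ℝ, V) ∞ (fun g => α g Z)) (g₁ : G)
    (X : Fin ℓ → LieAlg d G ⧸ lieSub d K) : Continuous (fibreDensity e o φ α g₁ X) := by
  have h1 := (contMDiff_fibreDensity e o hφ hα X).continuous
  have h2 : Continuous fun g₂ : G => (g₁, g₂) := by fun_prop
  refine (h1.comp h2).congr fun g₂ => ?_
  rw [Function.comp_apply]

theorem fibreDensity_translate (φ : G × G → TProd d K P [⋀^Fin (ℓ + q)]→ₗ[ℝ] (V →ₗ[ℝ] W))
    (α : Omega d P ρV k) (x g₁ g₂ : G) (X : Fin ℓ → LieAlg d G ⧸ lieSub d K) :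
    fibreDensity e o φ (Omega.translate x α).1 (x * g₁) X (x * g₂) =
      fibreDensity e o (fun y => φ (x * y.1, x * y.2)) α.1 g₁ X g₂ := by
  simp only [fibreDensity, Omega.translate, inv_mul_cancel_left]

variable [T2Space G]

/-- The action of `b` on `V` cancels between kernel and form. What remains of `b` is its action on
the top form along `G/P`, that is, a determinant. -/
theorem fibreDensity_equivariant (hK : IsClosed (K : Set G)) (hP : IsClosed (P : Set G))
    {φ : G × G → TProd d K P [⋀^Fin (ℓ + q)]→ₗ[ℝ] (V →ₗ[ℝ] W)} (hφ : IsKernelForm K P ρV ρW ℓ q φ)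
    (α : Omega d P ρV k) (g₁ g₂ : G) (a : K) (b : P) (X : Fin ℓ → LieAlg d G ⧸ lieSub d K) :
    fibreDensity e o φ α.1 (g₁ * a) X (g₂ * b) = (AdE e (b : G)).det •
      ρW a⁻¹ (fibreDensity e o φ α.1 g₁ (fun i => AdQ K (a : G) (X i)) g₂) := by
  have h1 := (isKernelForm_equivariant_iff hK hP).1 hφ.equivariant
  have h2 := (isForm_equivariant_iff hP).1 (IsForm.equivariant α.2)
  have h3 := fibrePart_equivariant (φ := φ (g₁, g₂)) (φ' := φ (g₁ * a, g₂ * b)) (α := α.1 g₂)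
    (α' := α.1 (g₂ * b)) (ρW a⁻¹) (AdQ K (a : G)) (AdQ P (b : G)) (fun Z Y => by
      rw [h1, h2]
      simp only [LinearMap.comp_apply]
      rw [← Module.End.mul_apply (ρV b), ← map_mul, mul_inv_cancel, map_one,
        Module.End.one_apply]) X e
  unfold fibreDensity
  rw [h3, ← fibreForm_apply, alternating_eq_det_smul e, det_AdQ e hP b.2, map_smul, map_smul,
    fibreForm_apply, smul_comm]

theorem isDensity_fibreDensity (hK : IsClosed (K : Set G)) (hP : IsClosed (P : Set G))
    {φ : G × G → TProd d K P [⋀^Fin (ℓ + q)]→ₗ[ℝ] (V →ₗ[ℝ] W)} (hφ : IsKernelForm K P ρV ρW ℓ q φ)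
    (α : Omega d P ρV k) (g₁ : G) (X : Fin ℓ → LieAlg d G ⧸ lieSub d K) :
    IsDensity e (fibreDensity e o φ α.1 g₁ X) := by
  intro g₂ b hb
  have h := fibreDensity_equivariant e o hK hP hφ α g₁ g₂ 1 ⟨b, hb⟩ X
  simpa only [Subgroup.coe_one, mul_one, inv_one, map_one, AdQ_one hK,
    Module.End.one_apply] using h

theorem fibreDensity_mul_left (hK : IsClosed (K : Set G)) (hP : IsClosed (P : Set G))
    {φ : G × G → TProd d K P [⋀^Fin (ℓ + q)]→ₗ[ℝ] (V →ₗ[ℝ] W)} (hφ : IsKernelForm K P ρV ρW ℓ q φ)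
    (α : Omega d P ρV k) (g₁ g₂ : G) (a : K) (X : Fin ℓ → LieAlg d G ⧸ lieSub d K) :
    fibreDensity e o φ α.1 (g₁ * a) X g₂ =
      ρW a⁻¹ (fibreDensity e o φ α.1 g₁ (fun i => AdQ K (a : G) (X i)) g₂) := by
  have h := fibreDensity_equivariant e o hK hP hφ α g₁ g₂ a 1 X
  have h1 : (AdE e (1 : G)).det = 1 := by rw [AdE_one e hP]; simp [ContinuousLinearMap.det]
  simpa only [Subgroup.coe_one, mul_one, h1, one_smul] using h

/-- A kernel defines an operator between spaces of forms. -/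
theorem exists_integralOperator [FiniteDimensional ℝ V] [FiniteDimensional ℝ W]
    (hK : IsClosed (K : Set G)) (hP : IsClosed (P : Set G)) (A : Atlas d P (q + k))
    {φ : G × G → TProd d K P [⋀^Fin (ℓ + q)]→ₗ[ℝ] (V →ₗ[ℝ] W)}
    (hφ : IsKernelForm K P ρV ρW ℓ q φ) :
    ∃ Φ : Omega d P ρV k →ₗ[ℝ] Omega d K ρW ℓ, ∀ α g₁ X,
      (Φ α).1 g₁ X = A.integral e (fibreDensity e o φ α.1 g₁ X) := by
  have : CompleteSpace W := FiniteDimensional.complete ℝ W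
  have hc : ∀ (α : Omega d P ρV k) g₁ X, Continuous (fibreDensity e o φ α.1 g₁ X) :=
    fun α g₁ X => continuous_fibreDensity e o hφ.smooth (IsForm.smooth α.2) g₁ X
  have hsmul : ∀ (c : ℝ) {F : G → W}, Continuous F →
      A.integral e (fun g => c • F g) = c • A.integral e F := fun c F hF =>
    A.integral_comp (c • ContinuousLinearMap.id ℝ W) hF
  let η : Omega d P ρV k → G → (LieAlg d G ⧸ lieSub d K) [⋀^Fin ℓ]→ₗ[ℝ] W := fun α g₁ =>
    { toFun := fun X => A.integral e (fibreDensity e o φ α.1 g₁ X)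
      map_update_add' := by
        intro inst X i x x'
        rw [← A.integral_add (hc α g₁ _) (hc α g₁ _)]
        congr 1
        funext g₂
        unfold fibreDensity
        simp only [← baseForm_apply, AlternatingMap.map_update_add, smul_add]
      map_update_smul' := by
        intro inst X i c x
        rw [← hsmul c (hc α g₁ _)]
        congr 1
        funext g₂
        unfold fibreDensity
        simp only [← baseForm_apply, AlternatingMap.map_update_smul]
        rw [smul_comm]
      map_eq_zero_of_eq' := by
        intro X i j hij hne
        -- Written as a scalar multiple, so that homogeneity of the integral gives the value `0`.
        have : fibreDensity e o φ α.1 g₁ X = fun _ => (0 : ℝ) • (0 : W) := by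
          funext g₂
          unfold fibreDensity
          rw [← baseForm_apply, AlternatingMap.map_eq_zero_of_eq _ X hij hne, smul_zero, smul_zero]
        rw [this, hsmul _ continuous_const, zero_smul] }
  have hη : ∀ α g₁ X, η α g₁ X = A.integral e (fibreDensity e o φ α.1 g₁ X) := fun _ _ _ => rfl
  have hmem : ∀ α, IsForm d K ρW ℓ (η α) := fun α =>
    { smooth := fun X => A.contMDiff_integral
        (contMDiff_fibreDensity e o hφ.smooth (IsForm.smooth α.2) X)
      equivariant := (isForm_equivariant_iff hK).2 fun g a X => by
        rw [hη, hη]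
        have h1 : fibreDensity e o φ α.1 (g * a) X = fun g₂ =>
            LinearMap.toContinuousLinearMap (ρW a⁻¹)
              (fibreDensity e o φ α.1 g (fun i => AdQ K (a : G) (X i)) g₂) :=
          funext fun g₂ => fibreDensity_mul_left e o hK hP hφ α g g₂ a X
        rw [h1, A.integral_comp _ (hc α _ _)]
        rfl }
  refine ⟨⟨⟨fun α => ⟨η α, hmem α⟩, fun α α' => ?_⟩, fun c α => ?_⟩, hη⟩
  · refine Subtype.ext (funext fun g₁ => AlternatingMap.ext fun X => ?_)
    show η (α + α') g₁ X = η α g₁ X + η α' g₁ X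
    rw [hη, hη, hη, ← A.integral_add (hc α g₁ X) (hc α' g₁ X)]
    congr 1
    funext g₂
    unfold fibreDensity
    rw [← smul_add]
    congr 1
    exact wedgePullback_add_right _ _ _ _
  · refine Subtype.ext (funext fun g₁ => AlternatingMap.ext fun X => ?_)
    show η (c • α) g₁ X = c • η α g₁ X
    rw [hη, hη, ← hsmul c (hc α g₁ X)]
    congr 1
    funext g₂
    unfold fibreDensity
    rw [smul_comm]
    congr 1
    exact wedgePullback_smul_right _ _ _ _

/-- `HasIntegral` allows a different atlas for every `α`, `g₁` and `X`. Independence of the atlas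
replaces all of them by one fixed `A`, which makes the integral linear and translatable. -/
theorem isIntegralOperator_iff [FiniteDimensional ℝ V]
    (hK : IsClosed (K : Set G)) (hP : IsClosed (P : Set G)) (hpos : ∀ b ∈ P, 0 < (AdE e b).det)
    (A : Atlas d P (q + k)) {φ : G × G → TProd d K P [⋀^Fin (ℓ + q)]→ₗ[ℝ] (V →ₗ[ℝ] W)}
    (hφ : IsKernelForm K P ρV ρW ℓ q φ) (Φ : Omega d P ρV k →ₗ[ℝ] Omega d K ρW ℓ) :
    IsIntegralOperator o φ Φ ↔
      ∀ α g₁ X, (Φ α).1 g₁ X = A.integral e (fibreDensity e o φ α.1 g₁ X) := by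
  have key : ∀ α g₁ X, HasIntegral o
      (fun g₂ Y => fibrePart (wedgePullback (φ (g₁, g₂)) (α.1 g₂)) X Y) ((Φ α).1 g₁ X) ↔
      ∃ A : Atlas d P (q + k), (Φ α).1 g₁ X = A.integral e (fibreDensity e o φ α.1 g₁ X) :=
    fun α g₁ X => hasIntegral_iff e o
      (fun g₂ => fibreForm (wedgePullback (φ (g₁, g₂)) (α.1 g₂)) X) _
  constructor
  · intro h α g₁ X
    obtain ⟨A', hA'⟩ := (key α g₁ X).1 (h α g₁ X)
    rw [hA']
    exact Atlas.integral_eq hP hpos A' A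
      (continuous_fibreDensity e o hφ.smooth (IsForm.smooth α.2) g₁ X)
      (isDensity_fibreDensity e o hK hP hφ α g₁ X)
  · intro h α g₁ X
    exact (key α g₁ X).2 ⟨A, h α g₁ X⟩

theorem IsKernelForm.translate {φ : G × G → TProd d K P [⋀^Fin (ℓ + q)]→ₗ[ℝ] (V →ₗ[ℝ] W)}
    (hφ : IsKernelForm K P ρV ρW ℓ q φ) (x : G) :
    IsKernelForm K P ρV ρW ℓ q fun y => φ (x * y.1, x * y.2) where
  smooth Z v := (hφ.smooth Z v).comp
    ((contMDiff_mul_left.comp contMDiff_fst).prodMk (contMDiff_mul_left.comp contMDiff_snd))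
  equivariant g₁ g₂ a b X Y := by
    simp only [← mul_assoc]
    exact hφ.equivariant _ _ a b X Y
  bidegree y := hφ.bidegree _

theorem IsKernelForm.sub {φ φ' : G × G → TProd d K P [⋀^Fin (ℓ + q)]→ₗ[ℝ] (V →ₗ[ℝ] W)}
    (hφ : IsKernelForm K P ρV ρW ℓ q φ) (hφ' : IsKernelForm K P ρV ρW ℓ q φ') :
    IsKernelForm K P ρV ρW ℓ q fun y => φ y - φ' y where
  smooth Z v := (hφ.smooth Z v).sub (hφ'.smooth Z v)
  equivariant g₁ g₂ a b X Y := by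
    rw [AlternatingMap.sub_apply, hφ.equivariant, hφ'.equivariant, AlternatingMap.sub_apply,
      LinearMap.sub_comp, LinearMap.comp_sub]
  bidegree y s Z h1 h2 h3 := by
    rw [AlternatingMap.sub_apply, hφ.bidegree y s Z h1 h2 h3, hφ'.bidegree y s Z h1 h2 h3, sub_zero]

/-- The integral operators of a kernel and of its translates. -/
theorem integral_fibreDensity_translate [FiniteDimensional ℝ V]
    (hK : IsClosed (K : Set G)) (hP : IsClosed (P : Set G)) (hpos : ∀ b ∈ P, 0 < (AdE e b).det)
    (A : Atlas d P (q + k)) {φ : G × G → TProd d K P [⋀^Fin (ℓ + q)]→ₗ[ℝ] (V →ₗ[ℝ] W)}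
    (hφ : IsKernelForm K P ρV ρW ℓ q φ) (α : Omega d P ρV k) (x g₁ : G)
    (X : Fin ℓ → LieAlg d G ⧸ lieSub d K) :
    A.integral e (fibreDensity e o (fun y => φ (x * y.1, x * y.2)) α.1 g₁ X) =
      A.integral e (fibreDensity e o φ (Omega.translate x α).1 (x * g₁) X) := by
  rw [← A.integral_const_mul hP hpos
    (continuous_fibreDensity e o hφ.smooth (IsForm.smooth (Omega.translate x α).2) _ X)
    (isDensity_fibreDensity e o hK hP hφ _ _ X) x]
  simp only [fibreDensity_translate]

end Operators

/-! ### Test forms, and uniqueness of the kernel -/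

section TestForms

variable {d : ℕ} {G : Type*} [TopologicalSpace G] [ChartedSpace (EuclideanSpace ℝ (Fin d)) G]
  [Group G] [LieGroup (𝓡 d) ∞ G] [T2Space G] {K P : Subgroup G} {ℓ q k n : ℕ}
variable {V : Type*} [NormedAddCommGroup V] [NormedSpace ℝ V] [FiniteDimensional ℝ V]
variable {W : Type*} [NormedAddCommGroup W] [NormedSpace ℝ W]
variable {ρV : Representation ℝ P V} {ρW : Representation ℝ K W}

/-- The forms with prescribed values along a local parametrization. -/
theorem exists_testForm (hP : IsClosed (P : Set G)) (hρV : ∀ v : V, Continuous fun b : P => ρV b v)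
    (hn : Module.finrank ℝ (LieAlg d G ⧸ lieSub d P) = n) {U : Set (Euc n)} {s : Euc n → G}
    (hp : IsLocalParam d P U s) {f : Euc n → ℝ} (hf : ContDiff ℝ ∞ f) (hfc : HasCompactSupport f)
    (hfU : tsupport f ⊆ U) (α₀ : (LieAlg d G ⧸ lieSub d P) [⋀^Fin k]→ₗ[ℝ] V) :
    ∃ α : Omega d P ρV k, SupportedIn P U s α.1 ∧ ∀ u ∈ U, α.1 (s u) = f u • α₀ := by
  classical
  let b : G → G := fun g => (s (coord P U s g))⁻¹ * g
  have hb : ∀ g ∈ sat P U s, b g ∈ P := fun g hg => (coord_mem hg).2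
  -- Equivariance dictates the value at `g = s(u) b` from the value `f u • α₀` at `s u`. Smoothness
  -- in `g` rests on the smoothness of the continuous representation `ρV`.
  let η : G → (LieAlg d G ⧸ lieSub d P) [⋀^Fin k]→ₗ[ℝ] V := fun g =>
    if g ∈ sat P U s then f (coord P U s g) •
      (repG P ρV (b g)⁻¹).toLinearMap.compAlternatingMap (α₀.compLinearMap (AdQ P (b g))) else 0
  have hη : ∀ g ∈ sat P U s, ∀ Z, η g Z =
      f (coord P U s g) • repG P ρV (b g)⁻¹ (α₀ fun i => AdQ P (b g) (Z i)) := by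
    intro g hg Z
    simp only [η, if_pos hg]; rfl
  have hη0 : ∀ g ∉ sat P U s, η g = 0 := fun g hg => if_neg hg
  have hsupp : SupportedIn P U s η := by
    refine ⟨tsupport f, hfU, hfc, fun g hg => ?_⟩
    have hgs : g ∈ sat P U s := by
      by_contra h; exact hg (hη0 g h)
    refine ⟨coord P U s g, ?_, hb g hgs⟩
    refine subset_tsupport f fun h0 => hg (AlternatingMap.ext fun Z => ?_)
    rw [hη g hgs, h0, zero_smul]; rfl
  have hform : IsForm d P ρV k η :=
    { smooth := fun Z => by
        refine hp.contMDiff_of_supportedIn hP (f := fun g => η g Z) ?_ fun g hg => ?_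
        · obtain ⟨C, hC, hCc, h⟩ := hsupp
          exact ⟨C, hC, hCc, fun g hg => h g fun h0 => hg (by
            show η g Z = 0
            rw [h0]; rfl)⟩
        have hc := hp.contMDiffAt_coord hP hn hg
        have hsat := (hp.isOpen_sat hP hn).mem_nhds hg
        have hbs : ContMDiffAt (𝓡 d) (𝓡 d) ∞ b g :=
          (ContMDiffAt.comp (g := s) g (hp.smoothAt (coord_mem hg).1) hc).inv.mul contMDiffAt_id
        have h1 : ContMDiffAt (𝓡 d) 𝓘(ℝ, V →L[ℝ] V) ∞ (fun g => repG P ρV (b g)⁻¹) g :=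
          ContMDiffAt.repG hP ρV hρV hbs.inv (by
            filter_upwards [hsat] with x hx using P.inv_mem (hb x hx))
        have h2 : ContMDiffAt (𝓡 d) 𝓘(ℝ, V) ∞ (fun g => α₀ fun i => AdQ P (b g) (Z i)) g :=
          contMDiffAt_alternating_apply (f := fun _ => α₀) (fun _ => contMDiffAt_const)
            fun i => weakSmoothAt_AdQ hbs (Z i)
        have h3 : ContMDiffAt (𝓡 d) 𝓘(ℝ, ℝ) ∞ (fun g => f (coord P U s g)) g :=
          hf.contMDiff.contMDiffAt.comp g hc
        refine (h3.smul (h1.clm_apply h2)).congr_of_eventuallyEq ?_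
        filter_upwards [hsat] with x hx using hη x hx Z
      equivariant := (isForm_equivariant_iff hP).2 fun g h Z => by
        by_cases hg : g ∈ sat P U s
        · have hbm : b (g * h) = b g * h := by
            simp only [b, hp.coord_mul hg h.2, mul_assoc]
          rw [hη _ ((mem_sat_mul_iff h.2).2 hg), hη g hg, hbm, hp.coord_mul hg h.2, mul_inv_rev,
            repG_mul ρV (P.inv_mem h.2) (P.inv_mem (hb g hg)), map_smul]
          simp only [AdQ_mul hP (hb g hg) h.2]
          congr 1
          exact repG_apply ρV h⁻¹ _
        · rw [hη0 g hg, hη0 _ (fun h' => hg ((mem_sat_mul_iff h.2).1 h'))]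
          simp }
  refine ⟨⟨η, hform⟩, hsupp, fun u hu => AlternatingMap.ext fun Z => ?_⟩
  have h1 : (s u)⁻¹ * s u ∈ P := by simp
  have hc := hp.coord_eq hu h1
  have hbu : b (s u) = 1 := by simp only [b, hc, inv_mul_cancel]
  show η (s u) Z = _
  rw [hη _ ⟨u, hu, h1⟩, hc, hbu, inv_one, repG_one]
  simp only [AdQ_one hP]
  rfl

/-- A kernel is determined by its integral operator. -/
theorem eq_zero_of_integral_eq_zero (hK : IsClosed (K : Set G)) (hP : IsClosed (P : Set G))
    (hρV : ∀ v : V, Continuous fun b : P => ρV b v) [CompleteSpace W]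
    (e : Module.Basis (Fin (q + k)) ℝ (LieAlg d G ⧸ lieSub d P))
    (o : Orientation ℝ (LieAlg d G ⧸ lieSub d P) (Fin (q + k)))
    (hpos : ∀ b ∈ P, 0 < (AdE e b).det)
    (A : Atlas d P (q + k)) {φ : G × G → TProd d K P [⋀^Fin (ℓ + q)]→ₗ[ℝ] (V →ₗ[ℝ] W)}
    (hφ : IsKernelForm K P ρV ρW ℓ q φ)
    (h : ∀ (α : Omega d P ρV k) g₁ X, A.integral e (fibreDensity e o φ α.1 g₁ X) = 0) :
    φ = fun _ => 0 := by
  have hn : Module.finrank ℝ (LieAlg d G ⧸ lieSub d P) = q + k := by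
    simpa using Module.finrank_eq_card_basis e
  funext ⟨g₁, g₂⟩
  refine eq_zero_of_fibrePart_eq_zero hn (hφ.bidegree _) fun α₀ X Y => ?_
  obtain ⟨U, s, hp, h0, rfl⟩ := exists_isLocalParam hP hn g₂
  let F : G → W := fibreDensity e o φ (fun _ => α₀) g₁ X
  have hF : Continuous F := continuous_fibreDensity e o hφ.smooth (fun _ => contMDiff_const) g₁ X
  have hcont : ContinuousOn (fun u => |jac e s u| • F (s u)) U := hp.continuousOn_comp e hF
  -- Fundamental lemma: the test forms show that the chart density for the constant `α₀` integrates
  -- to zero against every bump function on `U`. It vanishes almost everywhere, and by continuity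
  -- also at `0`, the coordinate of `g₂`.
  have hae := hp.isOpen.ae_eq_zero_of_integral_contDiff_smul_eq_zero
    (hcont.locallyIntegrableOn hp.isOpen.measurableSet) (μ := volume) (by
      intro f hf hfc hfU
      obtain ⟨α, hα, hαs⟩ := exists_testForm hP hρV hn hp hf hfc hfU α₀
      have hz : ∀ g, α.1 g = 0 → fibreDensity e o φ α.1 g₁ X g = 0 := by
        intro g hg
        have h1 := wedgePullback_smul_right (φ (g₁, g)) (0 : ℝ) (α.1 g)
        simp only [zero_smul] at h1
        simp only [fibreDensity, fibrePart, hg, h1, smul_zero]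
      have hsupp : SupportedIn P U s (fibreDensity e o φ α.1 g₁ X) := by
        obtain ⟨C, hC, hCc, h⟩ := hα
        exact ⟨C, hC, hCc, fun g hg => h g fun h0 => hg (hz g h0)⟩
      have h2 := h α g₁ X
      rw [A.integral_of_supportedIn hP hpos hp
        (continuous_fibreDensity e o hφ.smooth (IsForm.smooth α.2) g₁ X)
        (isDensity_fibreDensity e o hK hP hφ α g₁ X) hsupp] at h2
      rw [← h2, chartIntegral, ← setIntegral_eq_integral_of_forall_compl_eq_zero (s := U)]
      · refine setIntegral_congr_fun hp.isOpen.measurableSet fun u hu => ?_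
        simp only [F, fibreDensity, fibrePart, hαs u hu, wedgePullback_smul_right]
        rw [smul_comm, smul_comm (f u)]
      · intro u hu
        rw [image_eq_zero_of_notMem_tsupport fun h => hu (hfU h), zero_smul])
  have heq := Measure.eqOn_open_of_ae_eq (μ := volume) (g := fun _ => (0 : W))
    ((ae_restrict_iff' hp.isOpen.measurableSet).2 hae) hp.isOpen hcont continuousOn_const h0
  have h3 : F (s 0) = 0 := by
    rcases smul_eq_zero.1 heq with h4 | h4
    · exact absurd (abs_eq_zero.1 h4) (hp.jac_ne_zero e h0)
    · exact h4
  have h5 : fibrePart (wedgePullback (φ (g₁, s 0)) α₀) X e = 0 := by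
    have := congrArg (fun w => orientSign e o • w) h3
    simpa only [F, fibreDensity, smul_smul, orientSign_mul_self, one_smul, smul_zero] using this
  rw [← fibreForm_apply, alternating_eq_det_smul e, fibreForm_apply, h5, smul_zero]

theorem kernel_unique (hK : IsClosed (K : Set G)) (hP : IsClosed (P : Set G))
    (hρV : ∀ v : V, Continuous fun b : P => ρV b v) [CompleteSpace W]
    (e : Module.Basis (Fin (q + k)) ℝ (LieAlg d G ⧸ lieSub d P))
    (o : Orientation ℝ (LieAlg d G ⧸ lieSub d P) (Fin (q + k)))
    (hpos : ∀ b ∈ P, 0 < (AdE e b).det)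
    (A : Atlas d P (q + k)) {φ φ' : G × G → TProd d K P [⋀^Fin (ℓ + q)]→ₗ[ℝ] (V →ₗ[ℝ] W)}
    (hφ : IsKernelForm K P ρV ρW ℓ q φ) (hφ' : IsKernelForm K P ρV ρW ℓ q φ')
    {Φ : Omega d P ρV k →ₗ[ℝ] Omega d K ρW ℓ}
    (h : IsIntegralOperator o φ Φ) (h' : IsIntegralOperator o φ' Φ) : φ = φ' := by
  rw [isIntegralOperator_iff e o hK hP hpos A hφ] at h
  rw [isIntegralOperator_iff e o hK hP hpos A hφ'] at h'
  have h0 := eq_zero_of_integral_eq_zero hK hP hρV e o hpos A (hφ.sub hφ') fun α g₁ X => by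
    have h1 : ∀ g₂, fibreDensity e o φ α.1 g₁ X g₂ =
        fibreDensity e o (fun y => φ y - φ' y) α.1 g₁ X g₂ + fibreDensity e o φ' α.1 g₁ X g₂ := by
      intro g₂
      simp only [fibreDensity, fibrePart, wedgePullback_sub, smul_sub, sub_add_cancel]
    have h2 := A.integral_add (e := e)
      (continuous_fibreDensity e o (hφ.sub hφ').smooth (IsForm.smooth α.2) g₁ X)
      (continuous_fibreDensity e o hφ'.smooth (IsForm.smooth α.2) g₁ X)
    rw [← funext h1, ← h, ← h'] at h2
    exact add_right_cancel (b := (Φ α).1 g₁ X) (by rw [zero_add]; exact h2.symm)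
  funext y
  exact sub_eq_zero.1 (congrFun h0 y)

end TestForms

/-! ### The splitting `𝔤/𝔪 ≅ 𝔤/𝔨 × 𝔤/𝔭` and transport of invariant elements -/

section TangentSpaces

variable {d : ℕ} {G : Type*} [TopologicalSpace G] [ChartedSpace (EuclideanSpace ℝ (Fin d)) G]
  [Group G] [LieGroup (𝓡 d) ∞ G] [T2Space G] {K P : Subgroup G}

/-- The isomorphism `𝔤/𝔪 ≅ 𝔤/𝔨 × 𝔤/𝔭`. -/
theorem exists_prodEquiv (hK : IsClosed (K : Set G)) (hP : IsClosed (P : Set G))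
    (hKP : lieS d K ⊔ lieS d P = ⊤) :
    ∃ j : (LieAlg d G ⧸ lieSub d (K ⊓ P)) ≃ₗ[ℝ] TProd d K P,
      ∀ X, j (quo d (K ⊓ P) X) = (quo d K X, quo d P X) := by
  let f : Euc d →ₗ[ℝ] TProd d K P := (quo d K).prod (quo d P)
  have hf : Function.Surjective f := by
    rintro ⟨x, y⟩
    obtain ⟨X, rfl⟩ := quo_surjective K x
    obtain ⟨Y, rfl⟩ := quo_surjective P y
    -- If `X - Y = k + p`, then `X - k = Y + p` represents both classes at once.
    obtain ⟨k, hk, p, hp, h⟩ := Submodule.mem_sup.1 (hKP ▸ Submodule.mem_top (x := X - Y))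
    refine ⟨X - k, Prod.ext ?_ ?_⟩
    · show quo d K (X - k) = quo d K X
      rw [map_sub, quo_eq_zero.2 hk, sub_zero]
    · show quo d P (X - k) = quo d P Y
      have : X - k = Y + p := by rw [sub_eq_iff_eq_add, add_assoc, add_comm p k, h]; abel
      rw [this, map_add, quo_eq_zero.2 hp, add_zero]
  have hker : LinearMap.ker (quo d (K ⊓ P)) = LinearMap.ker f := by
    rw [ker_quo, lieS_inf hK hP, LinearMap.ker_prod, ker_quo, ker_quo]
  refine ⟨((quo d (K ⊓ P)).quotKerEquivOfSurjective (quo_surjective _)).symm.trans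
    ((Submodule.quotEquivOfEq _ _ hker).trans (f.quotKerEquivOfSurjective hf)), fun X => ?_⟩
  have h1 : ((quo d (K ⊓ P)).quotKerEquivOfSurjective (quo_surjective _)).symm
      (quo d (K ⊓ P) X) = Submodule.Quotient.mk X := by
    rw [LinearEquiv.symm_apply_eq]; rfl
  rw [LinearEquiv.trans_apply, h1]; rfl

theorem hasBidegree_comp_iff {L L' N : Type*} [AddCommGroup L] [Module ℝ L] [AddCommGroup L']
    [Module ℝ L'] [AddCommGroup N] [Module ℝ N] {r p : ℕ} (j : L ≃ₗ[ℝ] L') {A B : Submodule ℝ L}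
    {A' B' : Submodule ℝ L'} (hA : ∀ z, z ∈ A ↔ j z ∈ A') (hB : ∀ z, z ∈ B ↔ j z ∈ B')
    (φ : L' [⋀^Fin r]→ₗ[ℝ] N) :
    HasBidegree A B p (φ.compLinearMap j.toLinearMap) ↔ HasBidegree A' B' p φ := by
  constructor
  · intro h s Z h1 h2 h3
    have := h s (fun i => j.symm (Z i)) (fun i hi => (hA _).2 (by simpa using h1 i hi))
      (fun i hi => (hB _).2 (by simpa using h2 i hi)) h3
    simpa using this
  · intro h s Z h1 h2 h3
    exact h s (fun i => j (Z i)) (fun i hi => (hA _).1 (h1 i hi))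
      (fun i hi => (hB _).1 (h2 i hi)) h3

variable {ℓ q : ℕ}
variable {V : Type*} [NormedAddCommGroup V] [NormedSpace ℝ V]
variable {W : Type*} [NormedAddCommGroup W] [NormedSpace ℝ W]
variable {ρV : Representation ℝ P V} {ρW : Representation ℝ K W}
variable {j : (LieAlg d G ⧸ lieSub d (K ⊓ P)) ≃ₗ[ℝ] TProd d K P}

theorem exists_lift {H : Subgroup G} {r : ℕ} (Z : Fin r → LieAlg d G ⧸ lieSub d H) :
    ∃ X : Fin r → LieAlg d G, (fun i => mk d H (X i)) = Z := by
  choose X hX using fun i => quo_surjective (d := d) H (Z i)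
  exact ⟨X, funext hX⟩

/-- The isomorphism `j` intertwines the adjoint actions of `M` and carries `𝔭/𝔪` and `𝔨/𝔪` to the
two factors of the product. -/
theorem comp_mem_invariantElements_iff (hK : IsClosed (K : Set G)) (hP : IsClosed (P : Set G))
    (hj : ∀ X, j (quo d (K ⊓ P) X) = (quo d K X, quo d P X))
    (φ : TProd d K P [⋀^Fin (ℓ + q)]→ₗ[ℝ] (V →ₗ[ℝ] W)) :
    φ.compLinearMap j.toLinearMap ∈ invariantElements d ρV ρW ℓ q ↔
      HasBidegree (Submodule.prod ⊤ ⊥) (Submodule.prod ⊥ ⊤) ℓ φ ∧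
        ∀ (a : G) (haK : a ∈ K) (haP : a ∈ P) (Z : Fin (ℓ + q) → TProd d K P),
          φ (fun i => (AdQ K a (Z i).1, AdQ P a (Z i).2)) =
            ρW ⟨a, haK⟩ ∘ₗ φ Z ∘ₗ ρV (⟨a, haP⟩ : P)⁻¹ := by
  have hj' : ∀ X : LieAlg d G, j (mk d (K ⊓ P) X) = (mk d K X, mk d P X) := hj
  have hmap : ∀ H : Subgroup G, ∀ X : Euc d, K ⊓ P ≤ H →
      (quo d (K ⊓ P) X ∈ (lieSub d H).map (lieSub d (K ⊓ P)).mkQ ↔ quo d H X = 0) := by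
    intro H X hH
    rw [quo_eq_zero]
    constructor
    · rintro ⟨(Y : Euc d), hY, hYX⟩
      have hYX' : quo d (K ⊓ P) (X - Y) = 0 := by
        rw [map_sub, sub_eq_zero]; exact hYX.symm
      have h1 : X - Y ∈ lieS d H := by
        rw [quo_eq_zero, lieS_inf hK hP] at hYX'
        have h2 : X - Y ∈ lieS d (K ⊓ P) := by rw [lieS_inf hK hP]; exact hYX'
        refine Submodule.span_mono (R := ℝ) ?_ h2
        rintro Z ⟨γ, h1, h2, h3, h4⟩
        exact ⟨γ, h1, h2, fun t => hH (h3 t), h4⟩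
      have h3 := (lieS d H).add_mem h1 hY
      rwa [sub_add_cancel] at h3
    · intro hX
      exact ⟨X, hX, rfl⟩
  refine and_congr (hasBidegree_comp_iff j (fun z => ?_) (fun z => ?_) φ) ?_
  · obtain ⟨X, rfl⟩ := quo_surjective _ z
    rw [hmap P X inf_le_right, hj]
    simp [Submodule.mem_prod]
  · obtain ⟨X, rfl⟩ := quo_surjective _ z
    rw [hmap K X inf_le_left, hj]
    simp [Submodule.mem_prod]
  · refine forall_congr' fun a => forall_congr' fun haK => forall_congr' fun haP => ?_
    have key : ∀ X : Fin (ℓ + q) → LieAlg d G,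
        (φ.compLinearMap j.toLinearMap) (fun i => mk d (K ⊓ P) (X i)) =
          φ fun i => (mk d K (X i), mk d P (X i)) := fun X => by
      rw [AlternatingMap.compLinearMap_apply]
      congr 1
      funext i
      exact hj' (X i)
    constructor
    · intro h Z
      obtain ⟨X, hX⟩ := exists_lift fun i => j.symm (Z i)
      have hZ : Z = fun i => (mk d K (X i), mk d P (X i)) := by
        funext i
        rw [← hj', congrFun hX i, LinearEquiv.apply_symm_apply]
      have h1 := h X
      rw [key, key, ← hZ] at h1
      rw [← h1, hZ]
      simp only [AdQ_mk hK haK, AdQ_mk hP haP]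
    · intro h X
      rw [key, key, ← h]
      simp only [AdQ_mk hK haK, AdQ_mk hP haP]

theorem isBaseValue_iff (hj : ∀ X, j (quo d (K ⊓ P) X) = (quo d K X, quo d P X))
    (φ : G × G → TProd d K P [⋀^Fin (ℓ + q)]→ₗ[ℝ] (V →ₗ[ℝ] W))
    (φ₀ : (LieAlg d G ⧸ lieSub d (K ⊓ P)) [⋀^Fin (ℓ + q)]→ₗ[ℝ] (V →ₗ[ℝ] W)) :
    IsBaseValue φ φ₀ ↔ φ₀ = (φ (1, 1)).compLinearMap j.toLinearMap := by
  have hj' : ∀ X : LieAlg d G, j (mk d (K ⊓ P) X) = (mk d K X, mk d P X) := hj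
  have key : ∀ X : Fin (ℓ + q) → LieAlg d G,
      ((φ (1, 1)).compLinearMap j.toLinearMap) (fun i => mk d (K ⊓ P) (X i)) =
        φ (1, 1) fun i => (mk d K (X i), mk d P (X i)) := fun X => by
    rw [AlternatingMap.compLinearMap_apply]
    congr 1
    funext i
    exact hj' (X i)
  constructor
  · intro h
    ext1 Z
    obtain ⟨X, rfl⟩ := exists_lift Z
    rw [h X, key]
  · rintro rfl X
    exact key X

end TangentSpaces

/-! ### Invariant kernels and their values at the base point -/

section InvariantKernels

variable {d : ℕ} {G : Type*} [TopologicalSpace G] [ChartedSpace (EuclideanSpace ℝ (Fin d)) G]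
  [Group G] [LieGroup (𝓡 d) ∞ G] [T2Space G] {K P : Subgroup G} {ℓ q : ℕ}
variable {V : Type*} [NormedAddCommGroup V] [NormedSpace ℝ V]
variable {W : Type*} [NormedAddCommGroup W] [NormedSpace ℝ W]
variable {ρV : Representation ℝ P V} {ρW : Representation ℝ K W}

/-- The values at the base point of invariant kernels are invariant under `K ∩ P`. -/
theorem IsKernelForm.base_invariant (hK : IsClosed (K : Set G)) (hP : IsClosed (P : Set G))
    {φ : G × G → TProd d K P [⋀^Fin (ℓ + q)]→ₗ[ℝ] (V →ₗ[ℝ] W)}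
    (hφ : IsKernelForm K P ρV ρW ℓ q φ) (hinv : IsInvariantForm φ) (a : G) (haK : a ∈ K)
    (haP : a ∈ P) (Z : Fin (ℓ + q) → TProd d K P) :
    φ (1, 1) (fun i => (AdQ K a (Z i).1, AdQ P a (Z i).2)) =
      ρW ⟨a, haK⟩ ∘ₗ φ (1, 1) Z ∘ₗ ρV (⟨a, haP⟩ : P)⁻¹ := by
  -- For `a ∈ K ∩ P` the point `(a, a)` is reached from `(1, 1)` both by the right action of `K × P`
  -- and by the diagonal left action; comparing the two gives the invariance.
  have h1 := (isKernelForm_equivariant_iff hK hP).1 hφ.equivariant 1 1 ⟨a, haK⟩ ⟨a, haP⟩ Z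
  have h2 := hinv a 1 1
  simp only [mul_one, one_mul] at h1 h2
  rw [h2] at h1
  ext v
  rw [h1]
  simp only [LinearMap.comp_apply]
  rw [← Module.End.mul_apply (ρW _), ← map_mul, ← Module.End.mul_apply (ρV _), ← map_mul]
  simp

/-- An invariant kernel is determined by its value at the base point. -/
theorem IsKernelForm.eq_of_base_eq (hK : IsClosed (K : Set G)) (hP : IsClosed (P : Set G))
    (hfac : ∀ g : G, ∃ a ∈ K, ∃ b ∈ P, a * b = g)
    {φ φ' : G × G → TProd d K P [⋀^Fin (ℓ + q)]→ₗ[ℝ] (V →ₗ[ℝ] W)}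
    (hφ : IsKernelForm K P ρV ρW ℓ q φ) (hφ' : IsKernelForm K P ρV ρW ℓ q φ')
    (hinv : IsInvariantForm φ) (hinv' : IsInvariantForm φ') (h : φ (1, 1) = φ' (1, 1)) :
    φ = φ' := by
  funext ⟨g₁, g₂⟩
  -- Transitivity: the diagonal action moves `(g₁, g₂)` to `(a⁻¹, b)`, which differs from `(1, 1)`
  -- by the right action of `K × P`.
  obtain ⟨a, ha, b, hb, hab⟩ := hfac (g₁⁻¹ * g₂)
  have h1 : ∀ {ψ : G × G → TProd d K P [⋀^Fin (ℓ + q)]→ₗ[ℝ] (V →ₗ[ℝ] W)}, IsInvariantForm ψ →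
      ψ (g₁, g₂) = ψ (1 * a⁻¹, 1 * b) := by
    intro ψ hψ
    rw [← hψ (a⁻¹ * g₁⁻¹)]
    congr 2
    · group
    · rw [mul_assoc, ← hab]; group
  ext1 Z
  rw [h1 hinv, h1 hinv']
  have h2 := (isKernelForm_equivariant_iff hK hP).1 hφ.equivariant 1 1
    (⟨a, ha⟩ : K)⁻¹ ⟨b, hb⟩ Z
  have h3 := (isKernelForm_equivariant_iff hK hP).1 hφ'.equivariant 1 1
    (⟨a, ha⟩ : K)⁻¹ ⟨b, hb⟩ Z
  rw [h] at h2
  exact h2.trans h3.symm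

variable [FiniteDimensional ℝ V] [FiniteDimensional ℝ W]

/-- The conjugation `T ↦ S ∘ T ∘ R` of homomorphisms. -/
def homConj (S : W →ₗ[ℝ] W) (R : V →ₗ[ℝ] V) : (V →ₗ[ℝ] W) →ₗ[ℝ] (V →ₗ[ℝ] W) where
  toFun T := S ∘ₗ T ∘ₗ R
  map_add' T T' := by ext; simp
  map_smul' c T := by ext; simp

/-- The value at `(a⁻¹, b)` of the invariant kernel with value `φ` at the base point. -/
def kernelAt (ρV : Representation ℝ P V) (ρW : Representation ℝ K W)
    (φ : TProd d K P [⋀^Fin (ℓ + q)]→ₗ[ℝ] (V →ₗ[ℝ] W)) (a b : G) :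
    TProd d K P [⋀^Fin (ℓ + q)]→ₗ[ℝ] (V →ₗ[ℝ] W) :=
  (homConj (repG K ρW a).toLinearMap (repG P ρV b).toLinearMap).compAlternatingMap
    (φ.compLinearMap ((AdQ K a⁻¹).prodMap (AdQ P b)))

theorem kernelAt_apply (φ : TProd d K P [⋀^Fin (ℓ + q)]→ₗ[ℝ] (V →ₗ[ℝ] W)) (a b : G)
    (Z : Fin (ℓ + q) → TProd d K P) (v : V) :
    kernelAt ρV ρW φ a b Z v = repG K ρW a
      (φ (fun i => (AdQ K a⁻¹ (Z i).1, AdQ P b (Z i).2)) (repG P ρV b v)) := rfl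

/-- Two factorisations of the same element into `K` and `P` differ by some `c ∈ K ∩ P`, so this is
exactly the independence of the kernel from the factorisation. -/
theorem kernelAt_mul (hK : IsClosed (K : Set G)) (hP : IsClosed (P : Set G))
    {φ : TProd d K P [⋀^Fin (ℓ + q)]→ₗ[ℝ] (V →ₗ[ℝ] W)}
    (hφ : ∀ (a : G) (haK : a ∈ K) (haP : a ∈ P) (Z : Fin (ℓ + q) → TProd d K P),
      φ (fun i => (AdQ K a (Z i).1, AdQ P a (Z i).2)) =
        ρW ⟨a, haK⟩ ∘ₗ φ Z ∘ₗ ρV (⟨a, haP⟩ : P)⁻¹)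
    {a b c : G} (ha : a ∈ K) (hb : b ∈ P) (hcK : c ∈ K) (hcP : c ∈ P) :
    kernelAt ρV ρW φ (a * c) (c⁻¹ * b) = kernelAt ρV ρW φ a b := by
  ext Z v
  have hcK' := K.inv_mem hcK
  have hcP' := P.inv_mem hcP
  simp only [kernelAt_apply, mul_inv_rev, AdQ_mul hK hcK' (K.inv_mem ha), AdQ_mul hP hcP' hb]
  rw [hφ c⁻¹ hcK' hcP' (fun i => (AdQ K a⁻¹ (Z i).1, AdQ P b (Z i).2))]
  rw [repG_mul ρW ha hcK, repG_mul ρV hcP' hb]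
  simp only [LinearMap.comp_apply, mul_apply_eq_comp]
  rw [repG_apply' ρW hcK, repG_apply' ρV hcP', ← Module.End.mul_apply (ρW _), ← map_mul,
    ← Module.End.mul_apply (ρV _), ← map_mul]
  have e1 : (⟨c, hcK⟩ : K) * ⟨c⁻¹, hcK'⟩ = 1 := Subtype.ext (mul_inv_cancel c)
  rw [e1, inv_mul_cancel, map_one, map_one]; rfl

theorem contMDiffAt_kernelAt {EM HM M : Type*} [NormedAddCommGroup EM] [NormedSpace ℝ EM]
    [TopologicalSpace HM] {I : ModelWithCorners ℝ EM HM} [TopologicalSpace M] [ChartedSpace HM M]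
    (hK : IsClosed (K : Set G)) (hP : IsClosed (P : Set G))
    (hρV : ∀ v : V, Continuous fun b : P => ρV b v)
    (hρW : ∀ w : W, Continuous fun a : K => ρW a w)
    (φ : TProd d K P [⋀^Fin (ℓ + q)]→ₗ[ℝ] (V →ₗ[ℝ] W)) {a b : M → G} {x : M}
    (ha : ContMDiffAt I (𝓡 d) ∞ a x) (hb : ContMDiffAt I (𝓡 d) ∞ b x)
    (haK : ∀ᶠ y in 𝓝 x, a y ∈ K) (hbP : ∀ᶠ y in 𝓝 x, b y ∈ P)
    (Z : Fin (ℓ + q) → TProd d K P) (v : V) :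
    ContMDiffAt I 𝓘(ℝ, W) ∞ (fun y => kernelAt ρV ρW φ (a y) (b y) Z v) x := by
  have h1 := ContMDiffAt.repG hK ρW hρW ha haK
  have h2 := (ContMDiffAt.repG hP ρV hρV hb hbP).clm_apply (contMDiffAt_const (c := v))
  let y : Fin (ℓ + q) → M → TProd d K P := fun i m => (AdQ K (a m)⁻¹ (Z i).1, AdQ P (b m) (Z i).2)
  have hy : ∀ i, WeakSmoothAt I (y i) x := fun i =>
    WeakSmoothAt.prodMk (weakSmoothAt_AdQ ha.inv _) (weakSmoothAt_AdQ hb _)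
  have h3 : ∀ w : V, ContMDiffAt I 𝓘(ℝ, W) ∞ (fun m => φ (fun i => y i m) w) x := fun w =>
    contMDiffAt_alternating_apply
      (f := fun _ : M => (LinearMap.applyₗ (R := ℝ) (M₂ := W) w).compAlternatingMap φ)
      (fun _ => contMDiffAt_const) hy
  exact h1.clm_apply (contMDiffAt_hom_apply (T := fun m => φ fun i => y i m) h3 h2)

/-- Every invariant element is the value at the base point of an invariant kernel. -/
theorem exists_invariant_kernel (hK : IsCompact (K : Set G)) (hP : IsClosed (P : Set G))
    (hKP : lieS d K ⊔ lieS d P = ⊤)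
    (hKG : ∀ g : G, ∃ a ∈ K, a⁻¹ * g ∈ connectedComponent (1 : G))
    (hρV : ∀ v : V, Continuous fun b : P => ρV b v)
    (hρW : ∀ w : W, Continuous fun a : K => ρW a w)
    {φ : TProd d K P [⋀^Fin (ℓ + q)]→ₗ[ℝ] (V →ₗ[ℝ] W)}
    (hbi : HasBidegree (Submodule.prod ⊤ ⊥) (Submodule.prod ⊥ ⊤) ℓ φ)
    (hφ : ∀ (a : G) (haK : a ∈ K) (haP : a ∈ P) (Z : Fin (ℓ + q) → TProd d K P),
      φ (fun i => (AdQ K a (Z i).1, AdQ P a (Z i).2)) =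
        ρW ⟨a, haK⟩ ∘ₗ φ Z ∘ₗ ρV (⟨a, haP⟩ : P)⁻¹) :
    ∃ Ψ : G × G → TProd d K P [⋀^Fin (ℓ + q)]→ₗ[ℝ] (V →ₗ[ℝ] W),
      IsKernelForm K P ρV ρW ℓ q Ψ ∧ IsInvariantForm Ψ ∧ Ψ (1, 1) = φ := by
  have hKc := hK.isClosed
  choose α hα β hβ hαβ using exists_factor (d := d) hK hP hKP hKG
  let Ψ : G × G → TProd d K P [⋀^Fin (ℓ + q)]→ₗ[ℝ] (V →ₗ[ℝ] W) := fun x =>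
    kernelAt ρV ρW φ (α (x.1⁻¹ * x.2)) (β (x.1⁻¹ * x.2))
  -- The chosen `α` and `β` carry no regularity. This freedom to change the factorisation allows a
  -- smooth one near each point and a convenient one in each algebraic check.
  have hΨ : ∀ (x : G × G) (a b : G), a ∈ K → b ∈ P → a * b = x.1⁻¹ * x.2 →
      Ψ x = kernelAt ρV ρW φ a b := by
    intro x a b ha hb hab
    set g := x.1⁻¹ * x.2
    have e1 : a = α g * ((α g)⁻¹ * a) := by group
    have e2 : b = ((α g)⁻¹ * a)⁻¹ * β g := by
      rw [mul_inv_rev, inv_inv, mul_assoc, hαβ, ← hab]; group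
    have hcP : (α g)⁻¹ * a ∈ P := by
      have e3 : (α g)⁻¹ * a = β g * b⁻¹ := by
        rw [eq_mul_inv_iff_mul_eq, mul_assoc, hab, inv_mul_eq_iff_eq_mul, hαβ]
      rw [e3]; exact P.mul_mem (hβ g) (P.inv_mem hb)
    have h := kernelAt_mul hKc hP hφ (hα g) (hβ g) (K.mul_mem (K.inv_mem (hα g)) ha) hcP
    rw [← e2, ← e1] at h
    exact h.symm
  refine ⟨Ψ, ⟨fun Z v x => ?_, ?_, ?_⟩, ?_, ?_⟩
  · obtain ⟨a, b, has, hbs, hab⟩ := exists_smooth_factor (d := d) hK hP hKP hKG (x.1⁻¹ * x.2)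
    have hg : ContMDiffAt ((𝓡 d).prod (𝓡 d)) (𝓡 d) ∞ (fun y : G × G => y.1⁻¹ * y.2) x :=
      (contMDiff_fst.inv.mul contMDiff_snd).contMDiffAt
    have ha' : ContMDiffAt ((𝓡 d).prod (𝓡 d)) (𝓡 d) ∞ (fun y : G × G => a (y.1⁻¹ * y.2)) x :=
      ContMDiffAt.comp (g := a) x has hg
    have hb' : ContMDiffAt ((𝓡 d).prod (𝓡 d)) (𝓡 d) ∞ (fun y : G × G => b (y.1⁻¹ * y.2)) x :=
      ContMDiffAt.comp (g := b) x hbs hg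
    have hev := hg.continuousAt.tendsto.eventually hab
    have h3 := contMDiffAt_kernelAt hKc hP hρV hρW φ ha' hb' (hev.mono fun y hy => hy.1)
      (hev.mono fun y hy => hy.2.1) Z v
    refine h3.congr_of_eventuallyEq ?_
    filter_upwards [hev] with y hy
    rw [hΨ y _ _ hy.1 hy.2.1 hy.2.2]
  · refine (isKernelForm_equivariant_iff hKc hP).2 fun g₁ g₂ a b Z => LinearMap.ext fun v => ?_
    set g := g₁⁻¹ * g₂ with hg
    have ha' := K.inv_mem a.2
    rw [hΨ (g₁ * a, g₂ * b) ((a : G)⁻¹ * α g) (β g * b) (K.mul_mem ha' (hα g))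
      (P.mul_mem (hβ g) b.2) (by
        rw [mul_assoc, ← mul_assoc (α g), hαβ]; simp only [hg]; group),
      hΨ (g₁, g₂) _ _ (hα g) (hβ g) (hαβ g)]
    simp only [LinearMap.comp_apply, kernelAt_apply, mul_inv_rev, inv_inv,
      AdQ_mul hKc (K.inv_mem (hα g)) a.2, AdQ_mul hP (hβ g) b.2]
    rw [repG_mul ρW ha' (hα g), repG_mul ρV (hβ g) b.2]
    simp only [mul_apply_eq_comp]
    rw [repG_apply ρV b v]
    exact repG_apply ρW a⁻¹ _
  · intro x s Z h1 h2 h3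
    ext v
    have h4 := hbi s (fun i => (AdQ K (α (x.1⁻¹ * x.2))⁻¹ (Z i).1, AdQ P (β (x.1⁻¹ * x.2)) (Z i).2))
      (fun i hi => by
        have := h1 i hi
        simp only [Submodule.mem_prod, Submodule.mem_top, Submodule.mem_bot, true_and] at this ⊢
        rw [this, map_zero])
      (fun i hi => by
        have := h2 i hi
        simp only [Submodule.mem_prod, Submodule.mem_top, Submodule.mem_bot, and_true] at this ⊢
        rw [this, map_zero]) h3
    show kernelAt ρV ρW φ _ _ Z v = 0
    rw [kernelAt_apply, h4]; simp
  · intro x g₁ g₂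
    show kernelAt ρV ρW φ _ _ = kernelAt ρV ρW φ _ _
    have : (x * g₁)⁻¹ * (x * g₂) = g₁⁻¹ * g₂ := by group
    simp only [this]
  · ext Z v
    rw [hΨ (1, 1) 1 1 K.one_mem P.one_mem (by simp), kernelAt_apply, repG_one, repG_one, inv_one]
    simp only [AdQ_one hKc, AdQ_one hP]
    rfl

end InvariantKernels

/-! ### The bijection between invariant elements and Poisson transforms -/

section Classification

variable {d : ℕ} {G : Type*} [TopologicalSpace G] [ChartedSpace (EuclideanSpace ℝ (Fin d)) G]
  [Group G] [LieGroup (𝓡 d) ∞ G] [T2Space G] {K P : Subgroup G} {ℓ q k : ℕ}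
variable {V : Type*} [NormedAddCommGroup V] [NormedSpace ℝ V] [FiniteDimensional ℝ V]
variable {W : Type*} [NormedAddCommGroup W] [NormedSpace ℝ W] [FiniteDimensional ℝ W]
variable {ρV : Representation ℝ P V} {ρW : Representation ℝ K W}

/-- The classification of Poisson transforms for a compact subgroup `K` and a closed subgroup `P`
with `𝔤 = 𝔨 + 𝔭`. -/
theorem exists_equiv_poissonTransform (hK : IsCompact (K : Set G)) (hP : IsClosed (P : Set G))
    (hKP : lieS d K ⊔ lieS d P = ⊤)
    (hKG : ∀ g : G, ∃ a ∈ K, a⁻¹ * g ∈ connectedComponent (1 : G))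
    (hρV : ∀ v : V, Continuous fun b : P => ρV b v)
    (hρW : ∀ w : W, Continuous fun a : K => ρW a w)
    (hdim : Module.finrank ℝ (LieAlg d G ⧸ lieSub d P) = q + k)
    (o : Orientation ℝ (LieAlg d G ⧸ lieSub d P) (Fin (q + k)))
    (ho : IsInvariantOrientation o) :
    ∃ e : invariantElements d ρV ρW ℓ q ≃
        {Φ : Omega d P ρV k →ₗ[ℝ] Omega d K ρW ℓ // IsPoissonTransform (q := q) o Φ},
      (∀ φ₀, ∃ φ, IsKernelForm K P ρV ρW ℓ q φ ∧ IsInvariantForm φ ∧ IsBaseValue φ φ₀.1 ∧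
        IsIntegralOperator o φ (e φ₀).1) ∧
      (∀ Φ φ, IsKernelForm K P ρV ρW ℓ q φ → IsIntegralOperator o φ Φ.1 →
        IsInvariantForm φ ∧ IsBaseValue φ (e.symm Φ).1) := by
  have hKc := hK.isClosed
  have : CompleteSpace W := FiniteDimensional.complete ℝ W
  have hfac := exists_factor (d := d) hK hP hKP hKG
  obtain ⟨A⟩ := exists_atlas hP hdim hK hfac
  obtain ⟨j, hj⟩ := exists_prodEquiv hKc hP hKP
  let e := Module.finBasisOfFinrankEq ℝ _ hdim
  have hpos : ∀ b ∈ P, 0 < (AdE e b).det := fun b hb => det_AdE_pos e hP ho hb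
  have hunique : ∀ {φ φ' : G × G → TProd d K P [⋀^Fin (ℓ + q)]→ₗ[ℝ] (V →ₗ[ℝ] W)}
      {Φ : Omega d P ρV k →ₗ[ℝ] Omega d K ρW ℓ}, IsKernelForm K P ρV ρW ℓ q φ →
      IsKernelForm K P ρV ρW ℓ q φ' → IsIntegralOperator o φ Φ → IsIntegralOperator o φ' Φ →
      φ = φ' := fun hφ hφ' h h' => kernel_unique hKc hP hρV e o hpos A hφ hφ' h h'
  -- kernels of equivariant operators are invariant
  have hinvariant : ∀ {φ : G × G → TProd d K P [⋀^Fin (ℓ + q)]→ₗ[ℝ] (V →ₗ[ℝ] W)}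
      {Φ : Omega d P ρV k →ₗ[ℝ] Omega d K ρW ℓ}, IsKernelForm K P ρV ρW ℓ q φ →
      IsIntegralOperator o φ Φ →
      (∀ (x : G) (α : Omega d P ρV k), Φ (Omega.translate x α) = Omega.translate x (Φ α)) →
      IsInvariantForm φ := by
    intro φ Φ hφ h hequiv x g₁ g₂
    have h' : IsIntegralOperator o (fun y => φ (x * y.1, x * y.2)) Φ := by
      rw [isIntegralOperator_iff e o hKc hP hpos A (hφ.translate x)]
      intro α g₁ X
      rw [integral_fibreDensity_translate e o hKc hP hpos A hφ,
        ← (isIntegralOperator_iff e o hKc hP hpos A hφ Φ).1 h, hequiv]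
      simp only [Omega.translate, inv_mul_cancel_left]
    exact congrFun (hunique (hφ.translate x) hφ h' h) (g₁, g₂)
  -- operators with invariant kernels are equivariant
  have hequivariant : ∀ {φ : G × G → TProd d K P [⋀^Fin (ℓ + q)]→ₗ[ℝ] (V →ₗ[ℝ] W)}
      {Φ : Omega d P ρV k →ₗ[ℝ] Omega d K ρW ℓ}, IsKernelForm K P ρV ρW ℓ q φ →
      IsIntegralOperator o φ Φ → IsInvariantForm φ →
      ∀ (x : G) (α : Omega d P ρV k), Φ (Omega.translate x α) = Omega.translate x (Φ α) := by
    intro φ Φ hφ h hinv x α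
    refine Subtype.ext (funext fun g => AlternatingMap.ext fun X => ?_)
    have h1 := (isIntegralOperator_iff e o hKc hP hpos A hφ Φ).1 h
    have h2 := integral_fibreDensity_translate e o hKc hP hpos A hφ α x (x⁻¹ * g) X
    have h3 : (fun y : G × G => φ (x * y.1, x * y.2)) = φ := funext fun y => hinv x y.1 y.2
    rw [h3, mul_inv_cancel_left, ← h1, ← h1] at h2
    exact h2.symm
  have hexists : ∀ φ₀ : invariantElements d ρV ρW ℓ q,
      ∃ (φ : G × G → TProd d K P [⋀^Fin (ℓ + q)]→ₗ[ℝ] (V →ₗ[ℝ] W))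
        (Φ : Omega d P ρV k →ₗ[ℝ] Omega d K ρW ℓ), IsKernelForm K P ρV ρW ℓ q φ ∧
        IsInvariantForm φ ∧ IsBaseValue φ φ₀.1 ∧ IsIntegralOperator o φ Φ := by
    rintro ⟨φ₀, h₀⟩
    -- Transport of `φ₀` to the product, where kernels take their values.
    have hφ₀ : (φ₀.compLinearMap j.symm.toLinearMap).compLinearMap j.toLinearMap = φ₀ := by
      ext1 Z
      simp
    rw [← hφ₀, comp_mem_invariantElements_iff hKc hP hj] at h₀
    obtain ⟨φ, hφ, hinv, hbase⟩ := exists_invariant_kernel hK hP hKP hKG hρV hρW h₀.1 h₀.2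
    obtain ⟨Φ, hΦ⟩ := exists_integralOperator e o hKc hP A hφ
    refine ⟨φ, Φ, hφ, hinv, (isBaseValue_iff hj φ φ₀).2 ?_,
      (isIntegralOperator_iff e o hKc hP hpos A hφ Φ).2 hΦ⟩
    rw [hbase, hφ₀]
  choose φ Φ hφ hinv hbase hop using hexists
  let E : invariantElements d ρV ρW ℓ q →
      {Φ : Omega d P ρV k →ₗ[ℝ] Omega d K ρW ℓ // IsPoissonTransform (q := q) o Φ} := fun φ₀ =>
    ⟨Φ φ₀, ⟨φ φ₀, hφ φ₀, hop φ₀⟩, hequivariant (hφ φ₀) (hop φ₀) (hinv φ₀)⟩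
  have hbij : Function.Bijective E := by
    constructor
    · intro φ₀ φ₁ h
      have h1 : Φ φ₀ = Φ φ₁ := congrArg Subtype.val h
      have h2 := hunique (hφ φ₀) (hφ φ₁) (hop φ₀) (h1 ▸ hop φ₁)
      refine Subtype.ext ?_
      rw [(isBaseValue_iff hj _ _).1 (hbase φ₀), (isBaseValue_iff hj _ _).1 (hbase φ₁), h2]
    · rintro ⟨Ψ, ⟨ψ, hψ, hψo⟩, hΨ⟩
      -- Surjectivity: the given kernel is invariant, so its base value is an invariant element. The
      -- kernel built from that element has the same base value, hence is the same kernel and has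
      -- the same operator.
      have hψi := hinvariant hψ hψo hΨ
      have hmem : (ψ (1, 1)).compLinearMap j.toLinearMap ∈ invariantElements d ρV ρW ℓ q :=
        (comp_mem_invariantElements_iff hKc hP hj _).2
          ⟨hψ.bidegree _, hψ.base_invariant hKc hP hψi⟩
      set φ₀ : invariantElements d ρV ρW ℓ q := ⟨_, hmem⟩ with hφ₀
      have hb : φ φ₀ (1, 1) = ψ (1, 1) := by
        have h1 := (isBaseValue_iff hj _ _).1 (hbase φ₀)
        ext1 Z
        have h2 := DFunLike.congr_fun h1 fun i => j.symm (Z i)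
        simpa [hφ₀] using h2.symm
      have h3 : φ φ₀ = ψ := (hφ φ₀).eq_of_base_eq hKc hP hfac hψ (hinv φ₀) hψi hb
      refine ⟨φ₀, Subtype.ext (LinearMap.ext fun α => Subtype.ext (funext fun g =>
        AlternatingMap.ext fun X => ?_))⟩
      have h4 := (isIntegralOperator_iff e o hKc hP hpos A hψ _).1 (h3 ▸ hop φ₀)
      have h5 := (isIntegralOperator_iff e o hKc hP hpos A hψ _).1 hψo
      exact (h4 α g X).trans (h5 α g X).symm
  refine ⟨Equiv.ofBijective E hbij, fun φ₀ => ⟨φ φ₀, hφ φ₀, hinv φ₀, hbase φ₀, hop φ₀⟩,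
    fun Ψ ψ hψ hψo => ⟨hinvariant hψ hψo Ψ.2.2, ?_⟩⟩
  obtain ⟨φ₀, rfl⟩ := (Equiv.ofBijective E hbij).surjective Ψ
  rw [Equiv.symm_apply_apply, hunique hψ (hφ φ₀) hψo (hop φ₀)]
  exact hbase φ₀

end Classification

end PoissonTransform

end

theorem mainTheorem8 {d : ℕ} {G : Type*} [TopologicalSpace G] [T2Space G]
    [SecondCountableTopology G] [ChartedSpace (EuclideanSpace ℝ (Fin d)) G] [Group G]
    [LieGroup (𝓡 d) ∞ G]
    [LieAlgebra.IsSemisimple ℝ (PoissonTransform.LieAlg d G)]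
    (hcentre : Finite (Subgroup.center G))
    (K P : Subgroup G)
    (hK : PoissonTransform.IsMaximalCompact d K)
    (hKG : ∀ g : G, ∃ a ∈ K, a⁻¹ * g ∈ connectedComponent (1 : G))
    (hP : PoissonTransform.IsParabolic d P)
    {V : Type*} [NormedAddCommGroup V] [NormedSpace ℝ V] [FiniteDimensional ℝ V]
    {W : Type*} [NormedAddCommGroup W] [NormedSpace ℝ W] [FiniteDimensional ℝ W]
    (ρV : Representation ℝ P V) (hρV : ∀ v : V, Continuous fun b : P => ρV b v)
    (ρW : Representation ℝ K W) (hρW : ∀ w : W, Continuous fun a : K => ρW a w)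
    (k ℓ q : ℕ)
    (hdim : Module.finrank ℝ
      (PoissonTransform.LieAlg d G ⧸ PoissonTransform.lieSub d P) = q + k)
    (o : Orientation ℝ
      (PoissonTransform.LieAlg d G ⧸ PoissonTransform.lieSub d P) (Fin (q + k)))
    (ho : PoissonTransform.IsInvariantOrientation o) :
    ∃ e : PoissonTransform.invariantElements d ρV ρW ℓ q ≃
        {Φ : PoissonTransform.Omega d P ρV k →ₗ[ℝ] PoissonTransform.Omega d K ρW ℓ //
          PoissonTransform.IsPoissonTransform (q := q) o Φ},
      (∀ φ₀, ∃ φ, PoissonTransform.IsKernelForm K P ρV ρW ℓ q φ ∧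
        PoissonTransform.IsInvariantForm φ ∧
        PoissonTransform.IsBaseValue φ φ₀.1 ∧
        PoissonTransform.IsIntegralOperator o φ (e φ₀).1) ∧
      (∀ Φ φ, PoissonTransform.IsKernelForm K P ρV ρW ℓ q φ →
        PoissonTransform.IsIntegralOperator o φ Φ.1 →
        PoissonTransform.IsInvariantForm φ ∧
        PoissonTransform.IsBaseValue φ (e.symm Φ).1) := by
  -- The Cartan involution and the grading enter through `𝔤 = 𝔨 + 𝔭`.
  exact PoissonTransform.exists_equiv_poissonTransform hK.1.prop hP.1
    (PoissonTransform.lieS_sup_eq_top hK hP) hKG hρV hρW hdim o ho
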